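/- **Lemma (Euler–Lagrange equations).** Identify functions on $\mathbb T^3=\mathbb R^3/\mathbb Z^3$ with $\mathbb Z^3$-periodic functions on $\mathbb R^3$, let $G_h(z)=(4\pi h)^{-3/2}e^{-|z|^2/(4h)}$ for $z\in\mathbb R^3$, $h>0$, and $(G_h\ast f)(x)=\int_{\mathbb R^3}G_h(z)f(x-z)\,dz$. For every $h>0$ let $u^0=u^{0,h},u^1=u^{1,h},\dots:\mathbb T^3\to\mathbb S^1\subset\mathbb R^2$ be measurable maps generated by the thresholding scheme with step size $h$, that is, for every $n\ge1$ and almost every $x$ with $(G_h\ast u^{n-1})(x)\neq0$, $$u^n(x)=\frac{(G_h\ast u^{n-1})(x)}{|(G_h\ast u^{n-1})(x)|}$$ (the choice of $u^n(x)\in\mathbb S^1$ is arbitrary where $G_h\ast u^{n-1}$ vanishes). Assume that the initial data (which may be independent of $h$) satisfy, with a constant $C$ and for all sufficiently small $h>0$, $$E_h(u^0):=\frac1h\int_{\mathbb T^3}\bigl(1-u^0\cdot G_h\ast u^0\bigr)\,dx\le C\,|\log h| .$$ Let $u^h(x,t)=u^n(x)$ for $t\in[nh,(n+1)h)$, $n\ge0$,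 and $u^h(x,t)=u^0(x)$ for $t<0$; for $\tau\ne0$ let $\partial_t^{\tau}v(t)=\frac{v(t)-v(t-\tau)}{\tau}$. Let $0<T<\infty$, write $\iint dx\,dt=\int_0^T\int_{\mathbb T^3}dx\,dt$, and let $o(1)$ denote a quantity that tends to $0$ as $h\downarrow0$ with $T$, the test function and the family of initial data fixed. (i) For every smooth vector field $\xi:\mathbb T^3\times[0,T]\to\mathbb R^3$, $$2\iint G_{h/2}\ast\partial_t^hu^h\cdot(\xi\cdot\nabla)\,G_{h/2}\ast u^h\,dx\,dt=\frac1h\iint(\nabla\cdot\xi)\bigl(1-u^h\cdot G_h\ast u^h\bigr)\,dx\,dt-2\sum_{i,j=1}^3\iint\partial_i\xi_j\;\partial_iG_{h/2}\ast u^h\cdot\partial_jG_{h/2}\ast u^h\,dx\,dt+o(1).$$ (ii) For every smooth function $\zeta:\mathbb T^3\times[0,T]\to\mathbb R$ and all $i,j\in\{1,2\}$, both for the backward quotient $\tau=h$ and for the forward quotient $\tau=-h$, $$\iint\bigl(u^h_j\,\partial_t^{\tau}G_h\ast u^h_i-u^h_i\,\partial_t^{\tau}G_h\ast u^h_j\bigr)\zeta+\bigl(u^h_j\nabla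 G_h\ast u^h_i-u^h_i\nabla G_h\ast u^h_j\bigr)\cdot\nabla\zeta\,dx\,dt=o(1).$$ -/

import Mathlib

open scoped Topology ContDiff
open MeasureTheory Filter

namespace FilamentThresholding

noncomputable section

/-- The physical space `ℝ³`; functions on the torus `𝕋³ = ℝ³ / ℤ³` are treated as `ℤ³`-periodic
functions on it. -/
abbrev Space : Type := EuclideanSpace ℝ (Fin 3)

/-- The target plane `ℝ²`, which contains the unit circle `𝕊¹`. -/
abbrev Plane : Type := EuclideanSpace ℝ (Fin 2)

/-- `ℤ³`-periodicity, i.e. `f` is (the lift of) a function on `𝕋³`. -/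
def PeriodicZ3 {F : Type*} (f : Space → F) : Prop :=
  ∀ (k : Fin 3) (x : Space), f (x + EuclideanSpace.single k 1) = f x

/-- The fundamental cell `[0,1)³`; the integral over `𝕋³` is the integral over it. -/
def cell : Set Space := {x | ∀ k : Fin 3, x k ∈ Set.Ico (0 : ℝ) 1}

/-- The space-time integral `∫_0^T ∫_{𝕋³} f dx dt`. -/
def spaceTimeIntegral (T : ℝ) (f : ℝ → Space → ℝ) : ℝ :=
  ∫ t in (0 : ℝ)..T, ∫ x in cell, f t x

/-- The heat kernel `G_h(z) = (4πh)^{-3/2} exp(-|z|²/(4h))` on `ℝ³`. -/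
def heatKernel (h : ℝ) (z : Space) : ℝ :=
  1 / (4 * Real.pi * h) ^ ((3 : ℝ) / 2) * Real.exp (-‖z‖ ^ 2 / (4 * h))

/-- The convolution `(G_h ∗ f)(x) = ∫_{ℝ³} G_h(z) f(x - z) dz`. -/
def heatConv {F : Type*} [NormedAddCommGroup F] [NormedSpace ℝ F]
    (h : ℝ) (f : Space → F) : Space → F :=
  convolution (heatKernel h) f (ContinuousLinearMap.lsmul ℝ ℝ) volume

/-- The partial derivative `∂_k f`. -/
def pderiv {F : Type*} [NormedAddCommGroup F] [NormedSpace ℝ F]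
    (k : Fin 3) (f : Space → F) (x : Space) : F :=
  fderiv ℝ f x (EuclideanSpace.single k 1)

/-- The divergence `∇ · X` of a vector field. -/
def divergence (X : Space → Space) (x : Space) : ℝ :=
  ∑ k : Fin 3, pderiv k X x k

/-- The thresholding energy `E_h(u) = (1/h) ∫_{𝕋³} (1 - u · G_h ∗ u) dx`. -/
def energy (h : ℝ) (u : Space → Plane) : ℝ :=
  1 / h * ∫ x in cell, (1 - inner ℝ (u x) (heatConv h u x))

/-- `u 0, u 1, …` is a sequence of measurable maps `𝕋³ → 𝕊¹` produced by the thresholding scheme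
with time step `h`: wherever `v = G_h ∗ u n` does not vanish, `u (n + 1) = v / |v|`. (Where `v`
vanishes the projection is not defined, and any value in `𝕊¹` is admitted there.) As usual for
measurable maps, the pointwise conditions are required almost everywhere. -/
structure IsThresholdingScheme (h : ℝ) (u : ℕ → Space → Plane) : Prop where
  periodic : ∀ n, PeriodicZ3 (u n)
  measurable : ∀ n, AEStronglyMeasurable (u n) volume
  unit : ∀ n, ∀ᵐ x : Space, ‖u n x‖ = 1
  step : ∀ n, ∀ᵐ x : Space, heatConv h (u n) x ≠ 0 →
    u (n + 1) x = (‖heatConv h (u n) x‖)⁻¹ • heatConv h (u n) x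

/-- The piecewise constant interpolation, `u^h(t) = u n` for `t ∈ [n h, (n + 1) h)`. For `t < 0`
the value is `u 0` (the floor of a negative number is the natural number `0`). -/
def interpolation (h : ℝ) (u : ℕ → Space → Plane) (t : ℝ) (x : Space) : Plane :=
  u ⌊t / h⌋₊ x

/-- The difference quotient `∂_t^τ v (t) = (v(t) - v(t - τ)) / τ`: the backward quotient for
`τ = h > 0`, and `(v(t + h) - v(t)) / h` for `τ = -h`. -/
def diffQuot {F : Type*} [AddCommGroup F] [Module ℝ F]
    (τ : ℝ) (v : ℝ → Space → F) (t : ℝ) (x : Space) : F :=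
  τ⁻¹ • (v t x - v (t - τ) x)

/-- Smooth functions on `𝕋³ × [0,T]` (smooth up to the times `0` and `T`). -/
def IsSmoothOnTorus {F : Type*} [NormedAddCommGroup F] [NormedSpace ℝ F]
    (T : ℝ) (f : ℝ → Space → F) : Prop :=
  ContDiffOn ℝ ∞ (fun p : ℝ × Space => f p.1 p.2) (Set.Icc 0 T ×ˢ Set.univ) ∧
    ∀ t ∈ Set.Icc 0 T, PeriodicZ3 (f t)

/-- `2 ∬ G_{h/2} ∗ ∂_t^h w · (ξ · ∇) G_{h/2} ∗ w dx dt`. -/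
def innerLHS (T h : ℝ) (w : ℝ → Space → Plane) (ξ : ℝ → Space → Space) : ℝ :=
  2 * spaceTimeIntegral T fun t x =>
    inner ℝ (heatConv (h / 2) (diffQuot h w t) x)
      (∑ k : Fin 3, ξ t x k • pderiv k (heatConv (h / 2) (w t)) x)

/-- `(1/h) ∬ (∇ · ξ) (1 - w · G_h ∗ w) dx dt
  - 2 ∑_{i,j} ∬ ∂_i ξ_j ∂_i G_{h/2} ∗ w · ∂_j G_{h/2} ∗ w dx dt`. -/
def innerRHS (T h : ℝ) (w : ℝ → Space → Plane) (ξ : ℝ → Space → Space) : ℝ :=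
  1 / h * spaceTimeIntegral T (fun t x =>
      divergence (ξ t) x * (1 - inner ℝ (w t x) (heatConv h (w t) x))) -
    2 * ∑ i : Fin 3, ∑ j : Fin 3, spaceTimeIntegral T (fun t x =>
      pderiv i (ξ t) x j *
        inner ℝ (pderiv i (heatConv (h / 2) (w t)) x) (pderiv j (heatConv (h / 2) (w t)) x))

/-- `∬ (w_j ∂_t^τ G_h ∗ w_i - w_i ∂_t^τ G_h ∗ w_j) ζ
  + (w_j ∇ G_h ∗ w_i - w_i ∇ G_h ∗ w_j) · ∇ζ dx dt`. -/
def outerForm (T h τ : ℝ) (w : ℝ → Space → Plane) (ζ : ℝ → Space → ℝ) (i j : Fin 2) : ℝ :=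
  let g : Fin 2 → ℝ → Space → ℝ := fun m t => heatConv h fun y => w t y m
  spaceTimeIntegral T fun t x =>
    (w t x j * diffQuot τ (g i) t x - w t x i * diffQuot τ (g j) t x) * ζ t x +
      ∑ k : Fin 3, (w t x j * pderiv k (g i t) x - w t x i * pderiv k (g j t) x) *
        pderiv k (ζ t) x

end

end FilamentThresholding

open FilamentThresholding

open scoped Convolution

/-!
Write `A = G_h`, `B = G_{h/2}`, so that `A ∗ f = B ∗ (B ∗ f)`.  Since the thresholded map
`u^{n+1}` maximises `v ↦ ∫ v · A ∗ u^n` among unit maps, the energy does not increase along the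
scheme and the dissipation `h⁻¹ ∑ₙ ∫ |B ∗ (u^{n+1} - u^n)|²` is at most `E_h(u⁰)`.

Inner variation: moving one of the two kernels `B` across the derivative along `ξ` turns the
transport term into the first variation of the energy.  The part pairing `u^{n+1}` with
`A ∗ u^n` is a divergence, because thresholding makes these two vectors parallel, and what is
left are commutators of `ξ` with the convolution.  Outer variation: for the same reason
`u^{n+1}_j (A ∗ u^n)_i` is symmetric in `i`, `j`, and the remaining part is the commutator of `ζ`
with `A ∗`.

The commutators are controlled by expanding `ξ` or `ζ` to first order in the convolution
variable `z` and using that, for unit maps, `∫ G_h(z) |u(x) - u(x - z)|² dz = 2 (1 - u · A ∗ u)(x)`,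
whose integral over the cell is `2 h E_h(u)`.  All errors are thus `O(h^{1/4} (E_h(u⁰) + 1))`,
and `h^{1/4} |log h| → 0`.
-/

namespace FilamentThresholding

noncomputable section

section HeatKernel

variable {h : ℝ}

lemma heatKernel_pos (hh : 0 < h) (z : Space) : 0 < heatKernel h z := by
  unfold heatKernel
  positivity

lemma heatKernel_neg (h : ℝ) (z : Space) : heatKernel h (-z) = heatKernel h z := by
  simp only [heatKernel, norm_neg]

@[fun_prop]
lemma continuous_heatKernel (h : ℝ) : Continuous (heatKernel h) := by
  unfold heatKernel
  fun_prop

lemma heatKernel_eq_exp_mul_sq (h : ℝ) (z : Space) :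
    heatKernel h z = 1 / (4 * Real.pi * h) ^ ((3 : ℝ) / 2) *
      Real.exp (-(1 / (4 * h)) * ‖z‖ ^ 2) := by
  unfold heatKernel
  congr 2
  ring

lemma integral_exp_neg_mul_norm_sq {b : ℝ} (hb : 0 < b) :
    ∫ z : Space, Real.exp (-b * ‖z‖ ^ 2) = (Real.pi / b) ^ ((3 : ℝ) / 2) := by
  simpa using GaussianFourier.integral_rexp_neg_mul_sq_norm (V := Space) hb

lemma integral_heatKernel (hh : 0 < h) : ∫ z, heatKernel h z = 1 := by
  have hpos : 0 < (4 * Real.pi * h) ^ ((3 : ℝ) / 2) := by positivity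
  have hb : Real.pi / (1 / (4 * h)) = 4 * Real.pi * h := by field_simp
  simp_rw [heatKernel_eq_exp_mul_sq h]
  rw [integral_const_mul, integral_exp_neg_mul_norm_sq (by positivity), hb,
    one_div_mul_cancel hpos.ne']

lemma integrable_heatKernel (hh : 0 < h) : Integrable (heatKernel h) :=
  .of_integral_ne_zero (by rw [integral_heatKernel hh]; exact one_ne_zero)

lemma one_div_four_pi_mul_rpow {a b : ℝ} (ha : 0 < a) (hb : 0 < b) :
    1 / (4 * Real.pi * a) ^ ((3 : ℝ) / 2) =
      (b / a) ^ ((3 : ℝ) / 2) * (1 / (4 * Real.pi * b) ^ ((3 : ℝ) / 2)) := by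
  rw [← mul_div_assoc, mul_one, ← Real.div_rpow (by positivity) (by positivity),
    ← Real.one_rpow ((3 : ℝ) / 2), ← Real.div_rpow zero_le_one (by positivity)]
  congr 1
  field_simp

lemma heatKernel_le_rpow_mul_heatKernel {a b : ℝ} (ha : 0 < a) (hab : a ≤ b) (z : Space) :
    heatKernel a z ≤ (b / a) ^ ((3 : ℝ) / 2) * heatKernel b z := by
  have hb : 0 < b := ha.trans_le hab
  rw [heatKernel, heatKernel, one_div_four_pi_mul_rpow ha hb, ← mul_assoc, neg_div, neg_div]
  gcongr

lemma two_rpow_three_halves_le : (2 : ℝ) ^ ((3 : ℝ) / 2) ≤ 3 := by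
  have h2 : √2 * √2 = (2 : ℝ) := Real.mul_self_sqrt zero_le_two
  rw [Real.rpow_div_two_eq_sqrt _ zero_le_two, show (3 : ℝ) = (3 : ℕ) by norm_num,
    Real.rpow_natCast]
  push_cast
  nlinarith [Real.sqrt_two_lt_three_halves]

lemma heatKernel_half_le (hh : 0 < h) (z : Space) :
    heatKernel (h / 2) z ≤ 3 * heatKernel h z := by
  have hle := heatKernel_le_rpow_mul_heatKernel (half_pos hh) (half_le_self hh.le) z
  rw [div_div_cancel₀ hh.ne'] at hle
  have hpos := heatKernel_pos hh z
  exact hle.trans (by gcongr; exact two_rpow_three_halves_le)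

/-- The dimensionless weight `1 + |z|²/h` in which polynomial factors in front of `G_h` are
measured. -/
def weight (h : ℝ) (z : Space) : ℝ := 1 + ‖z‖ ^ 2 / h

lemma one_le_weight (hh : 0 < h) (z : Space) : 1 ≤ weight h z :=
  le_add_of_nonneg_right (by positivity)

@[fun_prop]
lemma continuous_weight (h : ℝ) : Continuous (weight h) := by
  unfold weight
  fun_prop

lemma norm_sq_le_mul_weight (hh : 0 < h) (z : Space) : ‖z‖ ^ 2 ≤ h * weight h z := by
  unfold weight
  field_simp
  linarith

lemma norm_le_sqrt_mul_weight (hh : 0 < h) (z : Space) : ‖z‖ ≤ √h * weight h z := by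
  obtain ⟨s, hs, rfl⟩ : ∃ s, 0 < s ∧ h = s ^ 2 :=
    ⟨√h, Real.sqrt_pos.2 hh, (Real.sq_sqrt hh.le).symm⟩
  rw [Real.sqrt_sq hs.le, weight]
  field_simp
  nlinarith [sq_nonneg (s - ‖z‖)]

/-- A bound for the `n`-th moment `∫ (1 + |z|²/h)ⁿ G_h(z) dz`, uniform in `h`. It comes from
`wⁿ ≤ n! 8ⁿ exp (w / 8)`, which turns `G_h` into a multiple of `G_{2h}`. -/
def gaussianMoment (n : ℕ) : ℝ := 3 * (n.factorial * 8 ^ n * Real.exp (1 / 8))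

lemma weight_pow_mul_heatKernel_le (hh : 0 < h) (n : ℕ) (z : Space) :
    weight h z ^ n * heatKernel h z ≤ gaussianMoment n * heatKernel (2 * h) z := by
  have hexp : weight h z ^ n ≤ n.factorial * 8 ^ n * Real.exp (weight h z / 8) := by
    have hpow := Real.pow_div_factorial_le_exp (weight h z / 8)
      (by linarith [one_le_weight hh z]) n
    rw [div_pow, div_div, div_le_iff₀ (by positivity)] at hpow
    linarith
  have habsorb : Real.exp (weight h z / 8) * heatKernel h z ≤
      3 * (Real.exp (1 / 8) * heatKernel (2 * h) z) := by
    have hexp_mul : Real.exp (weight h z / 8) * Real.exp (-‖z‖ ^ 2 / (4 * h)) =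
        Real.exp (1 / 8) * Real.exp (-‖z‖ ^ 2 / (4 * (2 * h))) := by
      rw [← Real.exp_add, ← Real.exp_add]
      congr 1
      unfold weight
      field_simp
      ring
    rw [heatKernel, heatKernel, mul_left_comm, hexp_mul, mul_left_comm (Real.exp (1 / 8)),
      ← mul_assoc 3, one_div_four_pi_mul_rpow hh (b := 2 * h) (by positivity),
      mul_div_cancel_right₀ _ hh.ne']
    gcongr
    exact two_rpow_three_halves_le
  have hpos := heatKernel_pos hh z
  calc weight h z ^ n * heatKernel h z
      ≤ n.factorial * 8 ^ n * Real.exp (weight h z / 8) * heatKernel h z := by gcongr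
    _ = n.factorial * 8 ^ n * (Real.exp (weight h z / 8) * heatKernel h z) := by ring
    _ ≤ n.factorial * 8 ^ n * (3 * (Real.exp (1 / 8) * heatKernel (2 * h) z)) := by gcongr
    _ = gaussianMoment n * heatKernel (2 * h) z := by unfold gaussianMoment; ring

lemma integrable_weight_pow_mul_heatKernel (hh : 0 < h) (n : ℕ) :
    Integrable (fun z => weight h z ^ n * heatKernel h z) := by
  refine ((integrable_heatKernel (show 0 < 2 * h by positivity)).const_mul (gaussianMoment n)).mono'
    (by fun_prop) (Eventually.of_forall fun z => ?_)
  have hw := one_le_weight hh z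
  have hpos := heatKernel_pos hh z
  rw [Real.norm_of_nonneg (by positivity)]
  exact weight_pow_mul_heatKernel_le hh n z

lemma integral_weight_pow_mul_heatKernel_le (hh : 0 < h) (n : ℕ) :
    ∫ z, weight h z ^ n * heatKernel h z ≤ gaussianMoment n := by
  have h2 : (0 : ℝ) < 2 * h := by positivity
  calc ∫ z, weight h z ^ n * heatKernel h z ≤ ∫ z, gaussianMoment n * heatKernel (2 * h) z :=
        integral_mono (integrable_weight_pow_mul_heatKernel hh n)
          ((integrable_heatKernel h2).const_mul _) (weight_pow_mul_heatKernel_le hh n)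
    _ = gaussianMoment n := by rw [integral_const_mul, integral_heatKernel h2, mul_one]

/-- All estimates below need at most the eighth moment of the heat kernel. -/
def momentConst : ℝ := gaussianMoment 8

lemma one_le_momentConst : 1 ≤ momentConst := by
  have := Real.add_one_le_exp (1 / 8 : ℝ)
  norm_num [momentConst, gaussianMoment, Nat.factorial]
  linarith

lemma momentConst_pos : 0 < momentConst := zero_lt_one.trans_le one_le_momentConst

lemma integral_weight_pow_mul_heatKernel_le_momentConst (hh : 0 < h) {n : ℕ} (hn : n ≤ 8) :
    ∫ z, weight h z ^ n * heatKernel h z ≤ momentConst := by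
  refine (integral_mono (integrable_weight_pow_mul_heatKernel hh n)
    (integrable_weight_pow_mul_heatKernel hh 8) fun z => ?_).trans
    (integral_weight_pow_mul_heatKernel_le hh 8)
  have hpos := heatKernel_pos hh z
  have hw := one_le_weight hh z
  dsimp only
  gcongr

lemma integrable_of_norm_le_weight_mul_heatKernel {F : Type*} [NormedAddCommGroup F] {c : ℝ}
    (hh : 0 < h) {K : Space → F} (hK : AEStronglyMeasurable K volume)
    (hKc : ∀ z, ‖K z‖ ≤ c * (weight h z * heatKernel h z)) : Integrable K := by
  refine ((integrable_weight_pow_mul_heatKernel hh 1).const_mul c).mono' hK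
    (Eventually.of_forall fun z => ?_)
  simpa using hKc z

/-- The partial derivative `∂_k G_h`. -/
def gradKernel (h : ℝ) (k : Fin 3) (z : Space) : ℝ := -(z k / (2 * h)) * heatKernel h z

/-- The second partial derivative `∂_i ∂_j G_h`. -/
def hessKernel (h : ℝ) (i j : Fin 3) (z : Space) : ℝ :=
  (z i * z j / (4 * h ^ 2) - if i = j then 1 / (2 * h) else 0) * heatKernel h z

@[fun_prop]
lemma continuous_gradKernel (h : ℝ) (k : Fin 3) : Continuous (gradKernel h k) := by
  unfold gradKernel
  fun_prop

lemma gradKernel_neg (h : ℝ) (k : Fin 3) (z : Space) :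
    gradKernel h k (-z) = -gradKernel h k z := by
  simp [gradKernel, heatKernel_neg, neg_div]

lemma hasFDerivAt_heatKernel (h : ℝ) (z : Space) :
    HasFDerivAt (heatKernel h) ((-(1 / (2 * h)) * heatKernel h z) • innerSL ℝ z) z := by
  have hsq : HasFDerivAt (fun z : Space => ‖z‖ ^ 2) (2 • innerSL ℝ z) z :=
    (hasStrictFDerivAt_norm_sq z).hasFDerivAt
  rw [funext (heatKernel_eq_exp_mul_sq h)]
  refine (((hsq.const_mul _).exp).const_mul _).congr_fderiv ?_
  ext y
  simp
  ring

lemma fderiv_heatKernel_single (h : ℝ) (k : Fin 3) (z : Space) :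
    fderiv ℝ (heatKernel h) z (EuclideanSpace.single k 1) = gradKernel h k z := by
  rw [(hasFDerivAt_heatKernel h z).fderiv]
  simp [EuclideanSpace.inner_single_right, gradKernel]
  ring

lemma abs_gradKernel_le (hh : 0 < h) (k : Fin 3) (z : Space) :
    |gradKernel h k z| ≤ 1 / √h * (weight h z * heatKernel h z) := by
  have hpos := heatKernel_pos hh z
  have hs := Real.sqrt_pos.2 hh
  have hcoord : |z k| ≤ √h * weight h z :=
    (PiLp.norm_apply_le z k).trans (norm_le_sqrt_mul_weight hh z)
  unfold gradKernel
  rw [abs_mul, abs_neg, abs_div, abs_of_pos hpos, abs_of_pos (show 0 < 2 * h by positivity),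
    ← mul_assoc]
  gcongr
  rw [div_mul_eq_mul_div, one_mul, div_le_div_iff₀ (by positivity) hs]
  calc |z k| * √h ≤ (√h * weight h z) * √h := by gcongr
    _ = h * weight h z := by rw [mul_right_comm, Real.mul_self_sqrt hh.le]
    _ ≤ weight h z * (2 * h) := by nlinarith [one_le_weight hh z]

lemma integrable_gradKernel (hh : 0 < h) (k : Fin 3) : Integrable (gradKernel h k) :=
  integrable_of_norm_le_weight_mul_heatKernel hh (by fun_prop) (abs_gradKernel_le hh k)

lemma integral_gradKernel (h : ℝ) (k : Fin 3) : ∫ z, gradKernel h k z = 0 := by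
  have hodd : ∫ z, gradKernel h k z = ∫ z, gradKernel h k (-z) :=
    (integral_neg_eq_self _ _).symm
  simp_rw [gradKernel_neg, integral_neg] at hodd
  linarith

lemma integrable_coord_mul_coord_mul_heatKernel (hh : 0 < h) (i j : Fin 3) :
    Integrable (fun z : Space => z i * z j * heatKernel h z) := by
  refine integrable_of_norm_le_weight_mul_heatKernel hh (c := h) (by fun_prop) fun z => ?_
  have hpos := heatKernel_pos hh z
  rw [norm_mul, norm_mul, Real.norm_of_nonneg hpos.le, ← mul_assoc]
  refine mul_le_mul_of_nonneg_right ?_ hpos.le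
  calc ‖z i‖ * ‖z j‖ ≤ ‖z‖ * ‖z‖ := by gcongr <;> exact PiLp.norm_apply_le z _
    _ ≤ h * weight h z := by rw [← pow_two]; exact norm_sq_le_mul_weight hh z

lemma integral_coord_mul_gradKernel (hh : 0 < h) (i j : Fin 3) :
    ∫ z : Space, z i * gradKernel h j z = if i = j then -1 else 0 := by
  have hcoord (z : Space) : HasFDerivAt (fun z : Space => z i)
      (EuclideanSpace.proj i : Space →L[ℝ] ℝ) z :=
    (EuclideanSpace.proj i : Space →L[ℝ] ℝ).hasFDerivAt
  have hcoord_single (z : Space) :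
      fderiv ℝ (fun z : Space => z i) z (EuclideanSpace.single j 1) = if i = j then 1 else 0 := by
    rw [(hcoord z).fderiv]
    simp
  have hparts := integral_mul_fderiv_eq_neg_fderiv_mul_of_integrable (μ := volume)
    (f := fun z : Space => z i) (g := heatKernel h) (v := EuclideanSpace.single j 1)
    (by simp_rw [hcoord_single]; exact (integrable_heatKernel hh).const_mul _)
    (by
      simp_rw [fderiv_heatKernel_single]
      refine ((integrable_coord_mul_coord_mul_heatKernel hh i j).const_mul
        (-(1 / (2 * h)))).congr (Eventually.of_forall fun z => ?_)
      simp only [gradKernel]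
      ring)
    (((integrable_gradKernel hh i).const_mul (-(2 * h))).congr
      (Eventually.of_forall fun z => by simp only [gradKernel]; field_simp))
    (fun z _ => (hcoord z).differentiableAt)
    (fun z _ => (hasFDerivAt_heatKernel h z).differentiableAt)
  simp_rw [fderiv_heatKernel_single, hcoord_single, integral_const_mul,
    integral_heatKernel hh] at hparts
  rw [hparts]
  split_ifs <;> simp

lemma integral_coord_mul_coord_mul_heatKernel (hh : 0 < h) (i j : Fin 3) :
    ∫ z : Space, z i * z j * heatKernel h z = if i = j then 2 * h else 0 := by
  calc ∫ z : Space, z i * z j * heatKernel h z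
      = ∫ z : Space, -(2 * h) * (z i * gradKernel h j z) := by
        congr 1 with z
        unfold gradKernel
        field_simp
    _ = if i = j then 2 * h else 0 := by
        rw [integral_const_mul, integral_coord_mul_gradKernel hh]
        split_ifs <;> ring

lemma hessKernel_eq_sub (h : ℝ) (i j : Fin 3) (z : Space) :
    hessKernel h i j z = (1 / (4 * h ^ 2)) * (z i * z j * heatKernel h z) -
      (if i = j then 1 / (2 * h) else 0) * heatKernel h z := by
  unfold hessKernel
  ring

lemma integrable_hessKernel (hh : 0 < h) (i j : Fin 3) : Integrable (hessKernel h i j) := by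
  simp_rw [funext (hessKernel_eq_sub h i j)]
  exact ((integrable_coord_mul_coord_mul_heatKernel hh i j).const_mul _).sub
    ((integrable_heatKernel hh).const_mul _)

lemma integral_hessKernel (hh : 0 < h) (i j : Fin 3) : ∫ z, hessKernel h i j z = 0 := by
  simp_rw [hessKernel_eq_sub]
  rw [integral_sub ((integrable_coord_mul_coord_mul_heatKernel hh i j).const_mul _)
    ((integrable_heatKernel hh).const_mul _), integral_const_mul, integral_const_mul,
    integral_heatKernel hh, integral_coord_mul_coord_mul_heatKernel hh]
  split_ifs
  · field_simp
    norm_num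
  · simp

-- Completing the square, centred at the midpoint of `0` and `x`.
lemma heatKernel_half_mul_heatKernel_half (hh : 0 < h) (x y : Space) :
    heatKernel (h / 2) (y + (1 / 2 : ℝ) • x) * heatKernel (h / 2) (x - (y + (1 / 2 : ℝ) • x)) =
      heatKernel h x * heatKernel (h / 4) y := by
  have hparallelogram : ‖y + (1 / 2 : ℝ) • x‖ ^ 2 + ‖x - (y + (1 / 2 : ℝ) • x)‖ ^ 2 =
      ‖x‖ ^ 2 / 2 + 2 * ‖y‖ ^ 2 := by
    rw [show x - (y + (1 / 2 : ℝ) • x) = (1 / 2 : ℝ) • x - y by module, norm_add_sq_real,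
      norm_sub_sq_real, norm_smul, real_inner_comm]
    norm_num
    ring
  have hprefactor : 1 / (4 * Real.pi * (h / 2)) ^ ((3 : ℝ) / 2) *
      (1 / (4 * Real.pi * (h / 2)) ^ ((3 : ℝ) / 2)) =
      1 / (4 * Real.pi * h) ^ ((3 : ℝ) / 2) * (1 / (4 * Real.pi * (h / 4)) ^ ((3 : ℝ) / 2)) := by
    rw [div_mul_div_comm, div_mul_div_comm, ← Real.mul_rpow (by positivity) (by positivity),
      ← Real.mul_rpow (by positivity) (by positivity)]
    congr 2
    ring
  unfold heatKernel
  rw [mul_mul_mul_comm, mul_mul_mul_comm _ (Real.exp (-‖x‖ ^ 2 / (4 * h))), ← Real.exp_add,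
    ← Real.exp_add, hprefactor]
  congr 2
  field_simp
  linear_combination -2 * hparallelogram

lemma integral_heatKernel_half_mul_heatKernel_half (hh : 0 < h) (x : Space) :
    ∫ y, heatKernel (h / 2) y * heatKernel (h / 2) (x - y) = heatKernel h x := by
  rw [← integral_add_right_eq_self _ ((1 / 2 : ℝ) • x)]
  simp_rw [heatKernel_half_mul_heatKernel_half hh x]
  rw [integral_const_mul, integral_heatKernel (by positivity), mul_one]

lemma gradKernel_half_mul_gradKernel_half (hh : 0 < h) (i j : Fin 3) (x y : Space) :
    gradKernel (h / 2) i (y + (1 / 2 : ℝ) • x) *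
      gradKernel (h / 2) j (x - (y + (1 / 2 : ℝ) • x)) =
      1 / h ^ 2 * heatKernel h x * (x i * x j / 4 * heatKernel (h / 4) y +
        (-(h * x j / 4) * gradKernel (h / 4) i y + h * x i / 4 * gradKernel (h / 4) j y) -
        y i * y j * heatKernel (h / 4) y) := by
  unfold gradKernel
  rw [mul_mul_mul_comm, heatKernel_half_mul_heatKernel_half hh x y]
  simp only [PiLp.add_apply, PiLp.sub_apply, PiLp.smul_apply, smul_eq_mul]
  field_simp
  ring

lemma integral_gradKernel_half_mul_gradKernel_half (hh : 0 < h) (i j : Fin 3) (x : Space) :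
    ∫ y, gradKernel (h / 2) i y * gradKernel (h / 2) j (x - y) = hessKernel h i j x := by
  have h4 : 0 < h / 4 := by positivity
  have hheat := (integrable_heatKernel h4).const_mul (x i * x j / 4)
  have hgrad_i := (integrable_gradKernel h4 i).const_mul (-(h * x j / 4))
  have hgrad_j := (integrable_gradKernel h4 j).const_mul (h * x i / 4)
  rw [← integral_add_right_eq_self _ ((1 / 2 : ℝ) • x)]
  simp_rw [gradKernel_half_mul_gradKernel_half hh]
  rw [integral_const_mul,
    integral_sub (by exact hheat.add (hgrad_i.add hgrad_j))
      (integrable_coord_mul_coord_mul_heatKernel h4 i j),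
    integral_add hheat (by exact hgrad_i.add hgrad_j), integral_add hgrad_i hgrad_j]
  simp_rw [integral_const_mul, integral_heatKernel h4, integral_gradKernel,
    integral_coord_mul_coord_mul_heatKernel h4]
  unfold hessKernel
  split_ifs <;> field_simp <;> ring

end HeatKernel

/-- The standard basis of `ℝ³`, as the basis of the lattice `ℤ³`. -/
abbrev stdBasis : Module.Basis (Fin 3) ℝ Space := (EuclideanSpace.basisFun (Fin 3) ℝ).toBasis

lemma cell_eq_fundamentalDomain : cell = ZSpan.fundamentalDomain stdBasis := by
  ext x
  simp [cell, ZSpan.mem_fundamentalDomain]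

lemma isAddFundamentalDomain_cell :
    IsAddFundamentalDomain (Submodule.span ℤ (Set.range stdBasis)) cell
      (volume : Measure Space) := by
  rw [cell_eq_fundamentalDomain]
  exact ZSpan.isAddFundamentalDomain _ _

lemma volume_cell : volume cell = 1 := by
  rw [cell_eq_fundamentalDomain,
    measure_congr (ZSpan.fundamentalDomain_ae_parallelepiped stdBasis volume)]
  simpa using (EuclideanSpace.basisFun (Fin 3) ℝ).volume_parallelepiped

instance isProbabilityMeasure_restrict_cell :
    IsProbabilityMeasure ((volume : Measure Space).restrict cell) :=
  ⟨by simp [volume_cell]⟩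

namespace PeriodicZ3

variable {E F H : Type*} {f : Space → F} {g : Space → H}

lemma comp_sub (hf : PeriodicZ3 f) (z : Space) : PeriodicZ3 fun x => f (x - z) := fun k x => by
  dsimp only
  rw [add_sub_right_comm, hf k]

lemma comp (hf : PeriodicZ3 f) (φ : F → H) : PeriodicZ3 fun x => φ (f x) := fun k x => by
  dsimp only
  rw [hf k x]

lemma comp₂ (hf : PeriodicZ3 f) (hg : PeriodicZ3 g) (φ : F → H → E) :
    PeriodicZ3 fun x => φ (f x) (g x) := fun k x => by
  dsimp only
  rw [hf k x, hg k x]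

lemma add_of_mem_span (hf : PeriodicZ3 f) {v : Space}
    (hv : v ∈ Submodule.span ℤ (Set.range stdBasis)) (x : Space) : f (x + v) = f x := by
  induction hv using Submodule.span_induction generalizing x with
  | mem v hv =>
    obtain ⟨k, rfl⟩ := hv
    simpa using hf k x
  | zero => simp
  | add v w _ _ hv hw => rw [← add_assoc, hw, hv]
  | smul n v _ hv =>
    have hneg (x : Space) : f (x - v) = f x := by rw [← hv (x - v), sub_add_cancel]
    induction n using Int.induction_on generalizing x with
    | zero => simp
    | succ n ih => rw [add_smul, one_smul, ← add_assoc, hv, ih]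
    | pred n ih => rw [sub_smul, one_smul, ← add_sub_assoc, hneg, ih]

lemma exists_mem_closedBall_eq (hf : PeriodicZ3 f) (x : Space) :
    ∃ y ∈ Metric.closedBall (0 : Space) 3, f x = f y := by
  refine ⟨ZSpan.fract stdBasis x, by simpa using ZSpan.norm_fract_le stdBasis x, ?_⟩
  have hx : x = ZSpan.fract stdBasis x + (ZSpan.floor stdBasis x : Space) := by
    rw [ZSpan.fract_apply, sub_add_cancel]
  conv_lhs => rw [hx]
  exact hf.add_of_mem_span (ZSpan.floor stdBasis x).2 _

lemma exists_norm_le [SeminormedAddCommGroup F] (hf : PeriodicZ3 f) (hc : Continuous f) :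
    ∃ M, ∀ x, ‖f x‖ ≤ M := by
  obtain ⟨M, hM⟩ := (isCompact_closedBall (0 : Space) 3).exists_bound_of_continuousOn
    hc.continuousOn
  refine ⟨M, fun x => ?_⟩
  obtain ⟨y, hy, hxy⟩ := hf.exists_mem_closedBall_eq x
  exact hxy ▸ hM y hy

open scoped Pointwise in
lemma setIntegral_add_right [NormedAddCommGroup F] [NormedSpace ℝ F]
    (hf : PeriodicZ3 f) (v : Space) : ∫ x in cell, f (x + v) = ∫ x in cell, f x := by
  have : VAddInvariantMeasure (Submodule.span ℤ (Set.range stdBasis)) Space volume :=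
    inferInstanceAs (VAddInvariantMeasure
      (Submodule.span ℤ (Set.range stdBasis)).toAddSubgroup Space volume)
  have : VAddCommClass Space (Submodule.span ℤ (Set.range stdBasis)) Space :=
    ⟨fun a b c => add_left_comm a (b : Space) c⟩
  have htranslate : ∫ x in v +ᵥ cell, f x = ∫ x in cell, f x :=
    (isAddFundamentalDomain_cell.vadd_of_comm v).setIntegral_eq isAddFundamentalDomain_cell
      fun g x => by
        change f ((g : Space) + x) = f x
        rw [add_comm, hf.add_of_mem_span g.2]
  have himage : v +ᵥ cell = (fun x : Space => x + v) '' cell := by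
    ext x
    simp only [Set.mem_vadd_set, Set.mem_image, vadd_eq_add, add_comm]
  rw [← htranslate, himage, (measurePreserving_add_right volume v).setIntegral_image_emb
    (measurableEmbedding_addRight v)]

/-- The integral of `x ↦ f (x + t • v)` over the cell does not depend on `t`; differentiate it
under the integral sign at `t = 0`. -/
lemma integral_lineDeriv_eq_zero {f : Space → ℝ} (hf : PeriodicZ3 f) {C : NNReal}
    (hl : LipschitzWith C f) {f' : Space → ℝ} {v : Space}
    (hd : ∀ᵐ x : Space, HasLineDerivAt ℝ f (f' x) x v) : ∫ x in cell, f' x = 0 := by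
  have hmeas : AEStronglyMeasurable f' (volume.restrict cell) :=
    ((measurable_lineDeriv (𝕜 := ℝ) (v := v) hl.continuous).aestronglyMeasurable.congr
      (hd.mono fun x hx => hx.lineDeriv)).restrict
  have hint : Integrable f (volume.restrict cell) := by
    obtain ⟨M, hM⟩ := hf.exists_norm_le hl.continuous
    exact Integrable.of_bound hl.continuous.aestronglyMeasurable M (Eventually.of_forall hM)
  have hlip (x : Space) : LipschitzOnWith (Real.nnabs (C * ‖v‖)) (fun t : ℝ => f (x + t • v))
      Set.univ := by
    rw [lipschitzOnWith_univ]
    refine LipschitzWith.of_dist_le_mul fun s t => (hl.dist_le_mul _ _).trans_eq ?_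
    rw [Real.coe_nnabs, abs_of_nonneg (by positivity), dist_add_left, dist_eq_norm, ← sub_smul,
      norm_smul, Real.dist_eq, Real.norm_eq_abs]
    ring
  have hderiv := (hasDerivAt_integral_of_dominated_loc_of_lip (𝕜 := ℝ)
    (μ := volume.restrict cell) (F := fun (t : ℝ) x => f (x + t • v)) (x₀ := 0) (F' := f')
    (s := Set.univ) (bound := fun _ => C * ‖v‖) Filter.univ_mem
    (Eventually.of_forall fun t => (hl.continuous.comp (by fun_prop)).aestronglyMeasurable)
    (by simpa using hint) hmeas (Eventually.of_forall hlip) (integrable_const _)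
    (ae_restrict_of_ae hd)).2
  simp_rw [hf.setIntegral_add_right] at hderiv
  exact hderiv.unique (hasDerivAt_const _ _)

end PeriodicZ3

/-- The double integral `∫_{𝕋³} ∫_{ℝ³} H(x, z) dz dx`. -/
def doubleIntegral (H : Space → Space → ℝ) : ℝ := ∫ x in cell, ∫ z, H x z

lemma doubleIntegral_const_mul (c : ℝ) (H : Space → Space → ℝ) :
    doubleIntegral (fun x z => c * H x z) = c * doubleIntegral H := by
  simp only [doubleIntegral, integral_const_mul]

lemma abs_doubleIntegral_le {H : Space → Space → ℝ} {b : Space → ℝ}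
    (hb : Integrable b (volume.restrict cell)) (hHb : ∀ x, |∫ z, H x z| ≤ b x) :
    |doubleIntegral H| ≤ ∫ x in cell, b x := by
  rw [← Real.norm_eq_abs]
  exact norm_integral_le_of_norm_le hb (Eventually.of_forall hHb)

/-- Integrands `H x z` of `doubleIntegral`: periodic in `x`, and dominated by an integrable
function of `z` alone. -/
structure IsDominatedIntegrand (H : Space → Space → ℝ) : Prop where
  aestronglyMeasurable :
    AEStronglyMeasurable (fun p : Space × Space => H p.1 p.2) (volume.prod volume)
  periodic : ∀ z, PeriodicZ3 fun x => H x z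
  exists_bound : ∃ κ : Space → ℝ, Integrable κ ∧ ∀ x z, |H x z| ≤ κ z

namespace IsDominatedIntegrand

variable {H L : Space → Space → ℝ}

lemma integrable_prod (hH : IsDominatedIntegrand H) :
    Integrable (Function.uncurry H) ((volume.restrict cell).prod volume) := by
  obtain ⟨κ, hκ, hHκ⟩ := hH.exists_bound
  refine (hκ.comp_snd _).mono' ?_ (Eventually.of_forall fun p => hHκ p.1 p.2)
  exact hH.aestronglyMeasurable.mono_ac
    ((Measure.absolutelyContinuous_of_le Measure.restrict_le_self).prod
      Measure.AbsolutelyContinuous.rfl)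

lemma doubleIntegral_eq_integral_prod (hH : IsDominatedIntegrand H) :
    doubleIntegral H = ∫ p, H p.1 p.2 ∂((volume.restrict cell).prod volume) :=
  (integral_prod _ hH.integrable_prod).symm

lemma comp_sub_neg (hH : IsDominatedIntegrand H) :
    IsDominatedIntegrand fun x z => H (x - z) (-z) where
  aestronglyMeasurable := by
    have hsub : MeasurePreserving (fun p : Space × Space => (p.1 - p.2, p.2))
      (volume.prod volume) (volume.prod volume) := measurePreserving_sub_prod volume volume
    have hneg : MeasurePreserving (fun p : Space × Space => (p.1, -p.2))
      (volume.prod volume) (volume.prod volume) :=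
      (MeasurePreserving.id _).prod (Measure.measurePreserving_neg volume)
    exact (hH.aestronglyMeasurable.comp_measurePreserving hneg).comp_measurePreserving hsub
  periodic z := (hH.periodic (-z)).comp_sub z
  exists_bound := by
    obtain ⟨κ, hκ, hHκ⟩ := hH.exists_bound
    exact ⟨fun z => κ (-z), hκ.comp_neg, fun x z => hHκ _ _⟩

lemma doubleIntegral_comp_sub_neg (hH : IsDominatedIntegrand H) :
    doubleIntegral (fun x z => H (x - z) (-z)) = doubleIntegral H := by
  unfold doubleIntegral
  rw [integral_integral_swap hH.integrable_prod,
    integral_integral_swap hH.comp_sub_neg.integrable_prod]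
  have htranslate (z : Space) : ∫ x in cell, H (x - z) (-z) = ∫ x in cell, H x (-z) := by
    simpa [sub_eq_add_neg] using (hH.periodic (-z)).setIntegral_add_right (-z)
  simp_rw [htranslate]
  exact integral_neg_eq_self (fun z => ∫ x in cell, H x z) volume

lemma const_mul (hH : IsDominatedIntegrand H) (c : ℝ) :
    IsDominatedIntegrand fun x z => c * H x z where
  aestronglyMeasurable := hH.aestronglyMeasurable.const_mul c
  periodic z := (hH.periodic z).comp (c * ·)
  exists_bound := by
    obtain ⟨κ, hκ, hHκ⟩ := hH.exists_bound
    refine ⟨fun z => |c| * κ z, hκ.const_mul _, fun x z => ?_⟩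
    rw [abs_mul]
    exact mul_le_mul_of_nonneg_left (hHκ x z) (abs_nonneg _)

lemma add (hH : IsDominatedIntegrand H) (hL : IsDominatedIntegrand L) :
    IsDominatedIntegrand fun x z => H x z + L x z where
  aestronglyMeasurable := hH.aestronglyMeasurable.add hL.aestronglyMeasurable
  periodic z := (hH.periodic z).comp₂ (hL.periodic z) (· + ·)
  exists_bound := by
    obtain ⟨κ, hκ, hHκ⟩ := hH.exists_bound
    obtain ⟨κ', hκ', hLκ'⟩ := hL.exists_bound
    exact ⟨fun z => κ z + κ' z, hκ.add hκ', fun x z =>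
      (abs_add_le _ _).trans (add_le_add (hHκ x z) (hLκ' x z))⟩

lemma sub (hH : IsDominatedIntegrand H) (hL : IsDominatedIntegrand L) :
    IsDominatedIntegrand fun x z => H x z - L x z := by
  simpa [sub_eq_add_neg] using hH.add (hL.const_mul (-1))

lemma sum {ι : Type*} {s : Finset ι} {H : ι → Space → Space → ℝ}
    (hH : ∀ i ∈ s, IsDominatedIntegrand (H i)) :
    IsDominatedIntegrand fun x z => ∑ i ∈ s, H i x z := by
  classical
  induction s using Finset.induction_on with
  | empty =>
    exact ⟨by simpa using aestronglyMeasurable_const, fun _ _ _ => by simp,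
      fun _ => 0, integrable_zero _ _ _, by simp⟩
  | insert i s hi ih =>
    simp only [Finset.sum_insert hi]
    exact (hH i (Finset.mem_insert_self i s)).add
      (ih fun j hj => hH j (Finset.mem_insert_of_mem hj))

lemma doubleIntegral_add (hH : IsDominatedIntegrand H) (hL : IsDominatedIntegrand L) :
    doubleIntegral (fun x z => H x z + L x z) = doubleIntegral H + doubleIntegral L := by
  rw [hH.doubleIntegral_eq_integral_prod, hL.doubleIntegral_eq_integral_prod,
    (hH.add hL).doubleIntegral_eq_integral_prod]
  exact integral_add hH.integrable_prod hL.integrable_prod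

lemma doubleIntegral_sub (hH : IsDominatedIntegrand H) (hL : IsDominatedIntegrand L) :
    doubleIntegral (fun x z => H x z - L x z) = doubleIntegral H - doubleIntegral L := by
  rw [hH.doubleIntegral_eq_integral_prod, hL.doubleIntegral_eq_integral_prod,
    (hH.sub hL).doubleIntegral_eq_integral_prod]
  exact integral_sub hH.integrable_prod hL.integrable_prod

lemma doubleIntegral_sum {ι : Type*} {s : Finset ι} {H : ι → Space → Space → ℝ}
    (hH : ∀ i ∈ s, IsDominatedIntegrand (H i)) :
    doubleIntegral (fun x z => ∑ i ∈ s, H i x z) = ∑ i ∈ s, doubleIntegral (H i) := by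
  rw [(sum hH).doubleIntegral_eq_integral_prod]
  refine (integral_finsetSum _ fun i hi => (hH i hi).integrable_prod).trans ?_
  exact Finset.sum_congr rfl fun i hi => (hH i hi).doubleIntegral_eq_integral_prod.symm

end IsDominatedIntegrand

section BoundedPeriodic

variable {E F : Type*} [NormedAddCommGroup E] [NormedSpace ℝ E] [NormedAddCommGroup F]

/-- Bounded measurable functions on the torus. -/
structure BoundedPeriodic (f : Space → F) : Prop where
  periodic : PeriodicZ3 f
  aestronglyMeasurable : AEStronglyMeasurable f volume
  exists_bound : ∃ M, ∀ x, ‖f x‖ ≤ M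

/-- Bounded measurable functions of a point `x` of the torus and a displacement `z ∈ ℝ³`. -/
structure BoundedPeriodicPair (B : Space → Space → F) : Prop where
  aestronglyMeasurable :
    AEStronglyMeasurable (fun p : Space × Space => B p.1 p.2) (volume.prod volume)
  periodic : ∀ z, PeriodicZ3 fun x => B x z
  exists_bound : ∃ M, ∀ x z, ‖B x z‖ ≤ M

lemma aestronglyMeasurable_comp_sub_left {f : Space → F} (hf : AEStronglyMeasurable f volume)
    (x : Space) : AEStronglyMeasurable (fun z => f (x - z)) volume :=
  hf.comp_quasiMeasurePreserving (quasiMeasurePreserving_sub_left_of_right_invariant volume x)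

lemma aestronglyMeasurable_uncurry_sub {f : Space → F} (hf : AEStronglyMeasurable f volume) :
    AEStronglyMeasurable (fun p : Space × Space => f (p.1 - p.2)) (volume.prod volume) :=
  hf.comp_quasiMeasurePreserving (quasiMeasurePreserving_sub_of_right_invariant volume volume)

namespace BoundedPeriodic

variable {f g : Space → F}

lemma const (c : F) : BoundedPeriodic (fun _ : Space => c) :=
  ⟨fun _ _ => rfl, aestronglyMeasurable_const, ‖c‖, fun _ => le_rfl⟩

lemma integrable_cell (hf : BoundedPeriodic f) : Integrable f (volume.restrict cell) := by
  obtain ⟨M, hM⟩ := hf.exists_bound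
  exact Integrable.of_bound hf.aestronglyMeasurable.restrict M (Eventually.of_forall hM)

lemma norm (hf : BoundedPeriodic f) : BoundedPeriodic (fun x => ‖f x‖) where
  periodic := hf.periodic.comp (‖·‖)
  aestronglyMeasurable := hf.aestronglyMeasurable.norm
  exists_bound := by
    obtain ⟨M, hM⟩ := hf.exists_bound
    exact ⟨M, fun x => (norm_norm _).trans_le (hM x)⟩

lemma pair_fst (hf : BoundedPeriodic f) : BoundedPeriodicPair fun x _ => f x :=
  ⟨hf.aestronglyMeasurable.comp_fst, fun _ => hf.periodic,
    let ⟨M, hM⟩ := hf.exists_bound; ⟨M, fun x _ => hM x⟩⟩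

lemma pair_sub (hf : BoundedPeriodic f) : BoundedPeriodicPair fun x z => f (x - z) :=
  ⟨aestronglyMeasurable_uncurry_sub hf.aestronglyMeasurable, fun z => hf.periodic.comp_sub z,
    let ⟨M, hM⟩ := hf.exists_bound; ⟨M, fun x z => hM (x - z)⟩⟩

lemma sub (hf : BoundedPeriodic f) (hg : BoundedPeriodic g) :
    BoundedPeriodic (fun x => f x - g x) where
  periodic := hf.periodic.comp₂ hg.periodic (· - ·)
  aestronglyMeasurable := hf.aestronglyMeasurable.sub hg.aestronglyMeasurable
  exists_bound := by
    obtain ⟨M, hM⟩ := hf.exists_bound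
    obtain ⟨N, hN⟩ := hg.exists_bound
    exact ⟨M + N, fun x => (norm_sub_le _ _).trans (add_le_add (hM x) (hN x))⟩

lemma smul {a : Space → ℝ} {f : Space → E} (ha : BoundedPeriodic a) (hf : BoundedPeriodic f) :
    BoundedPeriodic (fun x => a x • f x) where
  periodic := ha.periodic.comp₂ hf.periodic (· • ·)
  aestronglyMeasurable := ha.aestronglyMeasurable.smul hf.aestronglyMeasurable
  exists_bound := by
    obtain ⟨M, hM⟩ := ha.exists_bound
    obtain ⟨N, hN⟩ := hf.exists_bound
    refine ⟨M * N, fun x => ?_⟩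
    rw [norm_smul]
    exact mul_le_mul (hM x) (hN x) (norm_nonneg _) ((norm_nonneg _).trans (hM x))

lemma mul {a b : Space → ℝ} (ha : BoundedPeriodic a) (hb : BoundedPeriodic b) :
    BoundedPeriodic (fun x => a x * b x) :=
  ha.smul hb

lemma inner {f g : Space → F} [InnerProductSpace ℝ F] (hf : BoundedPeriodic f)
    (hg : BoundedPeriodic g) : BoundedPeriodic (fun x => inner ℝ (f x) (g x)) where
  periodic := hf.periodic.comp₂ hg.periodic (fun a b => Inner.inner ℝ a b)
  aestronglyMeasurable := hf.aestronglyMeasurable.inner hg.aestronglyMeasurable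
  exists_bound := by
    obtain ⟨M, hM⟩ := hf.exists_bound
    obtain ⟨N, hN⟩ := hg.exists_bound
    refine ⟨M * N, fun x => (norm_inner_le_norm _ _).trans ?_⟩
    exact mul_le_mul (hM x) (hN x) (norm_nonneg _) ((norm_nonneg _).trans (hM x))

lemma clm_comp [NormedSpace ℝ F] (hf : BoundedPeriodic f) (L : F →L[ℝ] E) :
    BoundedPeriodic (fun x => L (f x)) where
  periodic := hf.periodic.comp L
  aestronglyMeasurable := L.continuous.comp_aestronglyMeasurable hf.aestronglyMeasurable
  exists_bound := by
    obtain ⟨M, hM⟩ := hf.exists_bound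
    exact ⟨‖L‖ * M, fun x => (L.le_opNorm _).trans (by gcongr; exact hM x)⟩

lemma coord {n : ℕ} {f : Space → EuclideanSpace ℝ (Fin n)} (hf : BoundedPeriodic f) (i : Fin n) :
    BoundedPeriodic (fun x => f x i) := hf.clm_comp (EuclideanSpace.proj i)

end BoundedPeriodic

namespace BoundedPeriodicPair

lemma sub {A B : Space → Space → F} (hA : BoundedPeriodicPair A) (hB : BoundedPeriodicPair B) :
    BoundedPeriodicPair fun x z => A x z - B x z where
  aestronglyMeasurable := hA.aestronglyMeasurable.sub hB.aestronglyMeasurable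
  periodic z := (hA.periodic z).comp₂ (hB.periodic z) (· - ·)
  exists_bound := by
    obtain ⟨M, hM⟩ := hA.exists_bound
    obtain ⟨N, hN⟩ := hB.exists_bound
    exact ⟨M + N, fun x z => (norm_sub_le _ _).trans (add_le_add (hM x z) (hN x z))⟩

lemma inner [InnerProductSpace ℝ F] {A B : Space → Space → F} (hA : BoundedPeriodicPair A)
    (hB : BoundedPeriodicPair B) : BoundedPeriodicPair fun x z => inner ℝ (A x z) (B x z) where
  aestronglyMeasurable := hA.aestronglyMeasurable.inner hB.aestronglyMeasurable
  periodic z := (hA.periodic z).comp₂ (hB.periodic z) (fun a b => Inner.inner ℝ a b)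
  exists_bound := by
    obtain ⟨M, hM⟩ := hA.exists_bound
    obtain ⟨N, hN⟩ := hB.exists_bound
    refine ⟨M * N, fun x z => (norm_inner_le_norm _ _).trans ?_⟩
    exact mul_le_mul (hM x z) (hN x z) (norm_nonneg _) ((norm_nonneg _).trans (hM x z))

lemma mul {A B : Space → Space → ℝ} (hA : BoundedPeriodicPair A) (hB : BoundedPeriodicPair B) :
    BoundedPeriodicPair fun x z => A x z * B x z := by
  simpa [mul_comm] using hA.inner hB

lemma kernel_mul {B : Space → Space → ℝ} (hB : BoundedPeriodicPair B) {K : Space → ℝ}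
    (hK : Integrable K) : IsDominatedIntegrand fun x z => K z * B x z where
  aestronglyMeasurable := hK.1.comp_snd.mul hB.aestronglyMeasurable
  periodic z := (hB.periodic z).comp (K z * ·)
  exists_bound := by
    obtain ⟨M, hM⟩ := hB.exists_bound
    refine ⟨fun z => |K z| * M, hK.abs.mul_const M, fun x z => ?_⟩
    rw [abs_mul]
    exact mul_le_mul_of_nonneg_left (hM x z) (abs_nonneg _)

end BoundedPeriodicPair

end BoundedPeriodic

section Convolution

variable {E F : Type*} [NormedAddCommGroup E] [NormedSpace ℝ E] [NormedAddCommGroup F]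
  [NormedSpace ℝ F] {f g : Space → F} {K L : Space → ℝ}

lemma heatConv_eq_convolution (h : ℝ) (f : Space → F) : heatConv h f = heatKernel h ⋆ f := rfl

lemma convolution_const_smul (K : Space → ℝ) (c : ℝ) (f : Space → F) (x : Space) :
    (K ⋆ fun y => c • f y) x = c • (K ⋆ f) x :=
  congrFun (convolution_smul (f := K) (g := f) (L := ContinuousLinearMap.lsmul ℝ ℝ) (y := c)) x

namespace BoundedPeriodic

lemma convolutionExists (hf : BoundedPeriodic f) (hK : Integrable K) :
    ConvolutionExists K f (ContinuousLinearMap.lsmul ℝ ℝ) volume := fun x => by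
  obtain ⟨M, hM⟩ := hf.exists_bound
  exact hK.smul_bdd M (aestronglyMeasurable_comp_sub_left hf.aestronglyMeasurable x)
    (Eventually.of_forall fun z => hM _)

lemma norm_convolution_le {M : ℝ} (hM : ∀ x, ‖f x‖ ≤ M) (hK : Integrable K) (x : Space) :
    ‖(K ⋆ f) x‖ ≤ (∫ z, |K z|) * M := by
  rw [convolution_lsmul, ← integral_mul_const]
  refine norm_integral_le_of_norm_le (hK.abs.mul_const M) (Eventually.of_forall fun z => ?_)
  rw [norm_smul, Real.norm_eq_abs]
  gcongr
  exact hM _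

lemma convolution (hf : BoundedPeriodic f) (hK : Integrable K) : BoundedPeriodic (K ⋆ f) where
  periodic k x := by
    simp only [convolution_lsmul, add_sub_right_comm, hf.periodic k (x - _)]
  aestronglyMeasurable := by
    have hprod : AEStronglyMeasurable (fun p : Space × Space => K p.2 • f (p.1 - p.2))
        (volume.prod volume) :=
      hK.1.comp_snd.smul (aestronglyMeasurable_uncurry_sub hf.aestronglyMeasurable)
    exact hprod.integral_prod_right'
  exists_bound := by
    obtain ⟨M, hM⟩ := hf.exists_bound
    exact ⟨_, norm_convolution_le hM hK⟩

lemma heatConv (hf : BoundedPeriodic f) {h : ℝ} (hh : 0 < h) : BoundedPeriodic (heatConv h f) :=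
  hf.convolution (integrable_heatKernel hh)

end BoundedPeriodic

lemma convolution_clm_comp [CompleteSpace E] [CompleteSpace F] (hf : BoundedPeriodic f)
    (hK : Integrable K) (L : F →L[ℝ] E) (x : Space) :
    (K ⋆ fun y => L (f y)) x = L ((K ⋆ f) x) := by
  simp only [convolution_lsmul, ← map_smul]
  exact L.integral_comp_comm (hf.convolutionExists hK x)

lemma convolution_sub (hf : BoundedPeriodic f) (hg : BoundedPeriodic g) (hK : Integrable K)
    (x : Space) : (K ⋆ fun y => f y - g y) x = (K ⋆ f) x - (K ⋆ g) x := by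
  simp only [convolution_lsmul, smul_sub]
  exact integral_sub (hf.convolutionExists hK x) (hg.convolutionExists hK x)

lemma convolution_convolution [CompleteSpace F] (hf : BoundedPeriodic f) (hK : Integrable K)
    (hL : Integrable L) (x : Space) : (K ⋆ L ⋆ f) x = ((K ⋆ L) ⋆ f) x := by
  refine (convolution_assoc (ContinuousLinearMap.lsmul ℝ ℝ) (ContinuousLinearMap.lsmul ℝ ℝ)
    (ContinuousLinearMap.lsmul ℝ ℝ) (ContinuousLinearMap.lsmul ℝ ℝ) (fun a b v => smul_assoc a b v)
    hK.1 hL.1 hf.aestronglyMeasurable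
    (hK.ae_convolution_exists (ContinuousLinearMap.lsmul ℝ ℝ) hL)
    (Eventually.of_forall (hf.norm.convolutionExists hL.norm))
    ((hf.norm.convolution hL.norm).convolutionExists hK.norm x)).symm

lemma heatConv_half_heatConv_half [CompleteSpace F] (hf : BoundedPeriodic f) {h : ℝ} (hh : 0 < h)
    (x : Space) : heatConv (h / 2) (heatConv (h / 2) f) x = heatConv h f x := by
  have hint := integrable_heatKernel (half_pos hh)
  have hkernel : heatKernel (h / 2) ⋆ heatKernel (h / 2) = heatKernel h :=
    funext fun z => integral_heatKernel_half_mul_heatKernel_half hh z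
  simp only [heatConv_eq_convolution]
  rw [convolution_convolution hf hint hint, hkernel]

lemma gradKernel_half_convolution_gradKernel_half [CompleteSpace F] (hf : BoundedPeriodic f)
    {h : ℝ} (hh : 0 < h) (i j : Fin 3) (x : Space) :
    (gradKernel (h / 2) i ⋆ gradKernel (h / 2) j ⋆ f) x = (hessKernel h i j ⋆ f) x := by
  have hkernel : gradKernel (h / 2) i ⋆ gradKernel (h / 2) j = hessKernel h i j :=
    funext fun z => integral_gradKernel_half_mul_gradKernel_half hh i j z
  rw [convolution_convolution hf (integrable_gradKernel (half_pos hh) i)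
    (integrable_gradKernel (half_pos hh) j), hkernel]

lemma integral_mul_inner_convolution {V : Type*} [NormedAddCommGroup V] [InnerProductSpace ℝ V]
    [CompleteSpace V] (hK : Integrable K) (φ : Space → ℝ) (a : Space → V) {b : Space → V}
    (hb : BoundedPeriodic b) : ∫ x in cell, φ x * inner ℝ (a x) ((K ⋆ b) x) =
      doubleIntegral fun x z => K z * (φ x * inner ℝ (a x) (b (x - z))) := by
  unfold doubleIntegral
  congr 1 with x
  have hint : Integrable fun z => K z • b (x - z) := hb.convolutionExists hK x
  rw [convolution_lsmul, ← integral_inner hint, ← integral_const_mul]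
  congr 1 with z
  rw [inner_smul_right]
  ring

end Convolution

section Derivative

variable {F : Type*} [NormedAddCommGroup F] [NormedSpace ℝ F] {f : Space → F} {h : ℝ}

lemma heatKernel_le_of_norm_sub_le_one (hh : 0 < h) {x y : Space} (hxy : ‖x - y‖ ≤ 1) :
    heatKernel h x ≤ 3 * Real.exp (1 / (4 * h)) * heatKernel (2 * h) y := by
  have hnorm : ‖y‖ ^ 2 ≤ 2 * ‖x‖ ^ 2 + 2 := by
    have htri : ‖y‖ ≤ ‖x‖ + ‖x - y‖ := by simpa using norm_sub_le x (x - y)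
    nlinarith [norm_nonneg x, norm_nonneg y, norm_nonneg (x - y), sq_nonneg (‖x‖ - 1)]
  have hexp : Real.exp (-‖x‖ ^ 2 / (4 * h)) ≤
      Real.exp (1 / (4 * h)) * Real.exp (-‖y‖ ^ 2 / (4 * (2 * h))) := by
    rw [← Real.exp_add, Real.exp_le_exp, show 1 / (4 * h) + -‖y‖ ^ 2 / (4 * (2 * h)) =
      (1 - ‖y‖ ^ 2 / 2) / (4 * h) by field_simp; ring]
    gcongr
    linarith
  have hprefactor : 1 / (4 * Real.pi * h) ^ ((3 : ℝ) / 2) ≤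
      3 * (1 / (4 * Real.pi * (2 * h)) ^ ((3 : ℝ) / 2)) := by
    rw [one_div_four_pi_mul_rpow hh (show 0 < 2 * h by positivity), mul_div_cancel_right₀ _ hh.ne']
    exact mul_le_mul_of_nonneg_right two_rpow_three_halves_le (by positivity)
  unfold heatKernel
  calc 1 / (4 * Real.pi * h) ^ ((3 : ℝ) / 2) * Real.exp (-‖x‖ ^ 2 / (4 * h))
      ≤ 3 * (1 / (4 * Real.pi * (2 * h)) ^ ((3 : ℝ) / 2)) *
        (Real.exp (1 / (4 * h)) * Real.exp (-‖y‖ ^ 2 / (4 * (2 * h)))) := by gcongr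
    _ = 3 * Real.exp (1 / (4 * h)) * (1 / (4 * Real.pi * (2 * h)) ^ ((3 : ℝ) / 2) *
        Real.exp (-‖y‖ ^ 2 / (4 * (2 * h)))) := by ring

lemma norm_fderiv_heatKernel_le (hh : 0 < h) (z : Space) :
    ‖fderiv ℝ (heatKernel h) z‖ ≤ 1 / √h * gaussianMoment 1 * heatKernel (2 * h) z := by
  have hpos := heatKernel_pos hh z
  rw [(hasFDerivAt_heatKernel h z).fderiv, norm_smul, innerSL_apply_norm, norm_mul, norm_neg,
    Real.norm_of_nonneg (by positivity), Real.norm_of_nonneg hpos.le]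
  calc 1 / (2 * h) * heatKernel h z * ‖z‖ ≤ 1 / h * heatKernel h z * (√h * weight h z) := by
        gcongr
        · linarith
        · exact norm_le_sqrt_mul_weight hh z
    _ = 1 / √h * (weight h z ^ 1 * heatKernel h z) := by
        have := Real.mul_self_sqrt hh.le
        field_simp
        rw [pow_two, this]
    _ ≤ 1 / √h * gaussianMoment 1 * heatKernel (2 * h) z := by
        rw [mul_assoc]
        exact mul_le_mul_of_nonneg_left (weight_pow_mul_heatKernel_le hh 1 z) (by positivity)

lemma continuous_fderiv_heatKernel (h : ℝ) : Continuous (fderiv ℝ (heatKernel h)) := by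
  have hfderiv : fderiv ℝ (heatKernel h) =
      fun z => (-(1 / (2 * h)) * heatKernel h z) • innerSL ℝ z :=
    funext fun z => (hasFDerivAt_heatKernel h z).fderiv
  rw [hfderiv]
  fun_prop

lemma integrable_fderiv_heatKernel (hh : 0 < h) : Integrable (fderiv ℝ (heatKernel h)) :=
  ((integrable_heatKernel (show 0 < 2 * h by positivity)).const_mul _).mono'
    (continuous_fderiv_heatKernel h).aestronglyMeasurable
    (Eventually.of_forall (norm_fderiv_heatKernel_le hh))

lemma aestronglyMeasurable_smulRight_fderiv_heatKernel (h : ℝ) (hf : AEStronglyMeasurable f volume)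
    (x : Space) :
    AEStronglyMeasurable (fun y => (fderiv ℝ (heatKernel h) (x - y)).smulRight (f y)) volume :=
  (ContinuousLinearMap.smulRightL ℝ Space F).aestronglyMeasurable_comp₂
    ((continuous_fderiv_heatKernel h).comp (by fun_prop)).aestronglyMeasurable hf

lemma norm_smulRight_fderiv_heatKernel_le {M : ℝ} (hM : ∀ x, ‖f x‖ ≤ M) (h : ℝ) (x y : Space) :
    ‖(fderiv ℝ (heatKernel h) (x - y)).smulRight (f y)‖ ≤
      ‖fderiv ℝ (heatKernel h) (x - y)‖ * M := by
  rw [ContinuousLinearMap.norm_smulRight_apply]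
  gcongr
  exact hM y

namespace BoundedPeriodic

lemma integrable_smulRight_fderiv_heatKernel (hf : BoundedPeriodic f) (hh : 0 < h) (x : Space) :
    Integrable fun y => (fderiv ℝ (heatKernel h) (x - y)).smulRight (f y) := by
  obtain ⟨M, hM⟩ := hf.exists_bound
  exact (((integrable_fderiv_heatKernel hh).comp_sub_left x).norm.mul_const M).mono'
    (aestronglyMeasurable_smulRight_fderiv_heatKernel h hf.aestronglyMeasurable x)
    (Eventually.of_forall (norm_smulRight_fderiv_heatKernel_le hM h x))

lemma hasFDerivAt_heatConv (hf : BoundedPeriodic f) (hh : 0 < h) (x : Space) :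
    HasFDerivAt (FilamentThresholding.heatConv h f)
      (∫ y, (fderiv ℝ (heatKernel h) (x - y)).smulRight (f y)) x := by
  obtain ⟨M, hM⟩ := hf.exists_bound
  have hM0 : 0 ≤ M := (norm_nonneg _).trans (hM 0)
  have h2 : 0 < 2 * h := by positivity
  have h4 : 0 < 2 * (2 * h) := by positivity
  have hconv : FilamentThresholding.heatConv h f = fun x => ∫ y, heatKernel h (x - y) • f y :=
    funext fun x => convolution_lsmul_swap
  rw [hconv]
  refine hasFDerivAt_integral_of_dominated_of_fderiv_le (𝕜 := ℝ)
    (F' := fun x y => (fderiv ℝ (heatKernel h) (x - y)).smulRight (f y))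
    (bound := fun y => 1 / √h * gaussianMoment 1 *
      (3 * Real.exp (1 / (4 * (2 * h))) * heatKernel (2 * (2 * h)) (x - y)) * M)
    (Metric.ball_mem_nhds x one_pos)
    (Eventually.of_forall fun x' => ?_) ?_
    (aestronglyMeasurable_smulRight_fderiv_heatKernel h hf.aestronglyMeasurable x)
    (Eventually.of_forall fun y x' hx' => ?_) ?_ (Eventually.of_forall fun y x' _ => ?_)
  · exact ((continuous_heatKernel h).comp (by fun_prop)).aestronglyMeasurable.smul
      hf.aestronglyMeasurable
  · exact ((integrable_heatKernel hh).comp_sub_left x).smul_bdd M hf.aestronglyMeasurable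
      (Eventually.of_forall hM)
  · refine (norm_smulRight_fderiv_heatKernel_le hM h x' y).trans ?_
    refine mul_le_mul_of_nonneg_right ((norm_fderiv_heatKernel_le hh _).trans ?_) hM0
    gcongr
    · unfold gaussianMoment
      positivity
    · refine heatKernel_le_of_norm_sub_le_one h2 ?_
      rw [sub_sub_sub_cancel_right]
      exact (mem_ball_iff_norm.1 hx').le
  · exact ((((integrable_heatKernel h4).comp_sub_left x).const_mul _).const_mul _).mul_const M
  · exact ((hasFDerivAt_comp_sub y).2
      (hasFDerivAt_heatKernel h (x' - y)).differentiableAt.hasFDerivAt).smul_const (f y)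

lemma pderiv_heatConv (hf : BoundedPeriodic f) (hh : 0 < h) (k : Fin 3) (x : Space) :
    pderiv k (FilamentThresholding.heatConv h f) x = (gradKernel h k ⋆ f) x := by
  unfold pderiv
  rw [(hf.hasFDerivAt_heatConv hh x).fderiv,
    ContinuousLinearMap.integral_apply (hf.integrable_smulRight_fderiv_heatKernel hh x),
    convolution_lsmul_swap]
  simp only [ContinuousLinearMap.smulRight_apply, fderiv_heatKernel_single]

lemma exists_lipschitzWith_heatConv (hf : BoundedPeriodic f) (hh : 0 < h) :
    ∃ C, LipschitzWith C (FilamentThresholding.heatConv h f) := by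
  obtain ⟨M, hM⟩ := hf.exists_bound
  refine ⟨Real.toNNReal ((∫ z, ‖fderiv ℝ (heatKernel h) z‖) * M),
    lipschitzWith_of_nnnorm_fderiv_le (𝕜 := ℝ)
      (fun x => (hf.hasFDerivAt_heatConv hh x).differentiableAt) fun x => ?_⟩
  rw [← norm_toNNReal]
  refine Real.toNNReal_le_toNNReal ?_
  rw [(hf.hasFDerivAt_heatConv hh x).fderiv,
    ← integral_sub_left_eq_self (fun z => ‖fderiv ℝ (heatKernel h) z‖) volume x,
    ← integral_mul_const]
  exact norm_integral_le_of_norm_le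
    (((integrable_fderiv_heatKernel hh).comp_sub_left x).norm.mul_const M)
    (Eventually.of_forall (norm_smulRight_fderiv_heatKernel_le hM h x))

end BoundedPeriodic

end Derivative

section UnitMap

variable {V : Type*} [NormedAddCommGroup V] {u : Space → V} {h : ℝ}

/-- Measurable maps from the torus into the unit sphere of `V`. -/
structure UnitMap (u : Space → V) : Prop where
  periodic : PeriodicZ3 u
  aestronglyMeasurable : AEStronglyMeasurable u volume
  norm_eq_one : ∀ x, ‖u x‖ = 1

namespace UnitMap

lemma boundedPeriodic (hu : UnitMap u) : BoundedPeriodic u :=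
  ⟨hu.periodic, hu.aestronglyMeasurable, 1, fun x => (hu.norm_eq_one x).le⟩

lemma norm_sub_le_two (hu : UnitMap u) (x y : Space) : ‖u y - u x‖ ≤ 2 := by
  refine (norm_sub_le _ _).trans ?_
  rw [hu.norm_eq_one, hu.norm_eq_one]
  norm_num

lemma aestronglyMeasurable_norm_sub (hu : UnitMap u) (x : Space) :
    AEStronglyMeasurable (fun z => ‖u (x - z) - u x‖) volume :=
  ((aestronglyMeasurable_comp_sub_left hu.aestronglyMeasurable x).sub
    aestronglyMeasurable_const).norm

lemma integrable_weight_pow_mul_norm_sub_pow (hu : UnitMap u) (hh : 0 < h) (x : Space)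
    (n m : ℕ) : Integrable fun z => weight h z ^ n * heatKernel h z * ‖u (x - z) - u x‖ ^ m := by
  refine (integrable_weight_pow_mul_heatKernel hh n).mul_bdd (c := 2 ^ m)
    ((hu.aestronglyMeasurable_norm_sub x).pow m) (Eventually.of_forall fun z => ?_)
  rw [norm_pow, norm_norm]
  gcongr
  exact hu.norm_sub_le_two _ _

lemma integrable_heatKernel_mul_norm_sub_sq (hu : UnitMap u) (hh : 0 < h) (x : Space) :
    Integrable fun z => heatKernel h z * ‖u (x - z) - u x‖ ^ 2 := by
  simpa using hu.integrable_weight_pow_mul_norm_sub_pow hh x 0 2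

end UnitMap

variable [InnerProductSpace ℝ V]

/-- The local density `∫ G_h(z) |u(x) - u(x - z)|² dz` of the energy of a unit map. -/
def defect (h : ℝ) (u : Space → V) (x : Space) : ℝ := 2 * (1 - inner ℝ (u x) (heatConv h u x))

lemma integral_defect (hh : 0 < h) (u : Space → Plane) :
    ∫ x in cell, defect h u x = 2 * h * energy h u := by
  unfold defect energy
  rw [integral_const_mul]
  field_simp

namespace UnitMap

lemma norm_sub_sq (hu : UnitMap u) (x y : Space) :
    ‖u y - u x‖ ^ 2 = 2 * (1 - inner ℝ (u x) (u y)) := by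
  rw [norm_sub_sq_real, hu.norm_eq_one, hu.norm_eq_one, real_inner_comm]
  ring

lemma boundedPeriodic_defect (hu : UnitMap u) (hh : 0 < h) : BoundedPeriodic (defect h u) :=
  (BoundedPeriodic.const 2).mul
    ((BoundedPeriodic.const 1).sub (hu.boundedPeriodic.inner (hu.boundedPeriodic.heatConv hh)))

lemma integrable_defect (hu : UnitMap u) (hh : 0 < h) :
    Integrable (defect h u) (volume.restrict cell) :=
  (hu.boundedPeriodic_defect hh).integrable_cell

variable [CompleteSpace V]

lemma integral_heatKernel_mul_norm_sub_sq (hu : UnitMap u) (hh : 0 < h) (x : Space) :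
    ∫ z, heatKernel h z * ‖u (x - z) - u x‖ ^ 2 = defect h u x := by
  have hexpand (z : Space) : heatKernel h z * ‖u (x - z) - u x‖ ^ 2 =
      2 * (heatKernel h z - inner ℝ (u x) (heatKernel h z • u (x - z))) := by
    rw [hu.norm_sub_sq, inner_smul_right]
    ring
  have hint : Integrable fun z => heatKernel h z • u (x - z) :=
    hu.boundedPeriodic.convolutionExists (integrable_heatKernel hh) x
  simp_rw [hexpand]
  rw [integral_const_mul, integral_sub (integrable_heatKernel hh) (hint.const_inner _),
    integral_heatKernel hh, integral_inner hint]
  rfl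

lemma defect_nonneg (hu : UnitMap u) (hh : 0 < h) (x : Space) : 0 ≤ defect h u x := by
  rw [← hu.integral_heatKernel_mul_norm_sub_sq hh x]
  exact integral_nonneg fun z => mul_nonneg (heatKernel_pos hh z).le (sq_nonneg _)

lemma integrable_sqrt_defect (hu : UnitMap u) (hh : 0 < h) :
    Integrable (fun x => √(defect h u x)) (volume.restrict cell) := by
  refine ((integrable_const 1).add (hu.integrable_defect hh)).mono'
    (Real.continuous_sqrt.comp_aestronglyMeasurable
      (hu.boundedPeriodic_defect hh).aestronglyMeasurable).restrict
    (Eventually.of_forall fun x => ?_)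
  rw [Real.norm_of_nonneg (Real.sqrt_nonneg _), Pi.add_apply]
  nlinarith [Real.sq_sqrt (hu.defect_nonneg hh x), sq_nonneg (√(defect h u x) - 1)]

/-- Cauchy–Schwarz with respect to the measure `G_h(z) dz`. -/
lemma integral_weight_mul_norm_sub_le (hu : UnitMap u) (hh : 0 < h) (x : Space) :
    ∫ z, weight h z * heatKernel h z * ‖u (x - z) - u x‖ ≤ momentConst * √(defect h u x) := by
  have hsq (z : Space) : √(heatKernel h z) ^ 2 = heatKernel h z :=
    Real.sq_sqrt (heatKernel_pos hh z).le
  have hsqrtMeas : AEStronglyMeasurable (fun z => √(heatKernel h z)) volume := by fun_prop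
  have hweight : MemLp (fun z => weight h z * √(heatKernel h z)) 2 volume := by
    rw [memLp_two_iff_integrable_sq (by fun_prop)]
    simpa only [mul_pow, hsq] using integrable_weight_pow_mul_heatKernel hh 2
  have hincr : MemLp (fun z => √(heatKernel h z) * ‖u (x - z) - u x‖) 2 volume := by
    have hmeas : AEStronglyMeasurable (fun z => √(heatKernel h z) * ‖u (x - z) - u x‖) volume :=
      hsqrtMeas.mul (hu.aestronglyMeasurable_norm_sub x)
    rw [memLp_two_iff_integrable_sq hmeas]
    simpa only [mul_pow, hsq] using hu.integrable_heatKernel_mul_norm_sub_sq hh x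
  have hholder := integral_mul_le_Lp_mul_Lq_of_nonneg Real.HolderConjugate.two_two
    (Eventually.of_forall fun z =>
      mul_nonneg (zero_le_one.trans (one_le_weight hh z)) (Real.sqrt_nonneg _))
    (Eventually.of_forall fun z => mul_nonneg (Real.sqrt_nonneg _) (norm_nonneg _))
    (by simpa using hweight) (by simpa using hincr)
  simp only [Real.rpow_two, mul_pow, hsq, ← Real.sqrt_eq_rpow,
    hu.integral_heatKernel_mul_norm_sub_sq hh] at hholder
  calc ∫ z, weight h z * heatKernel h z * ‖u (x - z) - u x‖
      = ∫ z, weight h z * √(heatKernel h z) * (√(heatKernel h z) * ‖u (x - z) - u x‖) := by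
        congr 1 with z
        linear_combination -(weight h z * ‖u (x - z) - u x‖) * hsq z
    _ ≤ √(∫ z, weight h z ^ 2 * heatKernel h z) * √(defect h u x) := hholder
    _ ≤ momentConst * √(defect h u x) := by
        gcongr
        refine Real.sqrt_le_iff.2 ⟨momentConst_pos.le, ?_⟩
        nlinarith [integral_weight_pow_mul_heatKernel_le_momentConst hh
          (show 2 ≤ 8 by norm_num), one_le_momentConst]

lemma norm_integral_le_sqrt_defect {F : Type*} [NormedAddCommGroup F] [NormedSpace ℝ F]
    (hu : UnitMap u) (hh : 0 < h) (x : Space) {Φ : Space → F} {c : ℝ} (hc : 0 ≤ c)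
    (hΦ : ∀ z, ‖Φ z‖ ≤ c * (weight h z * heatKernel h z * ‖u (x - z) - u x‖)) :
    ‖∫ z, Φ z‖ ≤ c * momentConst * √(defect h u x) := by
  have hint : Integrable fun z => weight h z * heatKernel h z * ‖u (x - z) - u x‖ := by
    simpa using hu.integrable_weight_pow_mul_norm_sub_pow hh x 1 1
  refine (norm_integral_le_of_norm_le (hint.const_mul c) (Eventually.of_forall hΦ)).trans ?_
  rw [integral_const_mul, mul_assoc]
  gcongr
  exact hu.integral_weight_mul_norm_sub_le hh x

end UnitMap

lemma sq_le_add_pow_eight_div {l : ℝ} (hl : 0 < l) (w : ℝ) : w ^ 2 ≤ l + w ^ 8 / l ^ 3 := by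
  rcases le_total (w ^ 2) l with hwl | hlw
  · have : 0 ≤ w ^ 8 / l ^ 3 := by positivity
    linarith
  · have : w ^ 2 ≤ w ^ 8 / l ^ 3 := by
      rw [le_div_iff₀ (by positivity)]
      calc w ^ 2 * l ^ 3 ≤ w ^ 2 * (w ^ 2) ^ 3 := by gcongr
        _ = w ^ 8 := by ring
    linarith

namespace UnitMap

variable [CompleteSpace V]

/-- Where `weight ^ 2 ≤ l` the defect controls the integrand, elsewhere the Gaussian tail does. -/
lemma integral_weight_sq_mul_norm_sub_sq_le (hu : UnitMap u) (hh : 0 < h) (x : Space) {l : ℝ}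
    (hl : 0 < l) : ∫ z, weight h z ^ 2 * heatKernel h z * ‖u (x - z) - u x‖ ^ 2 ≤
      l * defect h u x + 4 * momentConst / l ^ 3 := by
  have hint := (hu.integrable_heatKernel_mul_norm_sub_sq hh x).const_mul l
  have hintTail := (integrable_weight_pow_mul_heatKernel hh 8).const_mul (4 / l ^ 3)
  have hpointwise (z : Space) : weight h z ^ 2 * heatKernel h z * ‖u (x - z) - u x‖ ^ 2 ≤
      l * (heatKernel h z * ‖u (x - z) - u x‖ ^ 2) +
        4 / l ^ 3 * (weight h z ^ 8 * heatKernel h z) := by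
    have hG := heatKernel_pos hh z
    have hw := one_le_weight hh z
    have hfour : ‖u (x - z) - u x‖ ^ 2 ≤ 4 := by
      nlinarith [norm_nonneg (u (x - z) - u x), hu.norm_sub_le_two x (x - z)]
    calc weight h z ^ 2 * heatKernel h z * ‖u (x - z) - u x‖ ^ 2
        ≤ (l + weight h z ^ 8 / l ^ 3) * heatKernel h z * ‖u (x - z) - u x‖ ^ 2 := by
          gcongr
          exact sq_le_add_pow_eight_div hl _
      _ = l * (heatKernel h z * ‖u (x - z) - u x‖ ^ 2) +
          weight h z ^ 8 / l ^ 3 * heatKernel h z * ‖u (x - z) - u x‖ ^ 2 := by ring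
      _ ≤ l * (heatKernel h z * ‖u (x - z) - u x‖ ^ 2) +
          weight h z ^ 8 / l ^ 3 * heatKernel h z * 4 := by gcongr
      _ = l * (heatKernel h z * ‖u (x - z) - u x‖ ^ 2) +
          4 / l ^ 3 * (weight h z ^ 8 * heatKernel h z) := by ring
  calc ∫ z, weight h z ^ 2 * heatKernel h z * ‖u (x - z) - u x‖ ^ 2
      ≤ ∫ z, (l * (heatKernel h z * ‖u (x - z) - u x‖ ^ 2) +
          4 / l ^ 3 * (weight h z ^ 8 * heatKernel h z)) :=
        integral_mono (hu.integrable_weight_pow_mul_norm_sub_pow hh x 2 2) (hint.add hintTail)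
          hpointwise
    _ = l * defect h u x + 4 / l ^ 3 * ∫ z, weight h z ^ 8 * heatKernel h z := by
        rw [integral_add hint hintTail, integral_const_mul, integral_const_mul,
          hu.integral_heatKernel_mul_norm_sub_sq hh]
    _ ≤ l * defect h u x + 4 * momentConst / l ^ 3 := by
        rw [mul_div_right_comm]
        gcongr
        exact integral_weight_pow_mul_heatKernel_le_momentConst hh le_rfl

lemma norm_integral_le_defect {F : Type*} [NormedAddCommGroup F] [NormedSpace ℝ F]
    (hu : UnitMap u) (hh : 0 < h) (x : Space) {Φ : Space → F} {c l : ℝ} (hc : 0 ≤ c)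
    (hl : 0 < l)
    (hΦ : ∀ z, ‖Φ z‖ ≤ c * (weight h z ^ 2 * heatKernel h z * ‖u (x - z) - u x‖ ^ 2)) :
    ‖∫ z, Φ z‖ ≤ c * (l * defect h u x + 4 * momentConst / l ^ 3) := by
  refine (norm_integral_le_of_norm_le
    ((hu.integrable_weight_pow_mul_norm_sub_pow hh x 2 2).const_mul c)
    (Eventually.of_forall hΦ)).trans ?_
  rw [integral_const_mul]
  gcongr
  exact hu.integral_weight_sq_mul_norm_sub_sq_le hh x hl

end UnitMap

end UnitMap

section C11

variable {F : Type*} [NormedAddCommGroup F] [NormedSpace ℝ F] {M : ℝ} {f : Space → F}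

lemma fderiv_apply_eq_sum_pderiv (f : Space → F) (x z : Space) :
    fderiv ℝ f x z = ∑ k : Fin 3, z k • pderiv k f x := by
  unfold pderiv
  conv_lhs => rw [← (EuclideanSpace.basisFun (Fin 3) ℝ).sum_repr z]
  simp only [EuclideanSpace.basisFun_repr, EuclideanSpace.basisFun_apply, map_sum, map_smul]

/-- Periodic functions of class `C^{1,1}`, with `M` bounding the function, its derivative and the
Lipschitz constant of its derivative. -/
structure C11Bound (M : ℝ) (f : Space → F) : Prop where
  periodic : PeriodicZ3 f
  differentiable : Differentiable ℝ f
  norm_le : ∀ x, ‖f x‖ ≤ M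
  norm_fderiv_le : ∀ x, ‖fderiv ℝ f x‖ ≤ M
  norm_fderiv_sub_le : ∀ x y, ‖fderiv ℝ f x - fderiv ℝ f y‖ ≤ M * ‖x - y‖

namespace C11Bound

lemma nonneg (hf : C11Bound M f) : 0 ≤ M := (norm_nonneg _).trans (hf.norm_le 0)

lemma boundedPeriodic (hf : C11Bound M f) : BoundedPeriodic f :=
  ⟨hf.periodic, hf.differentiable.continuous.aestronglyMeasurable, M, hf.norm_le⟩

lemma norm_sub_le (hf : C11Bound M f) (x y : Space) : ‖f x - f y‖ ≤ M * ‖x - y‖ :=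
  convex_univ.norm_image_sub_le_of_norm_fderiv_le (𝕜 := ℝ) (fun x _ => hf.differentiable x)
    (fun x _ => hf.norm_fderiv_le x) trivial trivial

lemma lipschitzWith (hf : C11Bound M f) : LipschitzWith M.toNNReal f :=
  LipschitzWith.of_dist_le_mul fun x y => by
    rw [dist_eq_norm, dist_eq_norm, Real.coe_toNNReal _ hf.nonneg]
    exact hf.norm_sub_le x y

lemma norm_sub_sub_fderiv_le (hf : C11Bound M f) (x z : Space) :
    ‖f x - f (x - z) - fderiv ℝ f x z‖ ≤ M * ‖z‖ ^ 2 := by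
  have htaylor := (convex_closedBall x ‖z‖).norm_image_sub_le_of_norm_hasFDerivWithin_le' (𝕜 := ℝ)
    (f := f) (f' := fderiv ℝ f) (φ := fderiv ℝ f x) (C := M * ‖z‖) (x := x - z) (y := x)
    (fun y _ => (hf.differentiable y).hasFDerivAt.hasFDerivWithinAt)
    (fun y hy => (hf.norm_fderiv_sub_le y x).trans
      (mul_le_mul_of_nonneg_left (mem_closedBall_iff_norm.1 hy) hf.nonneg))
    (by simp) (by simp)
  simpa [pow_two, mul_assoc] using htaylor

lemma continuous_fderiv (hf : C11Bound M f) : Continuous (fderiv ℝ f) :=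
  (LipschitzWith.of_dist_le_mul (K := M.toNNReal) fun x y => by
    rw [dist_eq_norm, dist_eq_norm, Real.coe_toNNReal _ hf.nonneg]
    exact hf.norm_fderiv_sub_le x y).continuous

lemma norm_pderiv_le (hf : C11Bound M f) (k : Fin 3) (x : Space) : ‖pderiv k f x‖ ≤ M := by
  refine ((fderiv ℝ f x).le_opNorm _).trans ?_
  simpa using hf.norm_fderiv_le x

lemma norm_pderiv_sub_le (hf : C11Bound M f) (k : Fin 3) (x y : Space) :
    ‖pderiv k f x - pderiv k f y‖ ≤ M * ‖x - y‖ := by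
  refine le_trans ?_ (hf.norm_fderiv_sub_le x y)
  simpa [pderiv] using (fderiv ℝ f x - fderiv ℝ f y).le_opNorm (EuclideanSpace.single k 1)

lemma boundedPeriodic_pderiv (hf : C11Bound M f) (k : Fin 3) : BoundedPeriodic (pderiv k f) where
  periodic j x := by
    have hshift : f = fun y => f (y + EuclideanSpace.single j 1) :=
      funext fun y => (hf.periodic j y).symm
    unfold pderiv
    conv_rhs => rw [hshift]
    rw [fderiv_comp_add_right]
  aestronglyMeasurable :=
    (hf.continuous_fderiv.clm_apply continuous_const).aestronglyMeasurable
  exists_bound := ⟨M, hf.norm_pderiv_le k⟩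

lemma integral_pderiv {f : Space → ℝ} (hf : C11Bound M f) (k : Fin 3) :
    ∫ x in cell, pderiv k f x = 0 :=
  hf.periodic.integral_lineDeriv_eq_zero hf.lipschitzWith (v := EuclideanSpace.single k 1)
    (Eventually.of_forall fun x => (hf.differentiable x).hasFDerivAt.hasLineDerivAt _)

end C11Bound

end C11

section Step

variable {V : Type*} [NormedAddCommGroup V] [InnerProductSpace ℝ V] {u v : Space → V} {h : ℝ}

/-- `u` is obtained from `v` by one step of the thresholding scheme, at every point. -/
def IsThresholdingStep (h : ℝ) (v u : Space → V) : Prop :=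
  ∀ x, heatConv h v x ≠ 0 → u x = (‖heatConv h v x‖)⁻¹ • heatConv h v x

lemma IsThresholdingStep.norm_smul (hs : IsThresholdingStep h v u) (x : Space) :
    ‖heatConv h v x‖ • u x = heatConv h v x := by
  by_cases h0 : heatConv h v x = 0
  · simp [h0]
  · rw [hs x h0, smul_inv_smul₀ (norm_ne_zero_iff.2 h0)]

lemma IsThresholdingStep.norm_sub_heatConv_le (hs : IsThresholdingStep h v u) (hv : UnitMap v)
    (hu : UnitMap u) (x : Space) : ‖u x - heatConv h v x‖ ≤ ‖v x - heatConv h v x‖ := by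
  have hsmul : u x - heatConv h v x = (1 - ‖heatConv h v x‖) • u x := by
    rw [sub_smul, one_smul, hs.norm_smul]
  calc ‖u x - heatConv h v x‖ = |‖v x‖ - ‖heatConv h v x‖| := by
        rw [hsmul, _root_.norm_smul, hu.norm_eq_one, hv.norm_eq_one, mul_one, Real.norm_eq_abs]
    _ ≤ ‖v x - heatConv h v x‖ := abs_norm_sub_norm_le _ _

variable [CompleteSpace V]

lemma UnitMap.norm_sub_heatConv_le (hu : UnitMap u) (hh : 0 < h) (x : Space) :
    ‖u x - heatConv h u x‖ ≤ momentConst * √(defect h u x) := by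
  have hconv : heatConv h u x - u x = ∫ z, heatKernel h z • (u (x - z) - u x) := by
    have hint : Integrable fun z => heatKernel h z • u (x - z) :=
      hu.boundedPeriodic.convolutionExists (integrable_heatKernel hh) x
    simp_rw [smul_sub]
    rw [integral_sub hint ((integrable_heatKernel hh).smul_const _), integral_smul_const,
      integral_heatKernel hh, one_smul]
    rfl
  rw [norm_sub_rev, hconv, ← one_mul momentConst]
  refine hu.norm_integral_le_sqrt_defect hh x zero_le_one fun z => ?_
  have hG := heatKernel_pos hh z
  rw [norm_smul, Real.norm_of_nonneg hG.le, one_mul]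
  gcongr
  exact le_mul_of_one_le_left hG.le (one_le_weight hh z)

lemma IsThresholdingStep.norm_sub_le (hs : IsThresholdingStep h v u) (hv : UnitMap v)
    (hu : UnitMap u) (hh : 0 < h) (x : Space) :
    ‖u x - v x‖ ≤ 2 * momentConst * √(defect h v x) := by
  have htriangle := norm_sub_le_norm_sub_add_norm_sub (u x) (heatConv h v x) (v x)
  rw [norm_sub_rev (heatConv h v x)] at htriangle
  linarith [hs.norm_sub_heatConv_le hv hu x, hv.norm_sub_heatConv_le hh x]

end Step

section Taylor

variable {F : Type*} [NormedAddCommGroup F] [NormedSpace ℝ F] {h M : ℝ}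

lemma sum_gradKernel_smul_pderiv (h : ℝ) (f : Space → F) (x z : Space) :
    ∑ k, gradKernel h k z • pderiv k f x =
      -(1 / (2 * h) * heatKernel h z) • fderiv ℝ f x z := by
  rw [fderiv_apply_eq_sum_pderiv, Finset.smul_sum]
  refine Finset.sum_congr rfl fun k _ => ?_
  rw [smul_smul]
  congr 1
  simp only [gradKernel]
  ring

lemma integrable_heatKernel_smul_apply (hh : 0 < h) (L : Space →L[ℝ] F) :
    Integrable fun z => heatKernel h z • L z := by
  refine integrable_of_norm_le_weight_mul_heatKernel (c := ‖L‖ * √h) hh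
    ((continuous_heatKernel h).smul L.continuous).aestronglyMeasurable fun z => ?_
  have hG := heatKernel_pos hh z
  rw [norm_smul, Real.norm_of_nonneg hG.le]
  calc heatKernel h z * ‖L z‖ ≤ heatKernel h z * (‖L‖ * (√h * weight h z)) := by
        gcongr
        exact L.le_opNorm_of_le (norm_le_sqrt_mul_weight hh z)
    _ = ‖L‖ * √h * (weight h z * heatKernel h z) := by ring

lemma integral_heatKernel_smul_apply (h : ℝ) (L : Space →L[ℝ] F) :
    ∫ z, heatKernel h z • L z = 0 := by
  have hneg := integral_neg_eq_self (fun z => heatKernel h z • L z) volume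
  simp only [heatKernel_neg, map_neg, smul_neg, integral_neg] at hneg
  have : IsAddTorsionFree F := .of_isTorsionFree ℝ F
  exact self_eq_neg.1 hneg.symm

namespace C11Bound

lemma norm_sub_comp_sub_le {f : Space → F} (hf : C11Bound M f) (hh : 0 < h) (x z : Space) :
    ‖f x - f (x - z)‖ ≤ M * (√h * weight h z) := by
  refine (hf.norm_sub_le _ _).trans ?_
  rw [sub_sub_cancel]
  have := hf.nonneg
  gcongr
  exact norm_le_sqrt_mul_weight hh z

lemma norm_sub_sub_fderiv_le_weight {f : Space → F} (hf : C11Bound M f) (hh : 0 < h)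
    (x z : Space) : ‖f x - f (x - z) - fderiv ℝ f x z‖ ≤ M * (h * weight h z) := by
  refine (hf.norm_sub_sub_fderiv_le x z).trans ?_
  have := hf.nonneg
  gcongr
  exact norm_sq_le_mul_weight hh z

/-- The first-order Taylor term is odd in `z`, so it integrates to zero against `G_h`. -/
lemma norm_integral_heatKernel_smul_sub_le {f : Space → F} (hf : C11Bound M f) (hh : 0 < h)
    (x : Space) : ‖∫ z, heatKernel h z • (f x - f (x - z))‖ ≤ M * h * momentConst := by
  have hremainder (z : Space) : ‖heatKernel h z • (f x - f (x - z) - fderiv ℝ f x z)‖ ≤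
      M * h * (weight h z ^ 1 * heatKernel h z) := by
    have hG := heatKernel_pos hh z
    rw [norm_smul, Real.norm_of_nonneg hG.le]
    calc heatKernel h z * ‖f x - f (x - z) - fderiv ℝ f x z‖
        ≤ heatKernel h z * (M * (h * weight h z)) := by
          gcongr
          exact hf.norm_sub_sub_fderiv_le_weight hh x z
      _ = M * h * (weight h z ^ 1 * heatKernel h z) := by ring
  have hfmeas := aestronglyMeasurable_comp_sub_left hf.boundedPeriodic.aestronglyMeasurable x
  have hint : Integrable fun z => heatKernel h z • (f x - f (x - z)) :=
    (integrable_heatKernel hh).smul_bdd (2 * M) (aestronglyMeasurable_const.sub hfmeas)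
      (Eventually.of_forall fun z => (_root_.norm_sub_le _ _).trans (by
        linarith [hf.norm_le x, hf.norm_le (x - z)]))
  have hM := hf.nonneg
  calc ‖∫ z, heatKernel h z • (f x - f (x - z))‖
      = ‖∫ z, heatKernel h z • (f x - f (x - z) - fderiv ℝ f x z)‖ := by
        simp_rw [smul_sub _ (f x - _)]
        rw [integral_sub hint (integrable_heatKernel_smul_apply hh _),
          integral_heatKernel_smul_apply, sub_zero]
    _ ≤ ∫ z, M * h * (weight h z ^ 1 * heatKernel h z) :=
        norm_integral_le_of_norm_le ((integrable_weight_pow_mul_heatKernel hh 1).const_mul _)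
          (Eventually.of_forall hremainder)
    _ ≤ M * h * momentConst := by
        rw [integral_const_mul]
        gcongr
        exact integral_weight_pow_mul_heatKernel_le_momentConst hh (by norm_num)

end C11Bound

end Taylor

section Commutator

variable {V : Type*} [NormedAddCommGroup V] {u : Space → V} {ζ : Space → ℝ} {h M : ℝ}

lemma BoundedPeriodic.integrable_heatKernel_smul_sub_smul [NormedSpace ℝ V] (hu : BoundedPeriodic u)
    (hζ : BoundedPeriodic ζ) (hh : 0 < h) (x : Space) :
    Integrable fun z => heatKernel h z • (ζ x - ζ (x - z)) • u (x - z) := by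
  have hconv := (hu.convolutionExists (integrable_heatKernel hh) x).smul (ζ x)
  refine (hconv.sub ((hζ.smul hu).convolutionExists (integrable_heatKernel hh) x)).congr
    (Eventually.of_forall fun z => ?_)
  simp [sub_smul, smul_sub, smul_comm (heatKernel h z)]

variable [InnerProductSpace ℝ V] [CompleteSpace V]

/-- Split off `u(x)`, against which the first-order term of `ζ` cancels. -/
lemma UnitMap.norm_integral_heatKernel_smul_sub_smul_le (hu : UnitMap u) (hh : 0 < h)
    (hζ : C11Bound M ζ) (x : Space) :
    ‖∫ z, heatKernel h z • (ζ x - ζ (x - z)) • u (x - z)‖ ≤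
      M * momentConst * (√h * √(defect h u x) + h) := by
  have hM := hζ.nonneg
  have hincr : ‖∫ z, heatKernel h z • (ζ x - ζ (x - z)) • (u (x - z) - u x)‖ ≤
      M * √h * momentConst * √(defect h u x) := by
    refine hu.norm_integral_le_sqrt_defect hh x (by positivity) fun z => ?_
    have hG := heatKernel_pos hh z
    rw [norm_smul, norm_smul, Real.norm_of_nonneg hG.le]
    calc heatKernel h z * (‖ζ x - ζ (x - z)‖ * ‖u (x - z) - u x‖)
        ≤ heatKernel h z * (M * (√h * weight h z) * ‖u (x - z) - u x‖) := by
          gcongr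
          exact hζ.norm_sub_comp_sub_le hh x z
      _ = M * √h * (weight h z * heatKernel h z * ‖u (x - z) - u x‖) := by ring
  have hu_int := hu.boundedPeriodic.integrable_heatKernel_smul_sub_smul hζ.boundedPeriodic hh x
  have hconst_int := (BoundedPeriodic.const (u x)).integrable_heatKernel_smul_sub_smul
    hζ.boundedPeriodic hh x
  have hsplit : ∫ z, heatKernel h z • (ζ x - ζ (x - z)) • u (x - z) =
      (∫ z, heatKernel h z • (ζ x - ζ (x - z)) • (u (x - z) - u x)) +
        (∫ z, heatKernel h z • (ζ x - ζ (x - z))) • u x := by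
    rw [← integral_smul_const, ← sub_eq_iff_eq_add]
    simp only [smul_assoc]
    rw [← integral_sub hu_int hconst_int]
    congr 1 with z
    rw [smul_sub (ζ x - ζ (x - z)), smul_sub (heatKernel h z)]
  calc ‖∫ z, heatKernel h z • (ζ x - ζ (x - z)) • u (x - z)‖
      ≤ M * √h * momentConst * √(defect h u x) + M * h * momentConst := by
        rw [hsplit]
        refine norm_add_le_of_le hincr ?_
        rw [norm_smul, hu.norm_eq_one, mul_one]
        exact hζ.norm_integral_heatKernel_smul_sub_le hh x
    _ = M * momentConst * (√h * √(defect h u x) + h) := by ring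

end Commutator

section Wedge

variable {n : ℕ} {u v w : Space → EuclideanSpace ℝ (Fin n)} {ζ : Space → ℝ} {h M : ℝ}

/-- The antisymmetric product `u_j(x) v_i(x - z) - u_i(x) v_j(x - z)`. -/
def wedge (u v : Space → EuclideanSpace ℝ (Fin n)) (i j : Fin n) (x z : Space) : ℝ :=
  u x j * v (x - z) i - u x i * v (x - z) j

/-- `∫ (u_j G_h ∗ v_i - u_i G_h ∗ v_j) ζ dx`. -/
def wedgeForm (h : ℝ) (u v : Space → EuclideanSpace ℝ (Fin n)) (ζ : Space → ℝ) (i j : Fin n) : ℝ :=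
  doubleIntegral fun x z => heatKernel h z * (wedge u v i j x z * ζ x)

/-- `∫ (u_j [ζ, G_h ∗] v_i - u_i [ζ, G_h ∗] v_j) dx`, with the commutator `[ζ, G_h ∗]` of the
multiplication by `ζ` and the convolution with `G_h`. -/
def wedgeCommutator (h : ℝ) (u v : Space → EuclideanSpace ℝ (Fin n)) (ζ : Space → ℝ)
    (i j : Fin n) : ℝ :=
  doubleIntegral fun x z => heatKernel h z * ((ζ x - ζ (x - z)) * wedge u v i j x z)

/-- `∫ (u_j ∇G_h ∗ u_i - u_i ∇G_h ∗ u_j) · ∇ζ dx`. -/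
def wedgeFlux (h : ℝ) (u : Space → EuclideanSpace ℝ (Fin n)) (ζ : Space → ℝ) (i j : Fin n) : ℝ :=
  ∑ k, doubleIntegral fun x z => gradKernel h k z * (wedge u u i j x z * pderiv k ζ x)

lemma boundedPeriodicPair_wedge (hu : BoundedPeriodic u) (hv : BoundedPeriodic v) (i j : Fin n) :
    BoundedPeriodicPair (wedge u v i j) :=
  ((hu.coord j).pair_fst.mul (hv.coord i).pair_sub).sub
    ((hu.coord i).pair_fst.mul (hv.coord j).pair_sub)

lemma UnitMap.abs_wedge_le (hu : UnitMap u) (i j : Fin n) (x z : Space) :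
    |wedge u u i j x z| ≤ 2 * ‖u (x - z) - u x‖ := by
  have hcoord (k l : Fin n) : |u x k * (u (x - z) - u x) l| ≤ ‖u (x - z) - u x‖ := by
    rw [abs_mul, ← one_mul ‖u (x - z) - u x‖, ← hu.norm_eq_one x]
    gcongr
    · exact PiLp.norm_apply_le (u x) k
    · exact PiLp.norm_apply_le (u (x - z) - u x) l
  calc |wedge u u i j x z| = |u x j * (u (x - z) - u x) i - u x i * (u (x - z) - u x) j| := by
        simp only [wedge, PiLp.sub_apply]
        ring_nf
    _ ≤ |u x j * (u (x - z) - u x) i| + |u x i * (u (x - z) - u x) j| := abs_sub _ _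
    _ ≤ 2 * ‖u (x - z) - u x‖ := by linarith [hcoord j i, hcoord i j]

lemma integral_wedge_convolution (hv : BoundedPeriodic v) {K : Space → ℝ} (hK : Integrable K)
    (f : Space → ℝ) (i j : Fin n) :
    ∫ x in cell, (u x j * (K ⋆ fun y => v y i) x - u x i * (K ⋆ fun y => v y j) x) * f x =
      doubleIntegral fun x z => K z * (wedge u v i j x z * f x) := by
  have hint (k : Fin n) (x : Space) : Integrable fun z => K z • v (x - z) k :=
    (hv.coord k).convolutionExists hK x
  unfold doubleIntegral
  congr 1 with x
  rw [convolution_lsmul, convolution_lsmul, ← integral_const_mul, ← integral_const_mul,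
    ← integral_sub ((hint i x).const_mul _) ((hint j x).const_mul _), ← integral_mul_const]
  congr 1 with z
  simp only [wedge, smul_eq_mul]
  ring

/-- Exchanging `x` and `x - z` exchanges the arguments of the antisymmetric `wedge`. -/
lemma wedgeCommutator_eq_add (hu : BoundedPeriodic u) (hv : BoundedPeriodic v) (hh : 0 < h)
    (hζ : BoundedPeriodic ζ) (i j : Fin n) :
    wedgeCommutator h u v ζ i j = wedgeForm h u v ζ i j + wedgeForm h v u ζ i j := by
  have hdom {a b : Space → EuclideanSpace ℝ (Fin n)} (ha : BoundedPeriodic a)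
      (hb : BoundedPeriodic b) :
      IsDominatedIntegrand fun x z => heatKernel h z * (wedge a b i j x z * ζ x) :=
    ((boundedPeriodicPair_wedge ha hb i j).mul hζ.pair_fst).kernel_mul (integrable_heatKernel hh)
  rw [wedgeForm, wedgeForm, ← (hdom hv hu).doubleIntegral_comp_sub_neg,
    ← (hdom hu hv).doubleIntegral_add (hdom hv hu).comp_sub_neg, wedgeCommutator]
  congr 1 with x z
  simp only [wedge, heatKernel_neg, sub_neg_eq_add, sub_add_cancel]
  ring

lemma wedgeCommutator_sub_left (hu : BoundedPeriodic u) (hv : BoundedPeriodic v)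
    (hw : BoundedPeriodic w) (hh : 0 < h) (hζ : BoundedPeriodic ζ) (i j : Fin n) :
    wedgeCommutator h (fun x => u x - v x) w ζ i j =
      wedgeCommutator h u w ζ i j - wedgeCommutator h v w ζ i j := by
  have hdom {a : Space → EuclideanSpace ℝ (Fin n)} (ha : BoundedPeriodic a) :
      IsDominatedIntegrand
        fun x z => heatKernel h z * ((ζ x - ζ (x - z)) * wedge a w i j x z) :=
    ((hζ.pair_fst.sub hζ.pair_sub).mul (boundedPeriodicPair_wedge ha hw i j)).kernel_mul
      (integrable_heatKernel hh)
  unfold wedgeCommutator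
  rw [← (hdom hu).doubleIntegral_sub (hdom hv)]
  congr 1 with x z
  simp only [wedge, PiLp.sub_apply]
  ring

/-- Since `∇G_h(z) = -z G_h(z) / (2h)`, the flux is the first-order term of the commutator. -/
lemma UnitMap.abs_wedgeCommutator_add_wedgeFlux_le (hu : UnitMap u) (hh : 0 < h)
    (hζ : C11Bound M ζ) (i j : Fin n) :
    |1 / (2 * h) * wedgeCommutator h u u ζ i j + wedgeFlux h u ζ i j| ≤
      M * momentConst * ∫ x in cell, √(defect h u x) := by
  have hwedge := boundedPeriodicPair_wedge hu.boundedPeriodic hu.boundedPeriodic i j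
  have hcomm : IsDominatedIntegrand
      fun x z => heatKernel h z * ((ζ x - ζ (x - z)) * wedge u u i j x z) :=
    ((hζ.boundedPeriodic.pair_fst.sub hζ.boundedPeriodic.pair_sub).mul hwedge).kernel_mul
      (integrable_heatKernel hh)
  have hflux : ∀ k ∈ Finset.univ, IsDominatedIntegrand
      fun x z => gradKernel h k z * (wedge u u i j x z * pderiv k ζ x) := fun k _ =>
    (hwedge.mul (hζ.boundedPeriodic_pderiv k).pair_fst).kernel_mul (integrable_gradKernel hh k)
  have hintegrand (x z : Space) :
      1 / (2 * h) * (heatKernel h z * ((ζ x - ζ (x - z)) * wedge u u i j x z)) +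
        ∑ k, gradKernel h k z * (wedge u u i j x z * pderiv k ζ x) =
      1 / (2 * h) * heatKernel h z * wedge u u i j x z * (ζ x - ζ (x - z) - fderiv ℝ ζ x z) := by
    have hsum := sum_gradKernel_smul_pderiv h ζ x z
    simp only [smul_eq_mul] at hsum
    simp_rw [mul_left_comm (gradKernel h _ z)]
    rw [← Finset.mul_sum, hsum]
    ring
  rw [wedgeCommutator, wedgeFlux, ← doubleIntegral_const_mul,
    ← IsDominatedIntegrand.doubleIntegral_sum hflux,
    ← (hcomm.const_mul _).doubleIntegral_add (IsDominatedIntegrand.sum hflux),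
    ← integral_const_mul]
  refine abs_doubleIntegral_le ((hu.integrable_sqrt_defect hh).const_mul _) fun x => ?_
  simp_rw [hintegrand, ← Real.norm_eq_abs]
  refine hu.norm_integral_le_sqrt_defect hh x hζ.nonneg fun z => ?_
  have hG := heatKernel_pos hh z
  rw [norm_mul, norm_mul, Real.norm_of_nonneg (by positivity : 0 ≤ 1 / (2 * h) * heatKernel h z)]
  calc 1 / (2 * h) * heatKernel h z * ‖wedge u u i j x z‖ * ‖ζ x - ζ (x - z) - fderiv ℝ ζ x z‖
      ≤ 1 / (2 * h) * heatKernel h z * (2 * ‖u (x - z) - u x‖) * (M * (h * weight h z)) := by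
        gcongr
        · exact hu.abs_wedge_le i j x z
        · exact hζ.norm_sub_sub_fderiv_le_weight hh x z
    _ = M * (weight h z * heatKernel h z * ‖u (x - z) - u x‖) := by field_simp

lemma UnitMap.abs_wedgeFlux_le (hu : UnitMap u) (hh : 0 < h) (hζ : C11Bound M ζ) (i j : Fin n) :
    |wedgeFlux h u ζ i j| ≤ 6 * M / √h * momentConst * ∫ x in cell, √(defect h u x) := by
  have hM := hζ.nonneg
  have hterm (k : Fin 3) :
      |doubleIntegral fun x z => gradKernel h k z * (wedge u u i j x z * pderiv k ζ x)| ≤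
        2 * M / √h * momentConst * ∫ x in cell, √(defect h u x) := by
    rw [← integral_const_mul]
    refine abs_doubleIntegral_le ((hu.integrable_sqrt_defect hh).const_mul _) fun x => ?_
    rw [← Real.norm_eq_abs]
    refine hu.norm_integral_le_sqrt_defect hh x (by positivity) fun z => ?_
    rw [norm_mul, norm_mul]
    have hG := heatKernel_pos hh z
    have hw := one_le_weight hh z
    calc ‖gradKernel h k z‖ * (‖wedge u u i j x z‖ * ‖pderiv k ζ x‖)
        ≤ 1 / √h * (weight h z * heatKernel h z) * (2 * ‖u (x - z) - u x‖ * M) := by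
          gcongr
          · exact abs_gradKernel_le hh k z
          · exact hu.abs_wedge_le i j x z
          · exact hζ.norm_pderiv_le k x
      _ = 2 * M / √h * (weight h z * heatKernel h z * ‖u (x - z) - u x‖) := by ring
  calc |wedgeFlux h u ζ i j|
      ≤ ∑ _k : Fin 3, 2 * M / √h * momentConst * ∫ x in cell, √(defect h u x) :=
        (Finset.abs_sum_le_sum_abs _ _).trans (Finset.sum_le_sum fun k _ => hterm k)
    _ = 6 * M / √h * momentConst * ∫ x in cell, √(defect h u x) := by
        simp only [Finset.sum_const, Finset.card_univ, Fintype.card_fin, nsmul_eq_mul]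
        push_cast
        ring

lemma heatConv_coord (hu : BoundedPeriodic u) (hh : 0 < h) (i : Fin n) (x : Space) :
    heatConv h (fun y => u y i) x = heatConv h u x i :=
  convolution_clm_comp hu (integrable_heatKernel hh) (EuclideanSpace.proj i) x

lemma IsThresholdingStep.wedgeForm_eq_zero (hs : IsThresholdingStep h v u)
    (hv : BoundedPeriodic v) (hh : 0 < h) (ζ : Space → ℝ) (i j : Fin n) :
    wedgeForm h u v ζ i j = 0 := by
  have hparallel (x : Space) : u x j * heatConv h v x i - u x i * heatConv h v x j = 0 := by
    rw [← hs.norm_smul x]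
    simp only [PiLp.smul_apply, smul_eq_mul]
    ring
  simp only [wedgeForm, ← integral_wedge_convolution hv (integrable_heatKernel hh),
    ← heatConv_eq_convolution, heatConv_coord hv hh, hparallel, zero_mul, integral_zero]

/-- Pointwise, the product of the bounds on `u - v` and on the commutator `[ζ, G_h ∗] v`. -/
lemma IsThresholdingStep.abs_wedgeCommutator_sub_le (hs : IsThresholdingStep h v u)
    (hv : UnitMap v) (hu : UnitMap u) (hh : 0 < h) (hζ : C11Bound M ζ) (i j : Fin n) :
    |wedgeCommutator h (fun x => u x - v x) v ζ i j| ≤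
      4 * M * momentConst ^ 2 * ∫ x in cell, (√h * defect h v x + h * √(defect h v x)) := by
  have hA := momentConst_pos
  rw [← integral_const_mul]
  refine abs_doubleIntegral_le ((((hv.integrable_defect hh).const_mul _).add
    ((hv.integrable_sqrt_defect hh).const_mul _)).const_mul _) fun x => ?_
  set Φ := ∫ z, heatKernel h z • (ζ x - ζ (x - z)) • v (x - z)
  have hint := hv.boundedPeriodic.integrable_heatKernel_smul_sub_smul hζ.boundedPeriodic hh x
  have hcoord (k : Fin n) :
      ∫ z, heatKernel h z * ((ζ x - ζ (x - z)) * v (x - z) k) = Φ k :=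
    (EuclideanSpace.proj k : _ →L[ℝ] ℝ).integral_comp_comm hint
  have hintCoord (k : Fin n) :
      Integrable fun z => heatKernel h z * ((ζ x - ζ (x - z)) * v (x - z) k) :=
    (EuclideanSpace.proj k : _ →L[ℝ] ℝ).integrable_comp hint
  have hwedge :
      ∫ z, heatKernel h z * ((ζ x - ζ (x - z)) * wedge (fun x => u x - v x) v i j x z) =
        (u x - v x) j * Φ i - (u x - v x) i * Φ j := by
    rw [← hcoord, ← hcoord, ← integral_const_mul, ← integral_const_mul,
      ← integral_sub ((hintCoord i).const_mul _) ((hintCoord j).const_mul _)]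
    congr 1 with z
    simp only [wedge]
    ring
  have hproduct (k l : Fin n) : |(u x - v x) k * Φ l| ≤
      2 * momentConst * √(defect h v x) * (M * momentConst * (√h * √(defect h v x) + h)) := by
    rw [abs_mul]
    gcongr
    · exact (PiLp.norm_apply_le _ k).trans (hs.norm_sub_le hv hu hh x)
    · exact (PiLp.norm_apply_le _ l).trans (hv.norm_integral_heatKernel_smul_sub_smul_le hh hζ x)
  rw [hwedge]
  refine (abs_sub _ _).trans ((add_le_add (hproduct j i) (hproduct i j)).trans (le_of_eq ?_))
  linear_combination 4 * momentConst ^ 2 * M * √h * Real.mul_self_sqrt (hv.defect_nonneg hh x)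

end Wedge

section OuterVariation

variable {n : ℕ} {u v : Space → EuclideanSpace ℝ (Fin n)} {ζ : Space → ℝ} {h M : ℝ}

/-- The spatial integrand of `outerForm`, where `u` and `v` are the maps at the times `t` and
`t - τ`. -/
def outerIntegrand (h τ : ℝ) (u v : Space → EuclideanSpace ℝ (Fin n)) (ζ : Space → ℝ)
    (i j : Fin n) (x : Space) : ℝ :=
  (u x j * (τ⁻¹ • (heatConv h (fun y => u y i) x - heatConv h (fun y => v y i) x)) -
      u x i * (τ⁻¹ • (heatConv h (fun y => u y j) x - heatConv h (fun y => v y j) x))) * ζ x +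
    ∑ k : Fin 3, (u x j * pderiv k (heatConv h fun y => u y i) x -
      u x i * pderiv k (heatConv h fun y => u y j) x) * pderiv k ζ x

lemma integral_outerIntegrand (hu : BoundedPeriodic u) (hv : BoundedPeriodic v) (hh : 0 < h)
    (hζ : C11Bound M ζ) (τ : ℝ) (i j : Fin n) :
    ∫ x in cell, outerIntegrand h τ u v ζ i j x =
      τ⁻¹ * (wedgeForm h u u ζ i j - wedgeForm h u v ζ i j) + wedgeFlux h u ζ i j := by
  have hint {K f : Space → ℝ} {w : Space → EuclideanSpace ℝ (Fin n)} (hK : Integrable K)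
      (hf : BoundedPeriodic f) (hw : BoundedPeriodic w) :
      Integrable (fun x => (u x j * (K ⋆ fun y => w y i) x - u x i * (K ⋆ fun y => w y j) x) * f x)
        (volume.restrict cell) :=
    ((((hu.coord j).mul ((hw.coord i).convolution hK)).sub
      ((hu.coord i).mul ((hw.coord j).convolution hK))).mul hf).integrable_cell
  have hheat {w : Space → EuclideanSpace ℝ (Fin n)} (hw : BoundedPeriodic w) :=
    hint (integrable_heatKernel hh) hζ.boundedPeriodic hw
  have hgrad (k : Fin 3) := hint (integrable_gradKernel hh k) (hζ.boundedPeriodic_pderiv k) hu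
  have hpoint (x : Space) : outerIntegrand h τ u v ζ i j x =
      τ⁻¹ * ((u x j * (heatKernel h ⋆ fun y => u y i) x -
          u x i * (heatKernel h ⋆ fun y => u y j) x) * ζ x -
        (u x j * (heatKernel h ⋆ fun y => v y i) x -
          u x i * (heatKernel h ⋆ fun y => v y j) x) * ζ x) +
      ∑ k, (u x j * (gradKernel h k ⋆ fun y => u y i) x -
        u x i * (gradKernel h k ⋆ fun y => u y j) x) * pderiv k ζ x := by
    simp only [outerIntegrand, (hu.coord _).pderiv_heatConv hh]
    simp only [heatConv_eq_convolution, smul_eq_mul]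
    ring
  simp_rw [hpoint]
  rw [integral_add (Integrable.const_mul (by exact (hheat hu).sub (hheat hv)) _)
      (integrable_finsetSum _ fun k _ => hgrad k), integral_const_mul,
    integral_sub (hheat hu) (hheat hv), integral_finsetSum _ fun k _ => hgrad k]
  simp only [integral_wedge_convolution hu (integrable_heatKernel hh),
    integral_wedge_convolution hv (integrable_heatKernel hh),
    integral_wedge_convolution hu (integrable_gradKernel hh _), wedgeForm, wedgeFlux]

lemma UnitMap.abs_integral_outerIntegrand_self_le (hu : UnitMap u) (hh : 0 < h)
    (hζ : C11Bound M ζ) (τ : ℝ) (i j : Fin n) :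
    |∫ x in cell, outerIntegrand h τ u u ζ i j x| ≤
      6 * M / √h * momentConst * ∫ x in cell, √(defect h u x) := by
  rw [integral_outerIntegrand hu.boundedPeriodic hu.boundedPeriodic hh hζ, sub_self, mul_zero,
    zero_add]
  exact hu.abs_wedgeFlux_le hh hζ i j

lemma IsThresholdingStep.abs_integral_outerIntegrand_backward_le (hs : IsThresholdingStep h v u)
    (hv : UnitMap v) (hu : UnitMap u) (hh : 0 < h) (hζ : C11Bound M ζ) (i j : Fin n) :
    |∫ x in cell, outerIntegrand h h u v ζ i j x| ≤
      M * momentConst * ∫ x in cell, √(defect h u x) := by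
  refine le_of_eq_of_le (congrArg _ ?_) (hu.abs_wedgeCommutator_add_wedgeFlux_le hh hζ i j)
  rw [integral_outerIntegrand hu.boundedPeriodic hv.boundedPeriodic hh hζ,
    hs.wedgeForm_eq_zero hv.boundedPeriodic hh,
    wedgeCommutator_eq_add hu.boundedPeriodic hu.boundedPeriodic hh hζ.boundedPeriodic]
  field_simp
  ring

/-- The scheme makes `∫ (u_j G_h ∗ v_i - u_i G_h ∗ v_j) ζ` vanish, but the forward quotient contains
the form with the roles of `u` and `v` exchanged; the two differ by a commutator. -/
lemma IsThresholdingStep.integral_outerIntegrand_forward (hs : IsThresholdingStep h v u)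
    (hv : UnitMap v) (hu : UnitMap u) (hh : 0 < h) (hζ : C11Bound M ζ) (i j : Fin n) :
    ∫ x in cell, outerIntegrand h (-h) v u ζ i j x =
      (1 / (2 * h) * wedgeCommutator h v v ζ i j + wedgeFlux h v ζ i j) +
        1 / h * wedgeCommutator h (fun x => u x - v x) v ζ i j := by
  have hv' := hv.boundedPeriodic
  have hu' := hu.boundedPeriodic
  have hζ' := hζ.boundedPeriodic
  rw [integral_outerIntegrand hv' hu' hh hζ, wedgeCommutator_sub_left hu' hv' hv' hh hζ',
    wedgeCommutator_eq_add hu' hv' hh hζ', wedgeCommutator_eq_add hv' hv' hh hζ',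
    hs.wedgeForm_eq_zero hv' hh]
  field_simp
  ring

lemma IsThresholdingStep.abs_integral_outerIntegrand_forward_le (hs : IsThresholdingStep h v u)
    (hv : UnitMap v) (hu : UnitMap u) (hh : 0 < h) (hζ : C11Bound M ζ) (i j : Fin n) :
    |∫ x in cell, outerIntegrand h (-h) v u ζ i j x| ≤
      5 * M * momentConst ^ 2 * ∫ x in cell, (√(defect h v x) + defect h v x / √h) := by
  have hM := hζ.nonneg
  have hA := one_le_momentConst
  have hrescale : 1 / h * (4 * M * momentConst ^ 2 *
      ∫ x in cell, (√h * defect h v x + h * √(defect h v x))) =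
      4 * M * momentConst ^ 2 * ∫ x in cell, (√(defect h v x) + defect h v x / √h) := by
    rw [mul_left_comm, ← integral_const_mul]
    congr 2 with x
    field_simp
    linear_combination defect h v x * Real.sq_sqrt hh.le
  have hmono : ∫ x in cell, √(defect h v x) ≤
      ∫ x in cell, (√(defect h v x) + defect h v x / √h) := by
    refine integral_mono (hv.integrable_sqrt_defect hh)
      ((hv.integrable_sqrt_defect hh).add ((hv.integrable_defect hh).div_const _)) fun x => ?_
    exact le_add_of_nonneg_right (div_nonneg (hv.defect_nonneg hh x) (Real.sqrt_nonneg h))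
  have hsquare : momentConst ≤ momentConst ^ 2 := by nlinarith
  have hlast : |1 / h * wedgeCommutator h (fun x => u x - v x) v ζ i j| ≤
      4 * M * momentConst ^ 2 * ∫ x in cell, (√(defect h v x) + defect h v x / √h) := by
    rw [← hrescale, abs_mul, abs_of_pos (show 0 < 1 / h by positivity)]
    gcongr
    exact hs.abs_wedgeCommutator_sub_le hv hu hh hζ i j
  rw [hs.integral_outerIntegrand_forward hv hu hh hζ]
  calc |(1 / (2 * h) * wedgeCommutator h v v ζ i j + wedgeFlux h v ζ i j) +
        1 / h * wedgeCommutator h (fun x => u x - v x) v ζ i j|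
      ≤ M * momentConst * (∫ x in cell, √(defect h v x)) + 4 * M * momentConst ^ 2 *
          ∫ x in cell, (√(defect h v x) + defect h v x / √h) :=
        (abs_add_le _ _).trans
          (add_le_add (hv.abs_wedgeCommutator_add_wedgeFlux_le hh hζ i j) hlast)
    _ ≤ M * momentConst ^ 2 * (∫ x in cell, (√(defect h v x) + defect h v x / √h)) +
          4 * M * momentConst ^ 2 * ∫ x in cell, (√(defect h v x) + defect h v x / √h) := by
        gcongr
    _ = 5 * M * momentConst ^ 2 * ∫ x in cell, (√(defect h v x) + defect h v x / √h) := by ring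

end OuterVariation

section CommutatorKernel

variable {V : Type*} [NormedAddCommGroup V] {u φ : Space → V} {f : Space → ℝ} {h M : ℝ}

lemma abs_gradKernel_half_le (hh : 0 < h) (k : Fin 3) (z : Space) :
    |gradKernel (h / 2) k z| ≤ 3 * (‖z‖ / h * heatKernel h z) := by
  have hG₂ := heatKernel_pos (half_pos hh) z
  calc |gradKernel (h / 2) k z| = ‖z k‖ / h * heatKernel (h / 2) z := by
        rw [gradKernel, abs_mul, abs_neg, abs_div, abs_of_pos hG₂, mul_div_cancel₀ h two_ne_zero,
          abs_of_pos hh, Real.norm_eq_abs]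
    _ ≤ ‖z‖ / h * (3 * heatKernel h z) := by
        gcongr
        · exact PiLp.norm_apply_le z k
        · exact heatKernel_half_le hh z
    _ = 3 * (‖z‖ / h * heatKernel h z) := by ring

lemma abs_gradKernel_half_le_weight (hh : 0 < h) (k : Fin 3) (z : Space) :
    |gradKernel (h / 2) k z| ≤ 3 / √h * (weight h z * heatKernel h z) := by
  have hG := heatKernel_pos hh z
  calc |gradKernel (h / 2) k z| ≤ 3 * (‖z‖ / h * heatKernel h z) := abs_gradKernel_half_le hh k z
    _ ≤ 3 * (√h * weight h z / h * heatKernel h z) := by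
        gcongr
        exact norm_le_sqrt_mul_weight hh z
    _ = 3 * (√h / h) * (weight h z * heatKernel h z) := by ring
    _ = 3 / √h * (weight h z * heatKernel h z) := by rw [Real.sqrt_div_self', mul_one_div]

lemma abs_gradKernel_half_mul_norm_le (hh : 0 < h) (k : Fin 3) (z : Space) :
    |gradKernel (h / 2) k z| * ‖z‖ ≤ 3 * (weight h z * heatKernel h z) := by
  have hG := heatKernel_pos hh z
  calc |gradKernel (h / 2) k z| * ‖z‖ ≤ 3 * (‖z‖ / h * heatKernel h z) * ‖z‖ := by
        gcongr
        exact abs_gradKernel_half_le hh k z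
    _ = 3 * (‖z‖ ^ 2 / h * heatKernel h z) := by ring
    _ ≤ 3 * (weight h z * heatKernel h z) := by
        gcongr
        rw [div_le_iff₀' hh]
        exact norm_sq_le_mul_weight hh z

lemma abs_gradKernel_half_mul_sub_le (hh : 0 < h) (hM : 0 ≤ M)
    (hf : ∀ x y, |f x - f y| ≤ M * ‖x - y‖) (k : Fin 3) (x z : Space) :
    |gradKernel (h / 2) k z * (f (x - z) - f x)| ≤ 3 * M * (weight h z * heatKernel h z) := by
  rw [abs_mul]
  calc |gradKernel (h / 2) k z| * |f (x - z) - f x| ≤ |gradKernel (h / 2) k z| * (M * ‖z‖) := by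
        gcongr
        simpa using hf (x - z) x
    _ = M * (|gradKernel (h / 2) k z| * ‖z‖) := by ring
    _ ≤ M * (3 * (weight h z * heatKernel h z)) :=
        mul_le_mul_of_nonneg_left (abs_gradKernel_half_mul_norm_le hh k z) hM
    _ = 3 * M * (weight h z * heatKernel h z) := by ring

lemma BoundedPeriodic.integrable_mul_sub (hf : BoundedPeriodic f) {K : Space → ℝ}
    (hK : Integrable K) (x : Space) : Integrable fun z => K z * (f (x - z) - f x) := by
  have hconv : Integrable fun z => K z * f (x - z) := hf.convolutionExists hK x
  exact (hconv.sub (hK.mul_const (f x))).congr (Eventually.of_forall fun z => (mul_sub _ _ _).symm)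

lemma C11Bound.integrable_mul_pderiv (hf : C11Bound M f) {K : Space → ℝ} (hK : Integrable K)
    (k : Fin 3) (x : Space) : Integrable fun z => K z * pderiv k f (x - z) :=
  (hf.boundedPeriodic_pderiv k).convolutionExists hK x

lemma C11Bound.integral_heatKernel_mul_pderiv (hf : C11Bound M f) (hh : 0 < h) (k : Fin 3)
    (x : Space) : ∫ z, heatKernel h z * pderiv k f (x - z) =
      ∫ z, gradKernel h k z * (f (x - z) - f x) := by
  have hderiv (z : Space) :
      HasFDerivAt (fun z => f (x - z) - f x) (-fderiv ℝ f (x - z)) z := by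
    have hcomp := (hf.differentiable (x - z)).hasFDerivAt.comp z ((hasFDerivAt_id z).const_sub x)
    exact (hcomp.sub_const (f x)).congr_fderiv (by ext; simp)
  have hsingle (z : Space) : fderiv ℝ (fun z => f (x - z) - f x) z (EuclideanSpace.single k 1) =
      -pderiv k f (x - z) := by
    rw [(hderiv z).fderiv]
    rfl
  have hparts := integral_mul_fderiv_eq_neg_fderiv_mul_of_integrable (𝕜 := ℝ)
    (μ := (volume : Measure Space)) (f := heatKernel h) (g := fun z => f (x - z) - f x)
    (v := EuclideanSpace.single k 1) ?_ ?_
    (hf.boundedPeriodic.integrable_mul_sub (integrable_heatKernel hh) x)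
    (fun z _ => (hasFDerivAt_heatKernel h z).differentiableAt)
    (fun z _ => (hderiv z).differentiableAt)
  · simp_rw [hsingle, fderiv_heatKernel_single, mul_neg, integral_neg] at hparts
    exact neg_injective hparts
  · simp_rw [fderiv_heatKernel_single]
    exact hf.boundedPeriodic.integrable_mul_sub (integrable_gradKernel hh k) x
  · simp_rw [hsingle, mul_neg]
    exact (hf.integrable_mul_pderiv (integrable_heatKernel hh) k x).neg

/-- The kernel of the commutator of `G_h ∗` with `f ∂_k`. -/
def commutatorKernel (h : ℝ) (k : Fin 3) (f : Space → ℝ) (x z : Space) : ℝ :=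
  heatKernel h z * pderiv k f (x - z) - gradKernel h k z * (f (x - z) - f x)

lemma integrable_commutatorKernel (hf : C11Bound M f) (hh : 0 < h) (k : Fin 3) (x : Space) :
    Integrable (commutatorKernel h k f x) :=
  (hf.integrable_mul_pderiv (integrable_heatKernel hh) k x).sub
    (hf.boundedPeriodic.integrable_mul_sub (integrable_gradKernel hh k) x)

lemma integral_commutatorKernel (hf : C11Bound M f) (hh : 0 < h) (k : Fin 3) (x : Space) :
    ∫ z, commutatorKernel h k f x z = 0 := by
  unfold commutatorKernel
  rw [integral_sub (hf.integrable_mul_pderiv (integrable_heatKernel hh) k x)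
    (hf.boundedPeriodic.integrable_mul_sub (integrable_gradKernel hh k) x),
    hf.integral_heatKernel_mul_pderiv hh, sub_self]

lemma abs_commutatorKernel_half_le (hf : C11Bound M f) (hh : 0 < h) (k : Fin 3) (x z : Space) :
    |commutatorKernel (h / 2) k f x z| ≤ 6 * M * (weight h z * heatKernel h z) := by
  have hM := hf.nonneg
  have hG := heatKernel_pos hh z
  have hheat : |heatKernel (h / 2) z * pderiv k f (x - z)| ≤
      3 * M * (weight h z * heatKernel h z) := by
    rw [abs_mul, abs_of_pos (heatKernel_pos (half_pos hh) z)]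
    calc heatKernel (h / 2) z * |pderiv k f (x - z)| ≤ (3 * heatKernel h z) * M := by
          gcongr
          · exact heatKernel_half_le hh z
          · exact hf.norm_pderiv_le k _
      _ = 3 * M * (1 * heatKernel h z) := by ring
      _ ≤ 3 * M * (weight h z * heatKernel h z) := by
          gcongr
          exact one_le_weight hh z
  have hgrad := abs_gradKernel_half_mul_sub_le hh hM hf.norm_sub_le k x z
  refine (abs_sub _ _).trans ?_
  linarith

variable [InnerProductSpace ℝ V] [CompleteSpace V]

lemma UnitMap.norm_integral_commutatorKernel_smul_le (hu : UnitMap u) (hf : C11Bound M f)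
    (hh : 0 < h) (k : Fin 3) (x : Space) :
    ‖∫ z, commutatorKernel (h / 2) k f x z • u (x - z)‖ ≤
      6 * M * momentConst * √(defect h u x) := by
  have hM := hf.nonneg
  have hκ := integrable_commutatorKernel hf (half_pos hh) k x
  have hint : Integrable fun z => commutatorKernel (h / 2) k f x z • u (x - z) :=
    hu.boundedPeriodic.convolutionExists hκ x
  have hcancel : ∫ z, commutatorKernel (h / 2) k f x z • u (x - z) =
      ∫ z, commutatorKernel (h / 2) k f x z • (u (x - z) - u x) := by
    simp_rw [smul_sub]
    rw [integral_sub hint (hκ.smul_const _), integral_smul_const,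
      integral_commutatorKernel hf (half_pos hh), zero_smul, sub_zero]
  rw [hcancel]
  refine hu.norm_integral_le_sqrt_defect hh x (by positivity) fun z => ?_
  rw [norm_smul, ← mul_assoc]
  gcongr
  exact abs_commutatorKernel_half_le hf hh k x z

lemma UnitMap.abs_doubleIntegral_commutatorKernel_le (hu : UnitMap u) (hφ : BoundedPeriodic φ)
    (hf : C11Bound M f) (hh : 0 < h) (k : Fin 3) :
    |doubleIntegral fun x z => commutatorKernel (h / 2) k f x z * inner ℝ (φ x) (u (x - z))| ≤
      6 * M * momentConst * ∫ x in cell, ‖φ x‖ * √(defect h u x) := by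
  have hbound : Integrable (fun x => ‖φ x‖ * √(defect h u x)) (volume.restrict cell) := by
    obtain ⟨N, hN⟩ := hφ.norm.exists_bound
    exact (hu.integrable_sqrt_defect hh).bdd_mul (c := N) hφ.norm.aestronglyMeasurable.restrict
      (Eventually.of_forall hN)
  rw [← integral_const_mul]
  refine abs_doubleIntegral_le (hbound.const_mul _) fun x => ?_
  have hint : Integrable fun z => commutatorKernel (h / 2) k f x z • u (x - z) :=
    hu.boundedPeriodic.convolutionExists (integrable_commutatorKernel hf (half_pos hh) k x) x
  simp_rw [← real_inner_smul_right]
  rw [integral_inner hint]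
  calc |inner ℝ (φ x) (∫ z, commutatorKernel (h / 2) k f x z • u (x - z))|
      ≤ ‖φ x‖ * (6 * M * momentConst * √(defect h u x)) := by
        refine (abs_real_inner_le_norm _ _).trans ?_
        gcongr
        exact hu.norm_integral_commutatorKernel_smul_le hf hh k x
    _ = 6 * M * momentConst * (‖φ x‖ * √(defect h u x)) := by ring

end CommutatorKernel

section Transport

variable {V : Type*} [NormedAddCommGroup V] [InnerProductSpace ℝ V] {u b c : Space → V}
  {f : Space → ℝ} {h M : ℝ}

/-- The weak form of `-∫ (f ∂_k u) · G_h ∗ b dx`. -/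
def transport (h : ℝ) (u : Space → V) (k : Fin 3) (f : Space → ℝ) (b : Space → V) : ℝ :=
  (∫ x in cell, pderiv k f x * inner ℝ (u x) (heatConv h b x)) +
    ∫ x in cell, f x * inner ℝ (u x) (pderiv k (heatConv h b) x)

lemma isDominatedIntegrand_mul_inner (hu : BoundedPeriodic u) (hb : BoundedPeriodic b)
    (hf : BoundedPeriodic f) {K : Space → ℝ} (hK : Integrable K) :
    IsDominatedIntegrand fun x z => K z * (f x * inner ℝ (u x) (b (x - z))) :=
  (hf.pair_fst.mul (hu.pair_fst.inner hb.pair_sub)).kernel_mul hK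

variable [CompleteSpace V]

lemma transport_eq_doubleIntegral (hb : BoundedPeriodic b) (hh : 0 < h) (k : Fin 3) :
    transport h u k f b =
      (doubleIntegral fun x z => heatKernel h z * (pderiv k f x * inner ℝ (u x) (b (x - z)))) +
        doubleIntegral fun x z => gradKernel h k z * (f x * inner ℝ (u x) (b (x - z))) := by
  unfold transport
  simp_rw [hb.pderiv_heatConv hh, heatConv_eq_convolution]
  rw [integral_mul_inner_convolution (integrable_heatKernel hh) _ _ hb,
    integral_mul_inner_convolution (integrable_gradKernel hh k) _ _ hb]

lemma transport_sub (hu : BoundedPeriodic u) (hb : BoundedPeriodic b) (hc : BoundedPeriodic c)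
    (hh : 0 < h) (hf : C11Bound M f) (k : Fin 3) :
    transport h u k f (fun x => b x - c x) = transport h u k f b - transport h u k f c := by
  have hheat {b : Space → V} (hb : BoundedPeriodic b) :=
    isDominatedIntegrand_mul_inner hu hb (hf.boundedPeriodic_pderiv k) (integrable_heatKernel hh)
  have hgrad {b : Space → V} (hb : BoundedPeriodic b) :=
    isDominatedIntegrand_mul_inner hu hb hf.boundedPeriodic (integrable_gradKernel hh k)
  rw [transport_eq_doubleIntegral (hb.sub hc) hh, transport_eq_doubleIntegral hb hh,
    transport_eq_doubleIntegral hc hh]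
  simp_rw [inner_sub_right, mul_sub]
  rw [(hheat hb).doubleIntegral_sub (hheat hc), (hgrad hb).doubleIntegral_sub (hgrad hc)]
  ring

lemma transport_eq_transport_half (hb : BoundedPeriodic b) (hh : 0 < h) (k : Fin 3) :
    transport h u k f b = transport (h / 2) u k f (heatConv (h / 2) b) := by
  have hsemigroup : heatConv (h / 2) (heatConv (h / 2) b) = heatConv h b :=
    funext fun x => heatConv_half_heatConv_half hb hh x
  rw [transport, transport, hsemigroup]

lemma transport_add_eq_doubleIntegral_commutatorKernel (hu : BoundedPeriodic u)
    (hb : BoundedPeriodic b) (hh : 0 < h) (hf : C11Bound M f) (k : Fin 3) :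
    transport h u k f b +
      ∫ x in cell, f x * inner ℝ (heatConv (h / 2) b x) (pderiv k (heatConv (h / 2) u) x) =
      doubleIntegral fun x z =>
        commutatorKernel (h / 2) k f x z * inner ℝ (heatConv (h / 2) b x) (u (x - z)) := by
  have hh₂ := half_pos hh
  have hφ := hb.heatConv hh₂
  have hf' := hf.boundedPeriodic
  have hgradK := integrable_gradKernel hh₂ k
  have hheat := isDominatedIntegrand_mul_inner hu hφ (hf.boundedPeriodic_pderiv k)
    (integrable_heatKernel hh₂)
  have hgrad := isDominatedIntegrand_mul_inner hu hφ hf' hgradK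
  rw [transport_eq_transport_half hb hh, transport_eq_doubleIntegral hφ hh₂]
  simp_rw [hu.pderiv_heatConv hh₂]
  rw [integral_mul_inner_convolution hgradK _ _ hu, ← hheat.doubleIntegral_comp_sub_neg,
    ← hgrad.doubleIntegral_comp_sub_neg,
    ← hheat.comp_sub_neg.doubleIntegral_add hgrad.comp_sub_neg,
    ← (hheat.comp_sub_neg.add hgrad.comp_sub_neg).doubleIntegral_add
      (isDominatedIntegrand_mul_inner hφ hu hf' hgradK)]
  congr 1 with x z
  simp only [commutatorKernel, heatKernel_neg, gradKernel_neg, sub_neg_eq_add, sub_add_cancel,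
    real_inner_comm (u (x - z))]
  ring

end Transport

section SelfTransport

variable {V : Type*} [NormedAddCommGroup V] [InnerProductSpace ℝ V] {u : Space → V}
  {a f : Space → ℝ} {h M : ℝ}

lemma UnitMap.boundedPeriodicPair_norm_sub_sq (hu : UnitMap u) :
    BoundedPeriodicPair fun x z => ‖u (x - z) - u x‖ ^ 2 := by
  have hdiff := hu.boundedPeriodic.pair_sub.sub hu.boundedPeriodic.pair_fst
  simpa only [real_inner_self_eq_norm_sq] using hdiff.inner hdiff

lemma UnitMap.isDominatedIntegrand_mul_norm_sub_sq (hu : UnitMap u) (ha : BoundedPeriodic a)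
    {K : Space → ℝ} (hK : Integrable K) :
    IsDominatedIntegrand fun x z => K z * (a x * ‖u (x - z) - u x‖ ^ 2) :=
  (ha.pair_fst.mul hu.boundedPeriodicPair_norm_sub_sq).kernel_mul hK

lemma UnitMap.doubleIntegral_gradKernel_mul_inner (hu : UnitMap u) (ha : BoundedPeriodic a)
    (hh : 0 < h) (k : Fin 3) :
    doubleIntegral (fun x z => gradKernel h k z * (a x * inner ℝ (u x) (u (x - z)))) =
      -(1 / 2) * doubleIntegral fun x z => gradKernel h k z * (a x * ‖u (x - z) - u x‖ ^ 2) := by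
  have hK := integrable_gradKernel hh k
  have hsq := hu.isDominatedIntegrand_mul_norm_sub_sq ha hK
  have hone : IsDominatedIntegrand fun x z => gradKernel h k z * (a x * 1) :=
    (ha.pair_fst.mul (BoundedPeriodic.const 1).pair_fst).kernel_mul hK
  have hone_zero : doubleIntegral (fun x z => gradKernel h k z * (a x * 1)) = 0 := by
    simp [doubleIntegral, integral_mul_const, integral_gradKernel]
  have hadd := (hsq.const_mul (-(1 / 2))).doubleIntegral_add hone
  rw [hone_zero, add_zero, doubleIntegral_const_mul] at hadd
  rw [← hadd]
  congr 1 with x z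
  rw [hu.norm_sub_sq]
  ring

/-- `∂_k G_h` is odd, so exchanging `x` and `x - z` antisymmetrises the coefficient `f`. -/
lemma UnitMap.doubleIntegral_gradKernel_mul_norm_sub_sq (hu : UnitMap u) (hf : BoundedPeriodic f)
    (hh : 0 < h) (k : Fin 3) :
    doubleIntegral (fun x z => gradKernel h k z * (f x * ‖u (x - z) - u x‖ ^ 2)) =
      1 / 2 * doubleIntegral
        fun x z => gradKernel h k z * ((f x - f (x - z)) * ‖u (x - z) - u x‖ ^ 2) := by
  have hsq := hu.isDominatedIntegrand_mul_norm_sub_sq hf (integrable_gradKernel hh k)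
  rw [eq_comm, one_div, inv_mul_eq_iff_eq_mul₀ two_ne_zero, two_mul]
  nth_rewrite 2 [← hsq.doubleIntegral_comp_sub_neg]
  rw [← hsq.doubleIntegral_add hsq.comp_sub_neg]
  congr 1 with x z
  simp only [gradKernel_neg, sub_neg_eq_add, sub_add_cancel, norm_sub_rev (u x)]
  ring

lemma UnitMap.integral_pderiv_mul_inner_heatConv (hu : UnitMap u) (hf : C11Bound M f) (hh : 0 < h)
    (k : Fin 3) : ∫ x in cell, pderiv k f x * inner ℝ (u x) (heatConv h u x) =
      -(1 / 2) * ∫ x in cell, pderiv k f x * defect h u x := by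
  have hpderiv := hf.boundedPeriodic_pderiv k
  have hint := (hpderiv.mul (hu.boundedPeriodic_defect hh)).integrable_cell
  rw [← integral_const_mul, ← add_zero (∫ x in cell, -(1 / 2) * _), ← hf.integral_pderiv k,
    ← integral_add (hint.const_mul _) hpderiv.integrable_cell]
  congr 1 with x
  unfold defect
  ring

/-- The density of the error terms: the free parameter `l` trades the defect against the Gaussian
tail. -/
def errorDensity (l h : ℝ) (u : Space → V) (x : Space) : ℝ :=
  l * defect h u x + 4 * momentConst / l ^ 3

lemma UnitMap.integrable_errorDensity (hu : UnitMap u) (hh : 0 < h) (l : ℝ) :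
    Integrable (errorDensity l h u) (volume.restrict cell) :=
  ((hu.integrable_defect hh).const_mul l).add (integrable_const _)

variable [CompleteSpace V]

lemma UnitMap.doubleIntegral_heatKernel_mul_norm_sub_sq (hu : UnitMap u) (hh : 0 < h)
    (a : Space → ℝ) :
    doubleIntegral (fun x z => heatKernel h z * (a x * ‖u (x - z) - u x‖ ^ 2)) =
      ∫ x in cell, a x * defect h u x := by
  unfold doubleIntegral
  congr 1 with x
  rw [← hu.integral_heatKernel_mul_norm_sub_sq hh, ← integral_const_mul]
  congr 1 with z
  ring

lemma UnitMap.transport_self (hu : UnitMap u) (hf : C11Bound M f) (hh : 0 < h) (k : Fin 3) :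
    transport h u k f u = -(1 / 2) * (∫ x in cell, pderiv k f x * defect h u x) -
      1 / 4 * doubleIntegral
        fun x z => gradKernel h k z * ((f x - f (x - z)) * ‖u (x - z) - u x‖ ^ 2) := by
  have hu' := hu.boundedPeriodic
  unfold transport
  simp_rw [hu'.pderiv_heatConv hh]
  rw [integral_mul_inner_convolution (integrable_gradKernel hh k) _ _ hu',
    hu.integral_pderiv_mul_inner_heatConv hf hh,
    hu.doubleIntegral_gradKernel_mul_inner hf.boundedPeriodic hh,
    hu.doubleIntegral_gradKernel_mul_norm_sub_sq hf.boundedPeriodic hh]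
  ring

lemma sum_hessKernel_mul_pderiv_add (hh : 0 < h) (f : Space → ℝ) (k : Fin 3) (x z : Space) :
    2 * h * (∑ i, hessKernel h i k z * pderiv i f x) + heatKernel h z * pderiv k f x =
      -(gradKernel h k z * fderiv ℝ f x z) := by
  have hdiag : heatKernel h z * pderiv k f x =
      ∑ i, if i = k then heatKernel h z * pderiv i f x else 0 := by simp
  rw [hdiag, fderiv_apply_eq_sum_pderiv, Finset.mul_sum, Finset.mul_sum, ← Finset.sum_add_distrib,
    ← Finset.sum_neg_distrib]
  refine Finset.sum_congr rfl fun i _ => ?_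
  simp only [hessKernel, gradKernel, smul_eq_mul]
  split_ifs <;> field_simp <;> ring

lemma UnitMap.transport_self_sub_eq_taylorRemainder (hu : UnitMap u) (hf : C11Bound M f)
    (hh : 0 < h) (k : Fin 3) :
    transport h u k f u - (-(1 / 4) * (∫ x in cell, pderiv k f x * defect h u x) +
      h / 2 * ∑ i, doubleIntegral
        fun x z => hessKernel h i k z * (pderiv i f x * ‖u (x - z) - u x‖ ^ 2)) =
      -(1 / 4) * doubleIntegral fun x z => gradKernel h k z *
        ((f x - f (x - z) - fderiv ℝ f x z) * ‖u (x - z) - u x‖ ^ 2) := by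
  have hpair := hu.boundedPeriodicPair_norm_sub_sq
  have hhess : ∀ i ∈ Finset.univ, IsDominatedIntegrand fun x z =>
      hessKernel h i k z * (pderiv i f x * ‖u (x - z) - u x‖ ^ 2) := fun i _ =>
    hu.isDominatedIntegrand_mul_norm_sub_sq (hf.boundedPeriodic_pderiv i)
      (integrable_hessKernel hh i k)
  have hheat := hu.isDominatedIntegrand_mul_norm_sub_sq (hf.boundedPeriodic_pderiv k)
    (integrable_heatKernel hh)
  have hgrad : IsDominatedIntegrand fun x z =>
      gradKernel h k z * ((f x - f (x - z)) * ‖u (x - z) - u x‖ ^ 2) :=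
    ((hf.boundedPeriodic.pair_fst.sub hf.boundedPeriodic.pair_sub).mul hpair).kernel_mul
      (integrable_gradKernel hh k)
  have hremainder : doubleIntegral (fun x z => gradKernel h k z *
        ((f x - f (x - z) - fderiv ℝ f x z) * ‖u (x - z) - u x‖ ^ 2)) =
      doubleIntegral fun x z => gradKernel h k z * ((f x - f (x - z)) * ‖u (x - z) - u x‖ ^ 2) +
        (2 * h * ∑ i, hessKernel h i k z * (pderiv i f x * ‖u (x - z) - u x‖ ^ 2) +
          heatKernel h z * (pderiv k f x * ‖u (x - z) - u x‖ ^ 2)) := by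
    congr 1 with x z
    simp only [← mul_assoc, ← Finset.sum_mul]
    linear_combination -‖u (x - z) - u x‖ ^ 2 * sum_hessKernel_mul_pderiv_add hh f k x z
  have hhess_sum := (IsDominatedIntegrand.sum hhess).const_mul (2 * h)
  rw [hremainder, hgrad.doubleIntegral_add (hhess_sum.add hheat),
    hhess_sum.doubleIntegral_add hheat, doubleIntegral_const_mul,
    IsDominatedIntegrand.doubleIntegral_sum hhess, hu.doubleIntegral_heatKernel_mul_norm_sub_sq hh,
    hu.transport_self hf hh]
  ring

lemma UnitMap.abs_transport_self_sub_le (hu : UnitMap u) (hh : 0 < h) (hf : C11Bound M f)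
    (k : Fin 3) {l : ℝ} (hl : 0 < l) :
    |transport h u k f u - (-(1 / 4) * (∫ x in cell, pderiv k f x * defect h u x) +
      h / 2 * ∑ i, doubleIntegral
        fun x z => hessKernel h i k z * (pderiv i f x * ‖u (x - z) - u x‖ ^ 2))| ≤
      1 / 4 * (M * √h) * ∫ x in cell, errorDensity l h u x := by
  have hM := hf.nonneg
  rw [hu.transport_self_sub_eq_taylorRemainder hf hh, abs_mul, abs_neg,
    abs_of_pos (show (0 : ℝ) < 1 / 4 by norm_num), mul_assoc]
  gcongr
  rw [← integral_const_mul]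
  refine abs_doubleIntegral_le ((hu.integrable_errorDensity hh l).const_mul _) fun x => ?_
  rw [← Real.norm_eq_abs]
  refine hu.norm_integral_le_defect hh x (by positivity) hl fun z => ?_
  have hG := heatKernel_pos hh z
  have hw := one_le_weight hh z
  rw [norm_mul, norm_mul, norm_pow, norm_norm]
  calc ‖gradKernel h k z‖ * (‖f x - f (x - z) - fderiv ℝ f x z‖ * ‖u (x - z) - u x‖ ^ 2)
      ≤ (1 / √h * (weight h z * heatKernel h z)) *
          ((M * (h * weight h z)) * ‖u (x - z) - u x‖ ^ 2) := by
        gcongr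
        · exact abs_gradKernel_le hh k z
        · exact hf.norm_sub_sub_fderiv_le_weight hh x z
    _ = h / √h * M * (weight h z ^ 2 * heatKernel h z * ‖u (x - z) - u x‖ ^ 2) := by ring
    _ = M * √h * (weight h z ^ 2 * heatKernel h z * ‖u (x - z) - u x‖ ^ 2) := by
        rw [Real.div_sqrt, mul_comm (√h)]

end SelfTransport

section HessianForm

variable {V : Type*} [NormedAddCommGroup V] [InnerProductSpace ℝ V] {u : Space → V}
  {f : Space → ℝ} {h l M : ℝ}

lemma UnitMap.doubleIntegral_hessKernel_mul_norm_sub_sq (hu : UnitMap u) (hf : BoundedPeriodic f)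
    (hh : 0 < h) (i j : Fin 3) :
    doubleIntegral (fun x z => hessKernel h i j z * (f x * ‖u (x - z) - u x‖ ^ 2)) =
      -2 * doubleIntegral fun x z => hessKernel h i j z * (f x * inner ℝ (u x) (u (x - z))) := by
  have hK := integrable_hessKernel hh i j
  have hinner := isDominatedIntegrand_mul_inner hu.boundedPeriodic hu.boundedPeriodic hf hK
  have hone : IsDominatedIntegrand fun x z => hessKernel h i j z * (f x * 1) :=
    (hf.pair_fst.mul (BoundedPeriodic.const 1).pair_fst).kernel_mul hK
  have hone_zero : doubleIntegral (fun x z => hessKernel h i j z * (f x * 1)) = 0 := by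
    simp [doubleIntegral, integral_mul_const, integral_hessKernel hh]
  have hadd := (hone.const_mul 2).doubleIntegral_add (hinner.const_mul (-2))
  rw [doubleIntegral_const_mul, doubleIntegral_const_mul, hone_zero, mul_zero, zero_add] at hadd
  rw [← hadd]
  congr 1 with x z
  rw [hu.norm_sub_sq]
  ring

lemma UnitMap.defect_le_errorDensity [CompleteSpace V] (hu : UnitMap u) (hh : 0 < h) (hl : 1 ≤ l)
    (x : Space) : defect h u x ≤ errorDensity l h u x := by
  have hA := momentConst_pos
  have htail : 0 ≤ 4 * momentConst / l ^ 3 := by positivity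
  have hscale : 1 * defect h u x ≤ l * defect h u x :=
    mul_le_mul_of_nonneg_right hl (hu.defect_nonneg hh x)
  unfold errorDensity
  linarith

variable [CompleteSpace V]

lemma UnitMap.gradKernel_convolution_eq (hu : UnitMap u) (hh : 0 < h) (k : Fin 3) (x : Space) :
    (gradKernel h k ⋆ u) x = ∫ z, gradKernel h k z • (u (x - z) - u x) := by
  have hK := integrable_gradKernel hh k
  have hint : Integrable fun z => gradKernel h k z • u (x - z) :=
    hu.boundedPeriodic.convolutionExists hK x
  simp_rw [smul_sub]
  rw [integral_sub hint (hK.smul_const _), integral_smul_const, integral_gradKernel, zero_smul,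
    sub_zero, convolution_lsmul]

lemma UnitMap.norm_gradKernel_half_convolution_le (hu : UnitMap u) (hh : 0 < h) (k : Fin 3)
    (x : Space) : ‖(gradKernel (h / 2) k ⋆ u) x‖ ≤ 3 / √h * momentConst * √(defect h u x) := by
  rw [hu.gradKernel_convolution_eq (half_pos hh)]
  refine hu.norm_integral_le_sqrt_defect hh x (by positivity) fun z => ?_
  rw [norm_smul, ← mul_assoc]
  gcongr
  exact abs_gradKernel_half_le_weight hh k z

/-- As `‖u‖` is constant, the normal component of the gradient of `G_h ∗ u` is quadratic in the
increments of `u`. -/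
lemma UnitMap.inner_gradKernel_convolution_self (hu : UnitMap u) (hh : 0 < h) (k : Fin 3)
    (x : Space) : inner ℝ ((gradKernel h k ⋆ u) x) (u x) =
      ∫ z, -(1 / 2) * (gradKernel h k z * ‖u (x - z) - u x‖ ^ 2) := by
  have hK := integrable_gradKernel hh k
  have hint : Integrable fun z => gradKernel h k z • u (x - z) :=
    hu.boundedPeriodic.convolutionExists hK x
  have hpointwise (z : Space) : -(1 / 2) * (gradKernel h k z * ‖u (x - z) - u x‖ ^ 2) =
      inner ℝ (u x) (gradKernel h k z • u (x - z)) - gradKernel h k z := by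
    rw [hu.norm_sub_sq, inner_smul_right]
    ring
  simp_rw [hpointwise]
  rw [integral_sub (hint.const_inner _) hK, integral_gradKernel, sub_zero, integral_inner hint,
    real_inner_comm, convolution_lsmul]

lemma UnitMap.abs_inner_gradKernel_half_convolution_self_le (hu : UnitMap u) (hh : 0 < h)
    (k : Fin 3) (x : Space) (hl : 0 < l) :
    |inner ℝ ((gradKernel (h / 2) k ⋆ u) x) (u x)| ≤ 3 / 2 / √h * errorDensity l h u x := by
  rw [hu.inner_gradKernel_convolution_self (half_pos hh), ← Real.norm_eq_abs]
  refine hu.norm_integral_le_defect hh x (by positivity) hl fun z => ?_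
  have hG := heatKernel_pos hh z
  have hw := one_le_weight hh z
  rw [norm_mul, norm_mul, norm_pow, norm_norm, norm_neg, Real.norm_of_nonneg one_half_pos.le]
  calc 1 / 2 * (‖gradKernel (h / 2) k z‖ * ‖u (x - z) - u x‖ ^ 2)
      ≤ 1 / 2 * ((3 / √h * (weight h z * heatKernel h z)) * ‖u (x - z) - u x‖ ^ 2) := by
        gcongr
        exact abs_gradKernel_half_le_weight hh k z
    _ ≤ 1 / 2 * ((3 / √h * (weight h z ^ 2 * heatKernel h z)) * ‖u (x - z) - u x‖ ^ 2) := by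
        gcongr
        exact le_self_pow₀ hw two_ne_zero
    _ = 3 / 2 / √h * (weight h z ^ 2 * heatKernel h z * ‖u (x - z) - u x‖ ^ 2) := by ring

/-- By the semigroup property `∂_i ∂_j G_h ∗ u` is `∂_i G_{h/2} ∗ ∂_j G_{h/2} ∗ u`; integrating by
parts, the derivative `∂_i` only sees the increments of `f`. -/
lemma UnitMap.doubleIntegral_hessKernel_sub_eq (hu : UnitMap u) (hf : BoundedPeriodic f)
    (hh : 0 < h) (i j : Fin 3) :
    (doubleIntegral fun x z => hessKernel h i j z * (f x * ‖u (x - z) - u x‖ ^ 2)) -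
      2 * (∫ x in cell, f x *
        inner ℝ ((gradKernel (h / 2) i ⋆ u) x) ((gradKernel (h / 2) j ⋆ u) x)) =
      2 * doubleIntegral fun x z => gradKernel (h / 2) i z * (f (x - z) - f x) *
        inner ℝ ((gradKernel (h / 2) j ⋆ u) x) (u (x - z)) := by
  have hu' := hu.boundedPeriodic
  have hK := integrable_gradKernel (half_pos hh)
  have hp : BoundedPeriodic (gradKernel (h / 2) j ⋆ u) := hu'.convolution (hK j)
  have hleft := isDominatedIntegrand_mul_inner hu' hp hf (hK i)
  have hright := isDominatedIntegrand_mul_inner hp hu' hf (hK i)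
  have hsemigroup : doubleIntegral (fun x z => hessKernel h i j z *
        (f x * inner ℝ (u x) (u (x - z)))) = doubleIntegral fun x z =>
      gradKernel (h / 2) i z * (f x * inner ℝ (u x) ((gradKernel (h / 2) j ⋆ u) (x - z))) := by
    rw [← integral_mul_inner_convolution (integrable_hessKernel hh i j) f u hu',
      ← integral_mul_inner_convolution (hK i) f u hp]
    simp_rw [gradKernel_half_convolution_gradKernel_half hu' hh]
  simp_rw [real_inner_comm ((gradKernel (h / 2) j ⋆ u) _) ((gradKernel (h / 2) i ⋆ u) _)]
  rw [hu.doubleIntegral_hessKernel_mul_norm_sub_sq hf hh, hsemigroup,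
    integral_mul_inner_convolution (hK i) f _ hu', ← hleft.doubleIntegral_comp_sub_neg]
  have hsub := (hleft.comp_sub_neg.const_mul (-1)).doubleIntegral_sub hright
  rw [doubleIntegral_const_mul] at hsub
  rw [neg_mul, ← mul_neg, ← mul_sub, ← neg_one_mul (doubleIntegral _), ← hsub]
  congr 2 with x z
  simp only [gradKernel_neg, sub_neg_eq_add, sub_add_cancel, real_inner_comm (u (x - z))]
  ring

lemma abs_integral_gradKernel_half_mul_sub_le (hh : 0 < h) (hM : 0 ≤ M)
    (hlip : ∀ x y, |f x - f y| ≤ M * ‖x - y‖) (k : Fin 3) (x : Space) :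
    |∫ z, gradKernel (h / 2) k z * (f (x - z) - f x)| ≤ 3 * M * momentConst := by
  have hint : Integrable fun z => 3 * M * (weight h z ^ 1 * heatKernel h z) :=
    (integrable_weight_pow_mul_heatKernel hh 1).const_mul _
  calc |∫ z, gradKernel (h / 2) k z * (f (x - z) - f x)|
      ≤ ∫ z, 3 * M * (weight h z ^ 1 * heatKernel h z) := by
        rw [← Real.norm_eq_abs]
        refine norm_integral_le_of_norm_le hint (Eventually.of_forall fun z => ?_)
        rw [pow_one]
        exact abs_gradKernel_half_mul_sub_le hh hM hlip k x z
    _ ≤ 3 * M * momentConst := by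
        rw [integral_const_mul]
        gcongr
        exact integral_weight_pow_mul_heatKernel_le_momentConst hh (by norm_num)

lemma UnitMap.norm_integral_gradKernel_half_mul_sub_smul_le (hu : UnitMap u) (hh : 0 < h)
    (hM : 0 ≤ M) (hlip : ∀ x y, |f x - f y| ≤ M * ‖x - y‖) (k : Fin 3) (x : Space) :
    ‖∫ z, (gradKernel (h / 2) k z * (f (x - z) - f x)) • (u (x - z) - u x)‖ ≤
      3 * M * momentConst * √(defect h u x) := by
  refine hu.norm_integral_le_sqrt_defect hh x (by positivity) fun z => ?_
  rw [norm_smul, ← mul_assoc]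
  gcongr
  exact abs_gradKernel_half_mul_sub_le hh hM hlip k x z

lemma integral_mul_inner_eq_add (hu : BoundedPeriodic u) {κ : Space → ℝ}
    (hκ : Integrable κ) (p : V) (x : Space) : ∫ z, κ z * inner ℝ p (u (x - z)) =
      inner ℝ p (∫ z, κ z • (u (x - z) - u x)) + inner ℝ p (u x) * ∫ z, κ z := by
  have hint : Integrable fun z => κ z • u (x - z) := hu.convolutionExists hκ x
  simp_rw [smul_sub, ← real_inner_smul_right]
  rw [integral_sub hint (hκ.smul_const _), integral_smul_const, inner_sub_right,
    inner_smul_right, integral_inner hint]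
  ring

lemma UnitMap.abs_integral_gradKernel_half_mul_inner_le (hu : UnitMap u)
    (hf : BoundedPeriodic f) (hh : 0 < h) (hM : 0 ≤ M)
    (hlip : ∀ x y, |f x - f y| ≤ M * ‖x - y‖) (i j : Fin 3) (hl : 1 ≤ l) (x : Space) :
    |∫ z, gradKernel (h / 2) i z * (f (x - z) - f x) *
      inner ℝ ((gradKernel (h / 2) j ⋆ u) x) (u (x - z))| ≤
      14 * M * momentConst ^ 2 / √h * errorDensity l h u x := by
  set p := (gradKernel (h / 2) j ⋆ u) x
  have hA := one_le_momentConst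
  have hq := hu.defect_nonneg hh x
  have hqe := hu.defect_le_errorDensity hh hl x
  have hκ := hf.integrable_mul_sub (integrable_gradKernel (half_pos hh) i) x
  have hincrement : |inner ℝ p (∫ z,
      (gradKernel (h / 2) i z * (f (x - z) - f x)) • (u (x - z) - u x))| ≤
      9 * M * momentConst ^ 2 / √h * errorDensity l h u x := by
    calc _ ≤ (3 / √h * momentConst * √(defect h u x)) * (3 * M * momentConst * √(defect h u x)) :=
          (abs_real_inner_le_norm _ _).trans (by
            gcongr
            · exact hu.norm_gradKernel_half_convolution_le hh j x
            · exact hu.norm_integral_gradKernel_half_mul_sub_smul_le hh hM hlip i x)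
      _ = 9 * M * momentConst ^ 2 / √h * (√(defect h u x) * √(defect h u x)) := by ring
      _ ≤ 9 * M * momentConst ^ 2 / √h * errorDensity l h u x := by
          rw [Real.mul_self_sqrt hq]
          gcongr
  have hnormal : |inner ℝ p (u x) * ∫ z, gradKernel (h / 2) i z * (f (x - z) - f x)| ≤
      5 * M * momentConst ^ 2 / √h * errorDensity l h u x := by
    have hE : 0 ≤ errorDensity l h u x := hq.trans hqe
    calc _ ≤ (3 / 2 / √h * errorDensity l h u x) * (3 * M * momentConst) := by
          rw [abs_mul]
          gcongr
          · exact hu.abs_inner_gradKernel_half_convolution_self_le hh j x (by linarith)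
          · exact abs_integral_gradKernel_half_mul_sub_le hh hM hlip i x
      _ = 9 / 2 * M * momentConst / √h * errorDensity l h u x := by ring
      _ ≤ 5 * M * momentConst ^ 2 / √h * errorDensity l h u x := by
          gcongr
          · norm_num
          · exact le_self_pow₀ hA two_ne_zero
  rw [integral_mul_inner_eq_add hu.boundedPeriodic hκ]
  refine (abs_add_le _ _).trans ((add_le_add hincrement hnormal).trans_eq ?_)
  ring

lemma UnitMap.abs_doubleIntegral_hessKernel_sub_le (hu : UnitMap u) (hf : BoundedPeriodic f)
    (hh : 0 < h) (hM : 0 ≤ M) (hlip : ∀ x y, |f x - f y| ≤ M * ‖x - y‖) (i j : Fin 3)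
    (hl : 1 ≤ l) :
    |(doubleIntegral fun x z => hessKernel h i j z * (f x * ‖u (x - z) - u x‖ ^ 2)) -
      2 * ∫ x in cell, f x *
        inner ℝ (pderiv i (heatConv (h / 2) u) x) (pderiv j (heatConv (h / 2) u) x)| ≤
      28 * M * momentConst ^ 2 / √h * ∫ x in cell, errorDensity l h u x := by
  simp_rw [hu.boundedPeriodic.pderiv_heatConv (half_pos hh)]
  rw [hu.doubleIntegral_hessKernel_sub_eq hf hh, abs_mul, abs_two,
    show 28 * M * momentConst ^ 2 / √h = 2 * (14 * M * momentConst ^ 2 / √h) by ring,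
    mul_assoc, ← integral_const_mul]
  gcongr
  exact abs_doubleIntegral_le ((hu.integrable_errorDensity hh l).const_mul _)
    (hu.abs_integral_gradKernel_half_mul_inner_le hf hh hM hlip i j hl)

end HessianForm

section Coordinates

variable {E F : Type*} [NormedAddCommGroup E] [NormedSpace ℝ E] [NormedAddCommGroup F]
  [NormedSpace ℝ F] {M : ℝ}

lemma C11Bound.clm_comp {f : Space → E} (hf : C11Bound M f) {L : E →L[ℝ] F} (hL : ‖L‖ ≤ 1) :
    C11Bound M fun x => L (f x) := by
  have hfderiv (x : Space) : HasFDerivAt (fun x => L (f x)) (L.comp (fderiv ℝ f x)) x :=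
    L.hasFDerivAt.comp x (hf.differentiable x).hasFDerivAt
  have hcomp (A : Space →L[ℝ] E) : ‖L.comp A‖ ≤ ‖A‖ :=
    (L.opNorm_comp_le A).trans (mul_le_of_le_one_left (norm_nonneg A) hL)
  exact
  { periodic := hf.periodic.comp L
    differentiable := fun x => (hfderiv x).differentiableAt
    norm_le := fun x =>
      (L.le_opNorm _).trans ((mul_le_of_le_one_left (norm_nonneg _) hL).trans (hf.norm_le x))
    norm_fderiv_le := fun x => by
      rw [(hfderiv x).fderiv]
      exact (hcomp _).trans (hf.norm_fderiv_le x)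
    norm_fderiv_sub_le := fun x y => by
      rw [(hfderiv x).fderiv, (hfderiv y).fderiv, ← ContinuousLinearMap.comp_sub]
      exact (hcomp _).trans (hf.norm_fderiv_sub_le x y) }

lemma C11Bound.coord {n : ℕ} {ξ : Space → EuclideanSpace ℝ (Fin n)} (hξ : C11Bound M ξ)
    (k : Fin n) : C11Bound M fun x => ξ x k :=
  hξ.clm_comp (L := EuclideanSpace.proj k) <|
    ContinuousLinearMap.opNorm_le_bound _ zero_le_one fun v => by
      rw [one_mul]
      exact PiLp.norm_apply_le v k

lemma pderiv_coord {n : ℕ} {ξ : Space → EuclideanSpace ℝ (Fin n)} (hξ : Differentiable ℝ ξ)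
    (i : Fin 3) (k : Fin n) (x : Space) : pderiv i (fun y => ξ y k) x = pderiv i ξ x k := by
  have hcoord : HasFDerivAt (fun y => ξ y k) _ x :=
    (EuclideanSpace.proj k : _ →L[ℝ] ℝ).hasFDerivAt.comp x (hξ x).hasFDerivAt
  unfold pderiv
  rw [hcoord.fderiv]
  rfl

end Coordinates

section InnerVariation

variable {V : Type*} [NormedAddCommGroup V] [InnerProductSpace ℝ V] {u v : Space → V}
  {f : Space → ℝ} {ξ : Space → Space} {h l M : ℝ}

/-- The time slice of `∬ G_{h/2} ∗ ∂_t^h u · (ξ · ∇) G_{h/2} ∗ u dx dt` at which `u` jumps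
from `v`. -/
def innerTransport (h : ℝ) (u v : Space → V) (ξ : Space → Space) : ℝ :=
  ∫ x in cell, inner ℝ (heatConv (h / 2) (fun y => h⁻¹ • (u y - v y)) x)
    (∑ k : Fin 3, ξ x k • pderiv k (heatConv (h / 2) u) x)

/-- The time slice of `∬ (∇ · ξ) (1 - u · G_h ∗ u) dx dt`. -/
def innerDivergence (h : ℝ) (u : Space → V) (ξ : Space → Space) : ℝ :=
  ∫ x in cell, divergence ξ x * (1 - inner ℝ (u x) (heatConv h u x))

/-- The time slice of `∬ ∂_i ξ_j ∂_i G_{h/2} ∗ u · ∂_j G_{h/2} ∗ u dx dt`. -/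
def innerStress (h : ℝ) (u : Space → V) (ξ : Space → Space) (i j : Fin 3) : ℝ :=
  ∫ x in cell, pderiv i ξ x j *
    inner ℝ (pderiv i (heatConv (h / 2) u) x) (pderiv j (heatConv (h / 2) u) x)

/-- The form `∫ a ∂_i G_{h/2} ∗ u · ∂_j G_{h/2} ∗ u dx`. -/
def gradientForm (h : ℝ) (u : Space → V) (a : Space → ℝ) (i j : Fin 3) : ℝ :=
  ∫ x in cell, a x * inner ℝ (pderiv i (heatConv (h / 2) u) x) (pderiv j (heatConv (h / 2) u) x)

/-- The form `∫ f (G_{h/2} ∗ w) · ∂_k G_{h/2} ∗ u dx`. -/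
def jumpTransport (h : ℝ) (u w : Space → V) (k : Fin 3) (f : Space → ℝ) : ℝ :=
  ∫ x in cell, f x * inner ℝ (heatConv (h / 2) w x) (pderiv k (heatConv (h / 2) u) x)

lemma innerStress_eq (hξ : C11Bound M ξ) (i j : Fin 3) :
    innerStress h u ξ i j = gradientForm h u (pderiv i fun y => ξ y j) i j := by
  unfold gradientForm
  simp_rw [pderiv_coord hξ.differentiable]
  rfl

lemma UnitMap.innerDivergence_eq (hu : UnitMap u) (hh : 0 < h) (hξ : C11Bound M ξ) :
    innerDivergence h u ξ =
      1 / 2 * ∑ k, ∫ x in cell, pderiv k (fun y => ξ y k) x * defect h u x := by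
  rw [← integral_finsetSum _ fun k _ =>
    (((hξ.coord k).boundedPeriodic_pderiv k).mul (hu.boundedPeriodic_defect hh)).integrable_cell,
    ← integral_const_mul]
  unfold innerDivergence divergence
  congr 1 with x
  simp_rw [pderiv_coord hξ.differentiable, ← Finset.sum_mul]
  unfold defect
  ring

lemma boundedPeriodic_pderiv_heatConv (hu : BoundedPeriodic u) (hh : 0 < h) (k : Fin 3) :
    BoundedPeriodic (pderiv k (heatConv h u)) := by
  rw [funext (hu.pderiv_heatConv hh k)]
  exact hu.convolution (integrable_gradKernel hh k)

lemma innerTransport_eq (hu : BoundedPeriodic u) (hv : BoundedPeriodic v) (hh : 0 < h)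
    (hξ : C11Bound M ξ) : innerTransport h u v ξ =
      h⁻¹ * ∑ k, jumpTransport h u (fun y => u y - v y) k fun y => ξ y k := by
  have hφ := (hu.sub hv).heatConv (half_pos hh)
  unfold jumpTransport
  rw [← integral_finsetSum _ fun k _ => ((hξ.coord k).boundedPeriodic.mul
    (hφ.inner (boundedPeriodic_pderiv_heatConv hu (half_pos hh) k))).integrable_cell,
    ← integral_const_mul]
  unfold innerTransport
  congr 1 with x
  rw [heatConv_eq_convolution, convolution_const_smul, real_inner_smul_left, inner_sum]
  simp_rw [real_inner_smul_right]
  rfl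

variable [CompleteSpace V]

lemma UnitMap.abs_transport_sub_add_jumpTransport_le (hu : UnitMap u) (hv : BoundedPeriodic v)
    (hh : 0 < h) (hf : C11Bound M f) (k : Fin 3) :
    |transport h u k f u - transport h u k f v + jumpTransport h u (fun y => u y - v y) k f| ≤
      6 * M * momentConst *
        ∫ x in cell, ‖heatConv (h / 2) (fun y => u y - v y) x‖ * √(defect h u x) := by
  have hjump := hu.boundedPeriodic.sub hv
  rw [← transport_sub hu.boundedPeriodic hu.boundedPeriodic hv hh hf, jumpTransport,
    transport_add_eq_doubleIntegral_commutatorKernel hu.boundedPeriodic hjump hh hf]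
  exact hu.abs_doubleIntegral_commutatorKernel_le (hjump.heatConv (half_pos hh)) hf hh k

lemma UnitMap.abs_sum_hessKernel_sub_gradientForm_le (hu : UnitMap u) (hh : 0 < h)
    (hf : C11Bound M f) (k : Fin 3) (hl : 1 ≤ l) :
    |∑ i, (doubleIntegral fun x z =>
        hessKernel h i k z * (pderiv i f x * ‖u (x - z) - u x‖ ^ 2)) -
      2 * ∑ i, gradientForm h u (pderiv i f) i k| ≤
      84 * M * momentConst ^ 2 / √h * ∫ x in cell, errorDensity l h u x := by
  rw [Finset.mul_sum, ← Finset.sum_sub_distrib]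
  refine (Finset.abs_sum_le_sum_abs _ _).trans <| (Finset.sum_le_sum fun i _ =>
    hu.abs_doubleIntegral_hessKernel_sub_le (hf.boundedPeriodic_pderiv i) hh hf.nonneg
      (hf.norm_pderiv_sub_le i) i k hl).trans_eq ?_
  rw [Finset.sum_const, Finset.card_univ, Fintype.card_fin, nsmul_eq_mul]
  push_cast
  ring

lemma UnitMap.abs_scalar_inner_variation_le (hu : UnitMap u) (hv : BoundedPeriodic v)
    (hh : 0 < h) (hf : C11Bound M f) (k : Fin 3) (hl : 1 ≤ l) :
    |2 / h * jumpTransport h u (fun y => u y - v y) k f -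
      (1 / h * (1 / 2 * ∫ x in cell, pderiv k f x * defect h u x) -
        2 * ∑ i, gradientForm h u (pderiv i f) i k) - 2 / h * transport h u k f v| ≤
      12 * M * momentConst / h *
        (∫ x in cell, ‖heatConv (h / 2) (fun y => u y - v y) x‖ * √(defect h u x)) +
      85 * M * momentConst ^ 2 / √h * ∫ x in cell, errorDensity l h u x := by
  have hM := hf.nonneg
  have hA := one_le_momentConst
  have hcommutator := hu.abs_transport_sub_add_jumpTransport_le hv hh hf k
  have htaylor := hu.abs_transport_self_sub_le hh hf k (zero_lt_one.trans_le hl)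
  have hstress := hu.abs_sum_hessKernel_sub_gradientForm_le hh hf k hl
  set J := jumpTransport h u (fun y => u y - v y) k f
  set D := ∫ x in cell, pderiv k f x * defect h u x
  set H := ∑ i, doubleIntegral fun x z =>
    hessKernel h i k z * (pderiv i f x * ‖u (x - z) - u x‖ ^ 2)
  set S := ∑ i, gradientForm h u (pderiv i f) i k
  set P := ∫ x in cell, ‖heatConv (h / 2) (fun y => u y - v y) x‖ * √(defect h u x)
  set Q := ∫ x in cell, errorDensity l h u x
  have hQ : 0 ≤ Q := integral_nonneg fun x =>
    (hu.defect_nonneg hh x).trans (hu.defect_le_errorDensity hh hl x)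
  have htaylor_le : 2 / h * (1 / 4 * (M * √h) * Q) ≤ M * momentConst ^ 2 / √h * Q := by
    calc 2 / h * (1 / 4 * (M * √h) * Q) = 1 / 2 * M * (√h / h) * Q := by ring
      _ = 1 / 2 * M * 1 / √h * Q := by rw [Real.sqrt_div_self', mul_one_div, mul_one]
      _ ≤ 1 * M * momentConst ^ 2 / √h * Q := by
          gcongr
          · norm_num
          · exact one_le_pow₀ hA
      _ = M * momentConst ^ 2 / √h * Q := by ring
  have hsplit : 2 / h * J - (1 / h * (1 / 2 * D) - 2 * S) - 2 / h * transport h u k f v =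
      2 / h * (transport h u k f u - transport h u k f v + J) -
        2 / h * (transport h u k f u - (-(1 / 4) * D + h / 2 * H)) - (H - 2 * S) := by
    field_simp
    ring
  rw [hsplit]
  refine (abs_sub _ _).trans ((add_le_add_left (abs_sub _ _) _).trans ?_)
  rw [abs_mul, abs_mul, abs_of_pos (by positivity : 0 < 2 / h)]
  calc _ ≤ 2 / h * (6 * M * momentConst * P) + 2 / h * (1 / 4 * (M * √h) * Q) +
        84 * M * momentConst ^ 2 / √h * Q := by gcongr
    _ ≤ 12 * M * momentConst / h * P + 85 * M * momentConst ^ 2 / √h * Q := by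
        linear_combination htaylor_le

lemma UnitMap.abs_inner_variation_le (hu : UnitMap u) (hv : BoundedPeriodic v) (hh : 0 < h)
    (hξ : C11Bound M ξ) (hl : 1 ≤ l) (hstationary : ∑ k, transport h u k (fun x => ξ x k) v = 0) :
    |2 * innerTransport h u v ξ -
      (1 / h * innerDivergence h u ξ - 2 * ∑ i, ∑ j, innerStress h u ξ i j)| ≤
      36 * M * momentConst / h *
        (∫ x in cell, ‖heatConv (h / 2) (fun y => u y - v y) x‖ * √(defect h u x)) +
      255 * M * momentConst ^ 2 / √h * ∫ x in cell, errorDensity l h u x := by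
  have hsum := (Finset.abs_sum_le_sum_abs _ Finset.univ).trans <| Finset.sum_le_sum fun k _ =>
    hu.abs_scalar_inner_variation_le hv hh (hξ.coord k) k hl
  simp only [Finset.sum_sub_distrib, ← Finset.mul_sum, hstationary, ← innerStress_eq hξ,
    ← hu.innerDivergence_eq hh hξ, mul_zero, sub_zero, Finset.sum_const, Finset.card_univ,
    Fintype.card_fin, nsmul_eq_mul] at hsum
  rw [innerTransport_eq hu.boundedPeriodic hv hh hξ, Finset.sum_comm, ← mul_assoc,
    ← div_eq_mul_inv]
  refine hsum.trans_eq ?_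
  push_cast
  ring

end InnerVariation

section StationaryStep

lemma exists_lipschitzWith_mul {α : Type*} [PseudoMetricSpace α] {f g : α → ℝ} {K L : NNReal}
    {C D : ℝ} (hf : LipschitzWith K f) (hg : LipschitzWith L g) (hC : ∀ x, ‖f x‖ ≤ C)
    (hD : ∀ x, ‖g x‖ ≤ D) : ∃ B, LipschitzWith B fun x => f x * g x := by
  refine ⟨(C * L + D * K).toNNReal, LipschitzWith.of_dist_le' fun x y => ?_⟩
  have hsplit : f x * g x - f y * g y = f x * (g x - g y) + g y * (f x - f y) := by ring
  have hdistf := hf.dist_le_mul x y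
  have hdistg := hg.dist_le_mul x y
  rw [Real.dist_eq] at hdistf hdistg
  calc dist (f x * g x) (f y * g y) = ‖f x * (g x - g y) + g y * (f x - f y)‖ := by
        rw [dist_eq_norm, hsplit]
    _ ≤ ‖f x‖ * |g x - g y| + ‖g y‖ * |f x - f y| :=
        (norm_add_le _ _).trans_eq (by rw [norm_mul, norm_mul, Real.norm_eq_abs (g x - g y),
          Real.norm_eq_abs (f x - f y)])
    _ ≤ C * (L * dist x y) + D * (K * dist x y) := by
        gcongr
        · exact (norm_nonneg _).trans (hC x)
        · exact hC x
        · exact (norm_nonneg _).trans (hD y)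
        · exact hD y
    _ = (C * L + D * K) * dist x y := by ring

variable {V : Type*} [NormedAddCommGroup V] [InnerProductSpace ℝ V]

section Calculus

variable {E : Type*} [NormedAddCommGroup E] [NormedSpace ℝ E] {W : E → V} {x : E}

lemma fderiv_eq_zero_of_differentiableAt_norm (h0 : W x = 0)
    (hnorm : DifferentiableAt ℝ (fun y => ‖W y‖) x) : fderiv ℝ W x = 0 := by
  have hmin : IsLocalMin (fun y => ‖W y‖) x := Eventually.of_forall fun y => by simp [h0]
  have hderiv := hnorm.hasFDerivAt
  rw [hmin.fderiv_eq_zero, hasFDerivAt_iff_isLittleO] at hderiv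
  refine HasFDerivAt.fderiv ?_
  rw [hasFDerivAt_iff_isLittleO]
  simpa [h0] using hderiv

lemma fderiv_norm_eq_inner {ν : V} (hν : ‖W x‖ • ν = W x) (hW : DifferentiableAt ℝ W x)
    (hnorm : DifferentiableAt ℝ (fun y => ‖W y‖) x) (e : E) :
    fderiv ℝ (fun y => ‖W y‖) x e = inner ℝ ν (fderiv ℝ W x e) := by
  by_cases h0 : W x = 0
  · have hmin : IsLocalMin (fun y => ‖W y‖) x := Eventually.of_forall fun y => by simp [h0]
    rw [hmin.fderiv_eq_zero, fderiv_eq_zero_of_differentiableAt_norm h0 hnorm]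
    simp
  · have hsq := congrArg (fun L : E →L[ℝ] ℝ => L e)
      (hW.hasFDerivAt.norm_sq.unique (hnorm.hasFDerivAt.pow 2))
    have hinner : inner ℝ (W x) (fderiv ℝ W x e) = ‖W x‖ * inner ℝ ν (fderiv ℝ W x e) := by
      conv_lhs => rw [← hν]
      rw [real_inner_smul_left]
    simp only [smul_apply, ContinuousLinearMap.comp_apply, innerSL_apply_apply, hinner,
      nsmul_eq_mul, smul_eq_mul, Nat.cast_ofNat, pow_one, Nat.add_one_sub_one] at hsq
    refine mul_left_cancel₀ (norm_ne_zero_iff.2 h0) ?_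
    linear_combination -(1 / 2) * hsq

end Calculus

variable {u v : Space → V} {f : Space → ℝ} {h M : ℝ}

lemma IsThresholdingStep.inner_eq_norm (hs : IsThresholdingStep h v u) (x : Space) :
    inner ℝ (u x) (heatConv h v x) = ‖heatConv h v x‖ := by
  by_cases h0 : heatConv h v x = 0
  · simp [h0]
  · refine mul_left_cancel₀ (norm_ne_zero_iff.2 h0) ?_
    rw [← real_inner_smul_left, hs.norm_smul, real_inner_self_eq_norm_mul_norm]

/-- The two integrands of `transport` add up to `∂_k (f ‖G_h ∗ v‖)`. -/
lemma IsThresholdingStep.transport_eq_zero (hs : IsThresholdingStep h v u)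
    (hu : BoundedPeriodic u) (hv : BoundedPeriodic v) (hh : 0 < h) (hf : C11Bound M f)
    (k : Fin 3) : transport h u k f v = 0 := by
  have hW := hv.heatConv hh
  obtain ⟨C, hC⟩ := hW.exists_bound
  obtain ⟨K, hK⟩ := hv.exists_lipschitzWith_heatConv hh
  have hnorm : LipschitzWith (1 * K) fun x => ‖heatConv h v x‖ := lipschitzWith_one_norm.comp hK
  obtain ⟨B, hB⟩ := exists_lipschitzWith_mul hf.lipschitzWith hnorm hf.norm_le
    fun x => (norm_norm _).trans_le (hC x)
  have hperiodic : PeriodicZ3 fun x => f x * ‖heatConv h v x‖ :=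
    hf.periodic.comp₂ hW.periodic fun a b => a * ‖b‖
  have hpderiv : pderiv k (heatConv h v) = gradKernel h k ⋆ v :=
    funext (hv.pderiv_heatConv hh k)
  have hintegrable : Integrable (fun x => f x * inner ℝ (u x) (pderiv k (heatConv h v) x))
      (volume.restrict cell) := by
    rw [hpderiv]
    exact (hf.boundedPeriodic.mul
      (hu.inner (hv.convolution (integrable_gradKernel hh k)))).integrable_cell
  unfold transport
  rw [← integral_add ((hf.boundedPeriodic_pderiv k).mul (hu.inner hW)).integrable_cell hintegrable]
  refine hperiodic.integral_lineDeriv_eq_zero hB (v := EuclideanSpace.single k 1) ?_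
  filter_upwards [hnorm.ae_differentiableAt] with x hx
  refine (((hf.differentiable x).hasFDerivAt.mul hx.hasFDerivAt).hasLineDerivAt _).congr_deriv ?_
  rw [hs.inner_eq_norm, add_apply, smul_apply, smul_apply,
    fderiv_norm_eq_inner (hs.norm_smul x) (hv.hasFDerivAt_heatConv hh x).differentiableAt hx]
  simp only [pderiv, smul_eq_mul]
  ring

end StationaryStep

section Dissipation

section InnerProduct

variable {V : Type*} [NormedAddCommGroup V] [InnerProductSpace ℝ V] {a b u v : Space → V} {h : ℝ}

lemma integrable_inner_heatConv (ha : BoundedPeriodic a) (hb : BoundedPeriodic b)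
    (hh : 0 < h) :
    Integrable (fun x => inner ℝ (a x) (heatConv h b x)) (volume.restrict cell) :=
  (ha.inner (hb.heatConv hh)).integrable_cell

lemma IsThresholdingStep.integral_inner_heatConv_le (hs : IsThresholdingStep h v u)
    (hu : UnitMap u) (hv : UnitMap v) (hh : 0 < h) :
    ∫ x in cell, inner ℝ (v x) (heatConv h v x) ≤ ∫ x in cell, inner ℝ (u x) (heatConv h v x) := by
  have hvr := hv.boundedPeriodic
  refine integral_mono (integrable_inner_heatConv hvr hvr hh)
    (integrable_inner_heatConv hu.boundedPeriodic hvr hh) fun x => ?_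
  calc inner ℝ (v x) (heatConv h v x) ≤ ‖v x‖ * ‖heatConv h v x‖ := real_inner_le_norm _ _
    _ = inner ℝ (u x) (heatConv h v x) := by rw [hv.norm_eq_one, one_mul, hs.inner_eq_norm]

variable [CompleteSpace V]

lemma integral_inner_heatConv_comm (ha : BoundedPeriodic a) (hb : BoundedPeriodic b)
    (hh : 0 < h) :
    ∫ x in cell, inner ℝ (a x) (heatConv h b x) = ∫ x in cell, inner ℝ (b x) (heatConv h a x) := by
  have hK := integrable_heatKernel hh
  have hab := integral_mul_inner_convolution hK (fun _ => 1) a hb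
  have hba := integral_mul_inner_convolution hK (fun _ => 1) b ha
  have hdominated := isDominatedIntegrand_mul_inner ha hb (BoundedPeriodic.const 1) hK
  simp only [one_mul] at hab hba hdominated
  rw [heatConv_eq_convolution, heatConv_eq_convolution, hab, hba,
    ← hdominated.doubleIntegral_comp_sub_neg]
  congr 1 with x z
  rw [heatKernel_neg, sub_neg_eq_add, sub_add_cancel, real_inner_comm]

lemma integral_norm_sq_heatConv_half (hu : BoundedPeriodic u) (hh : 0 < h) :
    ∫ x in cell, ‖heatConv (h / 2) u x‖ ^ 2 = ∫ x in cell, inner ℝ (u x) (heatConv h u x) := by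
  have hhalf := half_pos hh
  simp_rw [← real_inner_self_eq_norm_sq]
  rw [integral_inner_heatConv_comm (hu.heatConv hhalf) hu hhalf]
  simp_rw [heatConv_half_heatConv_half hu hh]

lemma integral_norm_sq_heatConv_half_sub (hu : BoundedPeriodic u) (hv : BoundedPeriodic v)
    (hh : 0 < h) :
    ∫ x in cell, ‖heatConv (h / 2) (fun y => u y - v y) x‖ ^ 2 =
      (∫ x in cell, inner ℝ (u x) (heatConv h u x)) -
        2 * (∫ x in cell, inner ℝ (u x) (heatConv h v x)) +
        ∫ x in cell, inner ℝ (v x) (heatConv h v x) := by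
  have hexpand (x : Space) : inner ℝ (u x - v x) (heatConv h (fun y => u y - v y) x) =
      (inner ℝ (u x) (heatConv h u x) - inner ℝ (u x) (heatConv h v x)) -
        (inner ℝ (v x) (heatConv h u x) - inner ℝ (v x) (heatConv h v x)) := by
    simp only [heatConv_eq_convolution]
    rw [convolution_sub hu hv (integrable_heatKernel hh), inner_sub_left, inner_sub_right,
      inner_sub_right]
  have huu := integrable_inner_heatConv hu hu hh
  have huv := integrable_inner_heatConv hu hv hh
  have hvu := integrable_inner_heatConv hv hu hh
  have hvv := integrable_inner_heatConv hv hv hh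
  have hfst : Integrable
      (fun x => inner ℝ (u x) (heatConv h u x) - inner ℝ (u x) (heatConv h v x))
      (volume.restrict cell) := huu.sub huv
  have hsnd : Integrable
      (fun x => inner ℝ (v x) (heatConv h u x) - inner ℝ (v x) (heatConv h v x))
      (volume.restrict cell) := hvu.sub hvv
  rw [integral_norm_sq_heatConv_half (hu.sub hv) hh, integral_congr_ae (ae_of_all _ hexpand),
    integral_sub hfst hsnd, integral_sub huu huv, integral_sub hvu hvv,
    integral_inner_heatConv_comm hv hu hh]
  ring

end InnerProduct

variable {u v : Space → Plane} {h : ℝ}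

lemma UnitMap.mul_energy (hu : UnitMap u) (hh : 0 < h) :
    h * energy h u = 1 - ∫ x in cell, inner ℝ (u x) (heatConv h u x) := by
  unfold energy
  rw [integral_sub (integrable_const 1)
    (integrable_inner_heatConv hu.boundedPeriodic hu.boundedPeriodic hh),
    one_div, mul_inv_cancel_left₀ hh.ne']
  simp

lemma UnitMap.energy_nonneg (hu : UnitMap u) (hh : 0 < h) : 0 ≤ energy h u := by
  have hdefect : 0 ≤ ∫ x in cell, defect h u x := integral_nonneg fun x => hu.defect_nonneg hh x
  rw [integral_defect hh u] at hdefect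
  exact nonneg_of_mul_nonneg_right hdefect (by positivity)

lemma IsThresholdingStep.integral_norm_sq_heatConv_half_sub_le (hs : IsThresholdingStep h v u)
    (hu : UnitMap u) (hv : UnitMap v) (hh : 0 < h) :
    ∫ x in cell, ‖heatConv (h / 2) (fun y => u y - v y) x‖ ^ 2 ≤
      h * (energy h v - energy h u) := by
  rw [integral_norm_sq_heatConv_half_sub hu.boundedPeriodic hv.boundedPeriodic hh, mul_sub,
    hu.mul_energy hh, hv.mul_energy hh]
  linarith [hs.integral_inner_heatConv_le hu hv hh]

lemma IsThresholdingStep.energy_le (hs : IsThresholdingStep h v u) (hu : UnitMap u)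
    (hv : UnitMap v) (hh : 0 < h) : energy h u ≤ energy h v := by
  have hdissipation : 0 ≤ h * (energy h v - energy h u) :=
    (integral_nonneg fun x => by positivity).trans
      (hs.integral_norm_sq_heatConv_half_sub_le hu hv hh)
  exact sub_nonneg.1 (nonneg_of_mul_nonneg_right hdissipation hh)

end Dissipation

section ExactScheme

variable {V : Type*} [NormedAddCommGroup V] {f g w : Space → V}

lemma convolution_congr_ae_right [NormedSpace ℝ V] (hfg : f =ᵐ[volume] g) (K : Space → ℝ) :
    K ⋆ f = K ⋆ g :=
  convolution_congr _ EventuallyEq.rfl hfg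

lemma heatConv_congr_ae [NormedSpace ℝ V] (hfg : f =ᵐ[volume] g) (h : ℝ) :
    heatConv h f = heatConv h g :=
  convolution_congr_ae_right hfg _

open Classical in
/-- The map `g` where it has unit norm, and `w` elsewhere. -/
def unitize (g w : Space → V) (x : Space) : V :=
  if ‖g x‖ = 1 then g x else w x

lemma unitize_of_norm_eq_one {x : Space} (hx : ‖g x‖ = 1) (w : Space → V) :
    unitize g w x = g x :=
  if_pos hx

lemma unitMap_unitize (hperiodic : PeriodicZ3 g) (hmeas : AEStronglyMeasurable g volume)
    (hw : UnitMap w) : UnitMap (unitize g w) where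
  periodic k x := by
    unfold unitize
    rw [hperiodic k x, hw.periodic k x]
  aestronglyMeasurable := by
    refine ⟨unitize (hmeas.mk g) (hw.aestronglyMeasurable.mk w), StronglyMeasurable.ite ?_
      hmeas.stronglyMeasurable_mk hw.aestronglyMeasurable.stronglyMeasurable_mk, ?_⟩
    · exact hmeas.stronglyMeasurable_mk.norm.measurable (measurableSet_singleton 1)
    · filter_upwards [hmeas.ae_eq_mk, hw.aestronglyMeasurable.ae_eq_mk] with x hgx hwx
      unfold unitize
      rw [hgx, hwx]
  norm_eq_one x := by
    unfold unitize
    split_ifs with hx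
    · exact hx
    · exact hw.norm_eq_one x

lemma ae_eq_unitize (hg : ∀ᵐ x : Space, ‖g x‖ = 1) (w : Space → V) :
    g =ᵐ[volume] unitize g w := by
  filter_upwards [hg] with x hx
  rw [unitize_of_norm_eq_one hx]

variable [InnerProductSpace ℝ V] {h : ℝ}

/-- A thresholding scheme all of whose defining conditions hold at every point. -/
structure IsExactScheme (h : ℝ) (u : ℕ → Space → V) : Prop where
  unitMap : ∀ n, UnitMap (u n)
  step : ∀ n, IsThresholdingStep h (u n) (u (n + 1))

/-- One thresholding step from `v`, with the values of `w` where `G_h ∗ v` vanishes. -/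
def thresholdingStep (h : ℝ) (v w : Space → V) : Space → V :=
  unitize (fun x => (‖heatConv h v x‖)⁻¹ • heatConv h v x) w

lemma isThresholdingStep_thresholdingStep (h : ℝ) (v w : Space → V) :
    IsThresholdingStep h v (thresholdingStep h v w) :=
  fun _ hx => unitize_of_norm_eq_one (g := fun x => (‖heatConv h v x‖)⁻¹ • heatConv h v x)
    (norm_smul_inv_norm (𝕜 := ℝ) hx) w

lemma unitMap_thresholdingStep {v : Space → V} (hv : BoundedPeriodic v) (hw : UnitMap w)
    (hh : 0 < h) : UnitMap (thresholdingStep h v w) := by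
  have hW := hv.heatConv hh
  refine unitMap_unitize (hW.periodic.comp fun y => (‖y‖)⁻¹ • y) ?_ hw
  exact hW.aestronglyMeasurable.norm.aemeasurable.inv.aestronglyMeasurable.smul
    hW.aestronglyMeasurable

lemma ae_eq_thresholdingStep {v : Space → V}
    (hstep : ∀ᵐ x : Space, heatConv h v x ≠ 0 → w x = (‖heatConv h v x‖)⁻¹ • heatConv h v x) :
    w =ᵐ[volume] thresholdingStep h v w := by
  filter_upwards [hstep] with x hx
  by_cases h0 : heatConv h v x = 0
  · simp [thresholdingStep, unitize, h0]
  · rw [isThresholdingStep_thresholdingStep h v w x h0, hx h0]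

/-- Modifying every map of an almost everywhere thresholding scheme on a null set does not change
its heat convolutions, so that the pointwise conditions can be restored one map at a time. -/
lemma exists_isExactScheme_ae_eq {v : ℕ → Space → V} (hv : ∀ n, UnitMap (v n)) (hh : 0 < h)
    (hstep : ∀ n, ∀ᵐ x : Space, heatConv h (v n) x ≠ 0 →
      v (n + 1) x = (‖heatConv h (v n) x‖)⁻¹ • heatConv h (v n) x) :
    ∃ w : ℕ → Space → V, IsExactScheme h w ∧ ∀ n, v n =ᵐ[volume] w n := by
  let w : ℕ → Space → V
    | 0 => v 0
    | n + 1 => thresholdingStep h (v n) (v (n + 1))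
  have hae : ∀ n, v n =ᵐ[volume] w n
    | 0 => EventuallyEq.rfl
    | n + 1 => ae_eq_thresholdingStep (hstep n)
  have hunit : ∀ n, UnitMap (w n)
    | 0 => hv 0
    | n + 1 => unitMap_thresholdingStep (hv n).boundedPeriodic (hv (n + 1)) hh
  refine ⟨w, ⟨hunit, fun n => ?_⟩, hae⟩
  unfold IsThresholdingStep
  rw [← heatConv_congr_ae (hae n) h]
  exact isThresholdingStep_thresholdingStep h (v n) (v (n + 1))

end ExactScheme

section Scheme

variable {h : ℝ} {u : ℕ → Space → Plane}

lemma IsThresholdingScheme.exists_isExactScheme_ae_eq (hu : IsThresholdingScheme h u)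
    (hh : 0 < h) : ∃ w : ℕ → Space → Plane, IsExactScheme h w ∧ ∀ n, u n =ᵐ[volume] w n := by
  have hconst : UnitMap fun _ : Space => (EuclideanSpace.single 0 1 : Plane) :=
    ⟨fun _ _ => rfl, aestronglyMeasurable_const, fun _ => by simp⟩
  have hae (n : ℕ) := ae_eq_unitize (hu.unit n) fun _ => EuclideanSpace.single 0 1
  obtain ⟨w, hw, hvw⟩ := FilamentThresholding.exists_isExactScheme_ae_eq
    (fun n => unitMap_unitize (hu.periodic n) (hu.measurable n) hconst) hh fun n => by
      rw [← heatConv_congr_ae (hae n) h]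
      filter_upwards [hu.step n, hae (n + 1)] with x hx hxae
      rw [← hxae]
      exact hx
  exact ⟨w, hw, fun n => (hae n).trans (hvw n)⟩

lemma IsExactScheme.energy_antitone (hu : IsExactScheme h u) (hh : 0 < h) :
    Antitone fun n => energy h (u n) :=
  antitone_nat_of_succ_le fun n => (hu.step n).energy_le (hu.unitMap _) (hu.unitMap _) hh

end Scheme

section SmoothOnTorus

namespace IsSmoothOnTorus

variable {E : Type*} [NormedAddCommGroup E] [NormedSpace ℝ E] {T : ℝ} {f : ℝ → Space → E}

lemma exists_bound (hf : IsSmoothOnTorus T f) : ∃ M, ∀ t ∈ Set.Icc 0 T, ∀ x, ‖f t x‖ ≤ M := by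
  have hcompact : IsCompact (Set.Icc 0 T ×ˢ Metric.closedBall (0 : Space) 3) :=
    isCompact_Icc.prod (isCompact_closedBall _ _)
  obtain ⟨M, hM⟩ := hcompact.exists_bound_of_continuousOn
    (hf.1.continuousOn.mono (Set.prod_mono_right (Set.subset_univ _)))
  refine ⟨M, fun t ht x => ?_⟩
  obtain ⟨y, hy, hxy⟩ := (hf.2 t ht).exists_mem_closedBall_eq x
  rw [hxy]
  exact hM (t, y) ⟨ht, hy⟩

lemma hasFDerivAt (hf : IsSmoothOnTorus T f) {t : ℝ} (ht : t ∈ Set.Icc 0 T) (x : Space) :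
    HasFDerivAt (f t)
      ((fderivWithin ℝ (fun p : ℝ × Space => f p.1 p.2) (Set.Icc 0 T ×ˢ Set.univ) (t, x)).comp
        (ContinuousLinearMap.inr ℝ ℝ Space)) x := by
  have houter := (hf.1.differentiableOn (by simp) (t, x) ⟨ht, trivial⟩).hasFDerivWithinAt
  have hinner : HasFDerivAt (fun y : Space => ((t, y) : ℝ × Space))
      (ContinuousLinearMap.inr ℝ ℝ Space) x := hasFDerivAt_prodMk_right t x
  rw [← hasFDerivWithinAt_univ] at hinner ⊢
  exact houter.comp x hinner fun y _ => ⟨ht, trivial⟩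

lemma continuousOn_time (hf : IsSmoothOnTorus T f) (x : Space) :
    ContinuousOn (fun t => f t x) (Set.Icc 0 T) :=
  hf.1.continuousOn.comp (f := fun t : ℝ => ((t, x) : ℝ × Space)) (by fun_prop)
    fun _ ht => ⟨ht, trivial⟩

lemma fderiv (hT : 0 < T) (hf : IsSmoothOnTorus T f) :
    IsSmoothOnTorus T fun t => fderiv ℝ (f t) := by
  constructor
  · have hunique : UniqueDiffOn ℝ (Set.Icc 0 T ×ˢ (Set.univ : Set Space)) :=
      (uniqueDiffOn_Icc hT).prod uniqueDiffOn_univ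
    have hsmooth := hf.1.fderivWithin (m := ∞) hunique (by simp)
    exact (hsmooth.clm_comp
      (contDiffOn_const (c := ContinuousLinearMap.inr ℝ ℝ Space))).congr fun p hp =>
        (hf.hasFDerivAt hp.1 p.2).fderiv
  · intro t ht k x
    have htranslate : f t = fun y => f t (y + EuclideanSpace.single k 1) :=
      funext fun y => (hf.2 t ht k y).symm
    dsimp only
    conv_rhs => rw [htranslate]
    rw [fderiv_comp_add_right]

lemma exists_c11Bound (hT : 0 < T) (hf : IsSmoothOnTorus T f) :
    ∃ M, ∀ t ∈ Set.Icc 0 T, C11Bound M (f t) := by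
  obtain ⟨M₀, h₀⟩ := hf.exists_bound
  obtain ⟨M₁, h₁⟩ := (hf.fderiv hT).exists_bound
  obtain ⟨M₂, h₂⟩ := ((hf.fderiv hT).fderiv hT).exists_bound
  refine ⟨max M₀ (max M₁ M₂), fun t ht =>
    ⟨hf.2 t ht, fun x => (hf.hasFDerivAt ht x).differentiableAt,
      fun x => (h₀ t ht x).trans (le_max_left _ _),
      fun x => (h₁ t ht x).trans ((le_max_left _ _).trans (le_max_right _ _)), fun x y => ?_⟩⟩
  have hlipschitz := convex_univ.norm_image_sub_le_of_norm_fderiv_le (𝕜 := ℝ)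
    (fun x _ => ((hf.fderiv hT).hasFDerivAt ht x).differentiableAt)
    (fun x _ => h₂ t ht x) (Set.mem_univ y) (Set.mem_univ x)
  refine hlipschitz.trans ?_
  gcongr
  exact (le_max_right _ _).trans (le_max_right _ _)

lemma continuousOn_pderiv (hT : 0 < T) (hf : IsSmoothOnTorus T f) (k : Fin 3) (x : Space) :
    ContinuousOn (fun t => pderiv k (f t) x) (Set.Icc 0 T) :=
  ((hf.fderiv hT).continuousOn_time x).clm_apply continuousOn_const

end IsSmoothOnTorus

/-- Families of measurable functions that are uniformly bounded and depend continuously on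
`t ∈ [0, T]` at every point. -/
structure BoundedFamily (T : ℝ) (F : ℝ → Space → ℝ) : Prop where
  aestronglyMeasurable : ∀ t ∈ Set.Icc 0 T, AEStronglyMeasurable (F t) volume
  exists_bound : ∃ M, ∀ t ∈ Set.Icc 0 T, ∀ x, |F t x| ≤ M
  continuousOn : ∀ x, ContinuousOn (fun t => F t x) (Set.Icc 0 T)

namespace BoundedFamily

variable {T : ℝ} {F H : ℝ → Space → ℝ}

lemma mul (hF : BoundedFamily T F) (hH : BoundedFamily T H) :
    BoundedFamily T fun t x => F t x * H t x where
  aestronglyMeasurable t ht := (hF.aestronglyMeasurable t ht).mul (hH.aestronglyMeasurable t ht)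
  exists_bound := by
    obtain ⟨M, hM⟩ := hF.exists_bound
    obtain ⟨N, hN⟩ := hH.exists_bound
    refine ⟨M * N, fun t ht x => ?_⟩
    rw [abs_mul]
    exact mul_le_mul (hM t ht x) (hN t ht x) (abs_nonneg _) ((abs_nonneg _).trans (hM t ht x))
  continuousOn x := (hF.continuousOn x).mul (hH.continuousOn x)

lemma sum {ι : Type*} [Fintype ι] {G : ι → ℝ → Space → ℝ} (hG : ∀ i, BoundedFamily T (G i)) :
    BoundedFamily T fun t x => ∑ i, G i t x where
  aestronglyMeasurable t ht :=
    Finset.aestronglyMeasurable_fun_sum _ fun i _ => (hG i).aestronglyMeasurable t ht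
  exists_bound := by
    choose M hM using fun i => (hG i).exists_bound
    exact ⟨∑ i, M i, fun t ht x => (Finset.abs_sum_le_sum_abs _ _).trans
      (Finset.sum_le_sum fun i _ => hM i t ht x)⟩
  continuousOn x := continuousOn_finsetSum _ fun i _ => (hG i).continuousOn x

lemma continuousOn_integral (hF : BoundedFamily T F) :
    ContinuousOn (fun t => ∫ x in cell, F t x) (Set.Icc 0 T) := by
  obtain ⟨M, hM⟩ := hF.exists_bound
  exact continuousOn_of_dominated (bound := fun _ => M)
    (fun t ht => (hF.aestronglyMeasurable t ht).restrict)
    (fun t ht => Eventually.of_forall fun x => hM t ht x) (integrable_const _)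
    (Eventually.of_forall hF.continuousOn)

end BoundedFamily

lemma BoundedPeriodic.boundedFamily {a : Space → ℝ} (ha : BoundedPeriodic a) (T : ℝ) :
    BoundedFamily T fun _ => a :=
  ⟨fun _ _ => ha.aestronglyMeasurable, let ⟨M, hM⟩ := ha.exists_bound; ⟨M, fun _ _ x => hM x⟩,
    fun _ => continuousOn_const⟩

end SmoothOnTorus

section TimeSteps

lemma floor_div_eq_iff_mem_Ico {h t : ℝ} (hh : 0 < h) (ht : 0 ≤ t) {n : ℕ} :
    ⌊t / h⌋₊ = n ↔ t ∈ Set.Ico (n * h) ((n + 1) * h) := by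
  rw [Nat.floor_eq_iff (by positivity), le_div_iff₀ hh, div_lt_iff₀ hh, Set.mem_Ico]

lemma floor_sub_div {h : ℝ} (hh : 0 < h) (t : ℝ) : ⌊(t - h) / h⌋₊ = ⌊t / h⌋₊ - 1 := by
  rw [sub_div, div_self hh.ne', Nat.floor_sub_one]

lemma floor_add_div {h t : ℝ} (hh : 0 < h) (ht : 0 ≤ t) : ⌊(t + h) / h⌋₊ = ⌊t / h⌋₊ + 1 := by
  rw [add_div, div_self hh.ne', Nat.floor_add_one (by positivity)]

lemma sum_indicator_floor {h T t : ℝ} (hh : 0 < h) (ht : t ∈ Set.Icc 0 T) (Φ : ℕ → ℝ → ℝ) :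
    ∑ n ∈ Finset.range (⌊T / h⌋₊ + 1), (Set.Ico (n * h) ((n + 1) * h)).indicator (Φ n) t =
      Φ ⌊t / h⌋₊ t := by
  have hmem : ⌊t / h⌋₊ ∈ Finset.range (⌊T / h⌋₊ + 1) := by
    rw [Finset.mem_range, Nat.lt_succ_iff]
    exact Nat.floor_le_floor (by gcongr; exact ht.2)
  rw [Finset.sum_eq_single_of_mem _ hmem]
  · exact Set.indicator_of_mem ((floor_div_eq_iff_mem_Ico hh ht.1).1 rfl) _
  · intro n _ hn
    refine Set.indicator_of_notMem (fun htn => hn ?_) _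
    exact ((floor_div_eq_iff_mem_Ico hh ht.1).2 htn).symm

lemma intervalIntegrable_floor {h T : ℝ} (hh : 0 < h) (hT : 0 ≤ T) {Φ : ℕ → ℝ → ℝ}
    (hΦ : ∀ n, ContinuousOn (Φ n) (Set.Icc 0 T)) :
    IntervalIntegrable (fun t => Φ ⌊t / h⌋₊ t) volume 0 T := by
  rw [intervalIntegrable_iff_integrableOn_Ioc_of_le hT]
  have hsum : IntegrableOn (fun t => ∑ n ∈ Finset.range (⌊T / h⌋₊ + 1),
      (Set.Ico (n * h) ((n + 1) * h)).indicator (Φ n) t) (Set.Ioc 0 T) :=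
    integrable_finsetSum _ fun n _ =>
      (((hΦ n).integrableOn_compact isCompact_Icc).mono_set Set.Ioc_subset_Icc_self).indicator
        measurableSet_Ico
  exact hsum.congr_fun (fun t ht => sum_indicator_floor hh ⟨ht.1.le, ht.2⟩ Φ) measurableSet_Ioc

lemma abs_intervalIntegral_floor_le {h T : ℝ} (hh : 0 < h) (hT : 0 ≤ T) {S : ℝ → ℝ} {β : ℕ → ℝ}
    (hβ : ∀ n, 0 ≤ β n) (hS : ∀ t ∈ Set.Icc 0 T, |S t| ≤ β ⌊t / h⌋₊) :
    |∫ t in (0 : ℝ)..T, S t| ≤ h * ∑ n ∈ Finset.range (⌊T / h⌋₊ + 1), β n := by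
  rw [intervalIntegral.integral_of_le hT, ← Real.norm_eq_abs]
  let step (n : ℕ) : ℝ → ℝ := (Set.Ico (n * h) ((n + 1) * h)).indicator fun _ => β n
  have hint : ∀ n ∈ Finset.range (⌊T / h⌋₊ + 1), Integrable (step n) := fun n _ =>
    (integrable_indicator_iff measurableSet_Ico).2 (integrableOn_const (by simp))
  have hlength (n : ℕ) : ((n + 1) * h : ℝ) - n * h = h := by ring
  have hstep (n : ℕ) : ∫ t, step n t = h * β n := by
    rw [integral_indicator measurableSet_Ico, setIntegral_const,
      Real.volume_real_Ico_of_le (by linarith [hlength n]), hlength, smul_eq_mul]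
  have hbound : ∀ᵐ t ∂volume.restrict (Set.Ioc 0 T),
      ‖S t‖ ≤ ∑ n ∈ Finset.range (⌊T / h⌋₊ + 1), step n t :=
    (ae_restrict_iff' measurableSet_Ioc).2 (Eventually.of_forall fun t ht =>
      (hS t ⟨ht.1.le, ht.2⟩).trans_eq
        (sum_indicator_floor hh ⟨ht.1.le, ht.2⟩ fun n _ => β n).symm)
  calc ‖∫ t in Set.Ioc 0 T, S t‖
      ≤ ∫ t in Set.Ioc 0 T, ∑ n ∈ Finset.range (⌊T / h⌋₊ + 1), step n t :=
        norm_integral_le_of_norm_le (integrable_finsetSum _ hint).integrableOn hbound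
    _ ≤ ∫ t, ∑ n ∈ Finset.range (⌊T / h⌋₊ + 1), step n t :=
        setIntegral_le_integral (integrable_finsetSum _ hint) (Eventually.of_forall fun t =>
          Finset.sum_nonneg fun n _ => Set.indicator_nonneg (fun _ _ => hβ n) _)
    _ = h * ∑ n ∈ Finset.range (⌊T / h⌋₊ + 1), β n := by
        rw [integral_finsetSum _ hint, Finset.mul_sum]
        exact Finset.sum_congr rfl fun n _ => hstep n

end TimeSteps

section CongrAe

variable {T h : ℝ} {W W' : ℝ → Space → Plane}

lemma diffQuot_congr_ae (hW : ∀ t, W t =ᵐ[volume] W' t) (τ t : ℝ) :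
    diffQuot τ W t =ᵐ[volume] diffQuot τ W' t := by
  filter_upwards [hW t, hW (t - τ)] with x hx hxτ
  unfold diffQuot
  rw [hx, hxτ]

lemma innerLHS_congr_ae (hW : ∀ t, W t =ᵐ[volume] W' t) (ξ : ℝ → Space → Space) :
    innerLHS T h W ξ = innerLHS T h W' ξ := by
  unfold innerLHS
  simp_rw [fun t => heatConv_congr_ae (hW t), fun t => heatConv_congr_ae (diffQuot_congr_ae hW h t)]

lemma innerRHS_congr_ae (hW : ∀ t, W t =ᵐ[volume] W' t) (ξ : ℝ → Space → Space) :
    innerRHS T h W ξ = innerRHS T h W' ξ := by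
  unfold innerRHS spaceTimeIntegral
  simp_rw [fun t => heatConv_congr_ae (hW t)]
  congr 3
  ext t
  refine integral_congr_ae ?_
  filter_upwards [ae_restrict_of_ae (hW t)] with x hx
  rw [hx]

lemma outerForm_congr_ae (hW : ∀ t, W t =ᵐ[volume] W' t) (τ : ℝ) (ζ : ℝ → Space → ℝ)
    (i j : Fin 2) : outerForm T h τ W ζ i j = outerForm T h τ W' ζ i j := by
  have hconv (m : Fin 2) (t : ℝ) :
      heatConv h (fun y => W t y m) = heatConv h fun y => W' t y m :=
    heatConv_congr_ae ((hW t).mono fun x hx => by simp only [hx]) h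
  unfold outerForm spaceTimeIntegral
  simp only [hconv]
  congr 1
  ext t
  refine integral_congr_ae ?_
  filter_upwards [ae_restrict_of_ae (hW t)] with x hx
  rw [hx]

lemma energy_congr_ae {u v : Space → Plane} (huv : u =ᵐ[volume] v) :
    energy h u = energy h v := by
  unfold energy
  rw [heatConv_congr_ae huv]
  congr 1
  refine integral_congr_ae ?_
  filter_upwards [ae_restrict_of_ae huv] with x hx
  rw [hx]

end CongrAe

section DefectIntegrals

variable {u : Space → Plane} {h : ℝ}

lemma UnitMap.integral_errorDensity (hu : UnitMap u) (hh : 0 < h) (l : ℝ) :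
    ∫ x in cell, errorDensity l h u x = l * (2 * h * energy h u) + 4 * momentConst / l ^ 3 := by
  unfold errorDensity
  rw [integral_add ((hu.integrable_defect hh).const_mul l) (integrable_const _), integral_const_mul,
    integral_defect hh]
  simp

lemma UnitMap.integral_sqrt_defect_le (hu : UnitMap u) (hh : 0 < h) :
    ∫ x in cell, √(defect h u x) ≤ √h * (energy h u + 1) := by
  have hint := ((hu.integrable_defect hh).const_mul ((√h)⁻¹ / 2)).add
    (integrable_const (√h / 2) (μ := volume.restrict cell))
  have hpoint (x : Space) : √(defect h u x) ≤ (√h)⁻¹ / 2 * defect h u x + √h / 2 := by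
    have hyoung := two_mul_le_add_mul_sq (a := √(defect h u x)) (b := 1)
      (inv_pos.2 (Real.sqrt_pos.2 hh))
    rw [Real.sq_sqrt (hu.defect_nonneg hh x), inv_inv] at hyoung
    linarith
  calc ∫ x in cell, √(defect h u x)
      ≤ ∫ x in cell, ((√h)⁻¹ / 2 * defect h u x + √h / 2) :=
        integral_mono (hu.integrable_sqrt_defect hh) hint hpoint
    _ = (√h)⁻¹ / 2 * (2 * h * energy h u) + √h / 2 := by
        rw [integral_add ((hu.integrable_defect hh).const_mul _) (integrable_const _),
          integral_const_mul, integral_defect hh]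
        simp
    _ = √h * (energy h u + 1 / 2) := by
        field_simp
        rw [Real.sq_sqrt hh.le]
        ring
    _ ≤ √h * (energy h u + 1) := by gcongr; norm_num

lemma UnitMap.integral_norm_mul_sqrt_defect_le {V : Type*} [NormedAddCommGroup V]
    {φ : Space → V} {r : ℝ} (hu : UnitMap u) (hφ : BoundedPeriodic φ) (hh : 0 < h) (hr : 0 < r) :
    ∫ x in cell, ‖φ x‖ * √(defect h u x) ≤
      1 / (2 * r) * (∫ x in cell, ‖φ x‖ ^ 2) + r * (h * energy h u) := by
  have hφ2 : Integrable (fun x => ‖φ x‖ ^ 2) (volume.restrict cell) := by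
    simpa only [sq] using (hφ.norm.mul hφ.norm).integrable_cell
  have hint := (hφ2.const_mul (1 / (2 * r))).add ((hu.integrable_defect hh).const_mul (r / 2))
  have hpoint (x : Space) : ‖φ x‖ * √(defect h u x) ≤
      1 / (2 * r) * ‖φ x‖ ^ 2 + r / 2 * defect h u x := by
    have hyoung := two_mul_le_add_mul_sq (a := √(defect h u x)) (b := ‖φ x‖) hr
    rw [Real.sq_sqrt (hu.defect_nonneg hh x)] at hyoung
    rw [one_div, mul_inv]
    linarith
  refine (integral_mono_of_nonneg (Eventually.of_forall fun x => by positivity) hint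
    (Eventually.of_forall hpoint)).trans_eq ?_
  simp only [Pi.add_apply]
  rw [integral_add (hφ2.const_mul _) ((hu.integrable_defect hh).const_mul _), integral_const_mul,
    integral_const_mul, integral_defect hh]
  ring

end DefectIntegrals

section InnerStep

variable {u v : Space → Plane} {h s M : ℝ} {ξ : Space → Space}

lemma sqrt_eq_sq_of_pow_four_eq (hsh : s ^ 4 = h) : √h = s ^ 2 := by
  rw [← hsh, show s ^ 4 = (s ^ 2) ^ 2 by ring, Real.sqrt_sq (by positivity)]

/-- With `s = h^{1/4}`, the errors balance for the weights `s²` in Young's inequality and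
`l = 1 / s` in `errorDensity`. -/
lemma inner_variation_error_le {A D e : ℝ} (hs : 0 < s) (hs1 : s ≤ 1) (hM : 0 ≤ M) (hA : 1 ≤ A)
    (hD : 0 ≤ D) (he : 0 ≤ e) :
    36 * M * A / s ^ 4 * (1 / (2 * s ^ 2) * (s ^ 4 * D) + s ^ 2 * (s ^ 4 * e)) +
        255 * M * A ^ 2 / s ^ 2 * (1 / s * (2 * s ^ 4 * e) + 4 * A / (1 / s) ^ 3) ≤
      1100 * M * A ^ 3 * (D / s ^ 2 + s * (e + 1)) := by
  have hA13 : A ≤ A ^ 3 := le_self_pow₀ hA (by norm_num)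
  have hA23 : A ^ 2 ≤ A ^ 3 := pow_le_pow_right₀ hA (by norm_num)
  have hlast : 0 ≤ M * A ^ 3 * (1082 * (D / s ^ 2) + 554 * (s * e) + 80 * s) := by positivity
  calc _ = M * (18 * A * (D / s ^ 2) + 36 * A * (s * s * e) + 510 * A ^ 2 * (s * e) +
        1020 * A ^ 3 * s) := by field_simp; ring
    _ ≤ M * (18 * A ^ 3 * (D / s ^ 2) + 36 * A ^ 3 * (1 * s * e) + 510 * A ^ 3 * (s * e) +
        1020 * A ^ 3 * s) := by gcongr
    _ ≤ 1100 * M * A ^ 3 * (D / s ^ 2 + s * (e + 1)) := by linear_combination hlast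

lemma IsThresholdingStep.abs_inner_variation_le (hst : IsThresholdingStep h v u) (hu : UnitMap u)
    (hv : UnitMap v) (hs : 0 < s) (hs1 : s ≤ 1) (hsh : s ^ 4 = h) (hξ : C11Bound M ξ) :
    |2 * innerTransport h u v ξ -
      (1 / h * innerDivergence h u ξ - 2 * ∑ i, ∑ j, innerStress h u ξ i j)| ≤
      1100 * M * momentConst ^ 3 *
        ((energy h v - energy h u) / s ^ 2 + s * (energy h u + 1)) := by
  have hh : 0 < h := hsh ▸ pow_pos hs 4
  have hM := hξ.nonneg
  have hA := one_le_momentConst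
  have hstationary : ∑ k, transport h u k (fun x => ξ x k) v = 0 := Finset.sum_eq_zero fun k _ =>
    hst.transport_eq_zero hu.boundedPeriodic hv.boundedPeriodic hh (hξ.coord k) k
  have hvariation := hu.abs_inner_variation_le hv.boundedPeriodic hh hξ
    ((one_le_div hs).2 hs1) hstationary
  have hjump : ∫ x in cell, ‖heatConv (h / 2) (fun y => u y - v y) x‖ * √(defect h u x) ≤
      1 / (2 * s ^ 2) * (h * (energy h v - energy h u)) + s ^ 2 * (h * energy h u) := by
    refine (hu.integral_norm_mul_sqrt_defect_le
      ((hu.boundedPeriodic.sub hv.boundedPeriodic).heatConv (half_pos hh)) hh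
      (pow_pos hs 2)).trans ?_
    gcongr
    exact hst.integral_norm_sq_heatConv_half_sub_le hu hv hh
  rw [hu.integral_errorDensity hh, sqrt_eq_sq_of_pow_four_eq hsh] at hvariation
  refine hvariation.trans (le_trans ?_ (inner_variation_error_le hs hs1 hM hA
    (sub_nonneg.2 (hst.energy_le hu hv hh)) (hu.energy_nonneg hh)))
  rw [hsh]
  gcongr

lemma innerTransport_self (h : ℝ) (u : Space → Plane) (ξ : Space → Space) :
    innerTransport h u u ξ = 0 := by
  have hzero : heatConv (h / 2) (fun y => h⁻¹ • (u y - u y)) = 0 := by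
    simp only [sub_self, smul_zero]
    exact convolution_zero
  simp only [innerTransport, hzero, Pi.zero_apply, inner_zero_left, integral_zero]

lemma abs_pderiv_apply_le (hξ : C11Bound M ξ) (i j : Fin 3) (x : Space) :
    |pderiv i ξ x j| ≤ M :=
  (PiLp.norm_apply_le _ j).trans (hξ.norm_pderiv_le i x)

lemma abs_divergence_le (hξ : C11Bound M ξ) (x : Space) : |divergence ξ x| ≤ 3 * M :=
  (Finset.abs_sum_le_sum_abs _ _).trans <|
    (Finset.sum_le_sum fun k _ => abs_pderiv_apply_le hξ k k x).trans_eq (by simp)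

lemma UnitMap.abs_innerDivergence_le (hu : UnitMap u) (hh : 0 < h) (hξ : C11Bound M ξ) :
    |innerDivergence h u ξ| ≤ 3 * M * (h * energy h u) := by
  have hintegral : 3 * M * (h * energy h u) = ∫ x in cell, 3 * M / 2 * defect h u x := by
    rw [integral_const_mul, integral_defect hh]
    ring
  rw [hintegral, ← Real.norm_eq_abs]
  refine norm_integral_le_of_norm_le ((hu.integrable_defect hh).const_mul _)
    (Eventually.of_forall fun x => ?_)
  have hdefect : 1 - inner ℝ (u x) (heatConv h u x) = defect h u x / 2 := by
    unfold defect
    ring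
  have hdefect_nonneg := hu.defect_nonneg hh x
  rw [hdefect, norm_mul, Real.norm_of_nonneg (div_nonneg hdefect_nonneg two_pos.le)]
  calc ‖divergence ξ x‖ * (defect h u x / 2) ≤ 3 * M * (defect h u x / 2) := by
        gcongr
        exact abs_divergence_le hξ x
    _ = 3 * M / 2 * defect h u x := by ring

lemma UnitMap.abs_innerStress_le (hu : UnitMap u) (hh : 0 < h) (hξ : C11Bound M ξ)
    (i j : Fin 3) : |innerStress h u ξ i j| ≤ 18 * M * momentConst ^ 2 * energy h u := by
  have hM := hξ.nonneg
  have hintegral : 18 * M * momentConst ^ 2 * energy h u =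
      ∫ x in cell, 9 * M * momentConst ^ 2 / h * defect h u x := by
    rw [integral_const_mul, integral_defect hh]
    field_simp
    ring
  rw [hintegral, ← Real.norm_eq_abs]
  refine norm_integral_le_of_norm_le ((hu.integrable_defect hh).const_mul _)
    (Eventually.of_forall fun x => ?_)
  set g := 3 / √h * momentConst * √(defect h u x)
  have hgrad (k : Fin 3) : ‖pderiv k (heatConv (h / 2) u) x‖ ≤ g := by
    rw [hu.boundedPeriodic.pderiv_heatConv (half_pos hh)]
    exact hu.norm_gradKernel_half_convolution_le hh k x
  calc ‖pderiv i ξ x j *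
        inner ℝ (pderiv i (heatConv (h / 2) u) x) (pderiv j (heatConv (h / 2) u) x)‖
      ≤ M * (g * g) := by
        rw [norm_mul]
        gcongr
        · exact abs_pderiv_apply_le hξ i j x
        · exact (norm_inner_le_norm _ _).trans
            (mul_le_mul (hgrad i) (hgrad j) (norm_nonneg _) ((norm_nonneg _).trans (hgrad i)))
    _ = M * (9 / √h ^ 2 * momentConst ^ 2 * √(defect h u x) ^ 2) := by ring
    _ = 9 * M * momentConst ^ 2 / h * defect h u x := by
        rw [Real.sq_sqrt hh.le, Real.sq_sqrt (hu.defect_nonneg hh x)]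
        ring

lemma UnitMap.abs_inner_variation_self_le (hu : UnitMap u) (hh : 0 < h) (hξ : C11Bound M ξ) :
    |2 * innerTransport h u u ξ -
      (1 / h * innerDivergence h u ξ - 2 * ∑ i, ∑ j, innerStress h u ξ i j)| ≤
      327 * M * momentConst ^ 2 * energy h u := by
  have hM := hξ.nonneg
  have hE := hu.energy_nonneg hh
  have hdivergence : |1 / h * innerDivergence h u ξ| ≤ 3 * M * momentConst ^ 2 * energy h u := by
    rw [abs_mul, abs_of_pos (one_div_pos.2 hh)]
    calc 1 / h * |innerDivergence h u ξ| ≤ 1 / h * (3 * M * (h * energy h u)) := by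
          gcongr
          exact hu.abs_innerDivergence_le hh hξ
      _ = 3 * M * 1 * energy h u := by field_simp
      _ ≤ 3 * M * momentConst ^ 2 * energy h u := by
          gcongr
          exact one_le_pow₀ one_le_momentConst
  have hstress : |∑ i, ∑ j, innerStress h u ξ i j| ≤ 162 * M * momentConst ^ 2 * energy h u := by
    calc |∑ i, ∑ j, innerStress h u ξ i j|
        ≤ ∑ _i : Fin 3, ∑ _j : Fin 3, 18 * M * momentConst ^ 2 * energy h u :=
          (Finset.abs_sum_le_sum_abs _ _).trans <| Finset.sum_le_sum fun i _ =>
            (Finset.abs_sum_le_sum_abs _ _).trans <| Finset.sum_le_sum fun j _ =>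
              hu.abs_innerStress_le hh hξ i j
      _ = 162 * M * momentConst ^ 2 * energy h u := by
          simp only [Finset.sum_const, Finset.card_univ, Fintype.card_fin, nsmul_eq_mul]
          ring
  rw [innerTransport_self, mul_zero, zero_sub, abs_neg]
  refine (abs_sub _ _).trans ?_
  rw [abs_mul 2, abs_two]
  linarith

end InnerStep

section TimeSummation

lemma sum_range_pred_sub (E : ℕ → ℝ) (N : ℕ) :
    ∑ n ∈ Finset.range (N + 1), (E (n - 1) - E n) = E 0 - E N := by
  rw [Finset.sum_range_succ']
  simp only [Nat.add_sub_cancel, Finset.sum_range_sub', Nat.zero_sub, sub_self, add_zero]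

/-- The error budget of the `n`-th time step for an energy profile `E`: the energy dissipated in the
step (truncation makes it vanish for `n = 0`), a small multiple of the initial
energy, and a large contribution of the first step alone. -/
def errorBudget (E : ℕ → ℝ) (s : ℝ) (n : ℕ) : ℝ :=
  (E (n - 1) - E n) / s ^ 2 + s * (E 0 + 1) + if n = 0 then E 0 + 1 else 0

variable {E : ℕ → ℝ} {T h s K : ℝ}

lemma le_errorBudget (hE : Antitone E) (hE0 : 0 ≤ E 0) (n : ℕ) :
    s * (E 0 + 1) ≤ errorBudget E s n := by
  have hdrop : 0 ≤ (E (n - 1) - E n) / s ^ 2 :=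
    div_nonneg (sub_nonneg.2 (hE (Nat.sub_le n 1))) (sq_nonneg s)
  have hfirst : 0 ≤ if n = 0 then E 0 + 1 else 0 := by split_ifs <;> positivity
  unfold errorBudget
  linarith

lemma le_errorBudget_zero (hE0 : 0 ≤ E 0) (hs : 0 ≤ s) : E 0 + 1 ≤ errorBudget E s 0 := by
  have hsmall : 0 ≤ s * (E 0 + 1) := by positivity
  simp only [errorBudget, Nat.zero_sub, sub_self, zero_div, zero_add, if_true]
  linarith

lemma sum_errorBudget (E : ℕ → ℝ) (s : ℝ) (N : ℕ) :
    ∑ n ∈ Finset.range (N + 1), errorBudget E s n =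
      (E 0 - E N) / s ^ 2 + (N + 1) * (s * (E 0 + 1)) + (E 0 + 1) := by
  simp only [errorBudget, Finset.sum_add_distrib, ← Finset.sum_div, sum_range_pred_sub,
    Finset.sum_const, Finset.card_range, nsmul_eq_mul, Nat.cast_add_one, Finset.sum_ite_eq',
    Finset.mem_range, Nat.succ_pos, if_true]

lemma abs_intervalIntegral_le_of_errorBudget (hT : 0 ≤ T) (hs : 0 < s) (hs1 : s ≤ 1)
    (hsh : s ^ 4 = h) (hK : 0 ≤ K) (hE : Antitone E) (hE0 : ∀ n, 0 ≤ E n) {S : ℝ → ℝ}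
    (hS : ∀ t ∈ Set.Icc 0 T, |S t| ≤ K * errorBudget E s ⌊t / h⌋₊) :
    |∫ t in (0 : ℝ)..T, S t| ≤ K * (T + 3) * (s * (E 0 + 1)) := by
  have hh : 0 < h := hsh ▸ pow_pos hs 4
  have h0 := hE0 0
  have hbudget (n : ℕ) : 0 ≤ K * errorBudget E s n :=
    mul_nonneg hK (le_trans (by positivity) (le_errorBudget hE h0 n))
  set N := ⌊T / h⌋₊
  have hN : N * h ≤ T := (le_div_iff₀ hh).1 (Nat.floor_le (by positivity))
  have hhs : h ≤ s := hsh ▸ pow_le_of_le_one hs.le hs1 (by norm_num)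
  have hs2 : s ^ 2 ≤ s := pow_le_of_le_one hs.le hs1 (by norm_num)
  have hdrop : 0 ≤ E 0 - E N := sub_nonneg.2 (hE (Nat.zero_le N))
  calc |∫ t in (0 : ℝ)..T, S t| ≤ h * ∑ n ∈ Finset.range (N + 1), K * errorBudget E s n :=
        abs_intervalIntegral_floor_le hh hT hbudget hS
    _ = K * (s ^ 2 * (E 0 - E N) + (N * h + h) * (s * (E 0 + 1)) + h * (E 0 + 1)) := by
        rw [← Finset.mul_sum, sum_errorBudget, ← hsh]
        field_simp
    _ ≤ K * (s * (E 0 - 0) + (T + 1) * (s * (E 0 + 1)) + s * (E 0 + 1)) := by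
        gcongr
        · exact hE0 N
        · exact hhs.trans hs1
    _ ≤ K * (T + 3) * (s * (E 0 + 1)) := by linear_combination K * hs.le

end TimeSummation

section TimeRegularity

variable {T h : ℝ} {ξ : ℝ → Space → Space}

lemma IsSmoothOnTorus.boundedFamily_coord (hT : 0 < T) (hξ : IsSmoothOnTorus T ξ) (k : Fin 3) :
    BoundedFamily T fun t x => ξ t x k := by
  obtain ⟨M, hM⟩ := hξ.exists_c11Bound hT
  exact ⟨fun t ht => ((hM t ht).coord k).boundedPeriodic.aestronglyMeasurable,
    ⟨M, fun t ht x => ((hM t ht).coord k).norm_le x⟩, fun x =>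
      (EuclideanSpace.proj k : Space →L[ℝ] ℝ).continuous.comp_continuousOn
        (hξ.continuousOn_time x)⟩

lemma IsSmoothOnTorus.boundedFamily_pderiv_coord (hT : 0 < T) (hξ : IsSmoothOnTorus T ξ)
    (i k : Fin 3) : BoundedFamily T fun t x => pderiv i (ξ t) x k := by
  obtain ⟨M, hM⟩ := hξ.exists_c11Bound hT
  refine ⟨fun t ht => ?_, ⟨M, fun t ht x => abs_pderiv_apply_le (hM t ht) i k x⟩, fun x =>
    (EuclideanSpace.proj k : Space →L[ℝ] ℝ).continuous.comp_continuousOn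
      (hξ.continuousOn_pderiv hT i x)⟩
  simp_rw [← pderiv_coord (hM t ht).differentiable]
  exact (((hM t ht).coord k).boundedPeriodic_pderiv i).aestronglyMeasurable

variable {V : Type*} [NormedAddCommGroup V] [InnerProductSpace ℝ V] {u v : Space → V}

lemma continuousOn_innerDivergence (hT : 0 < T) (hξ : IsSmoothOnTorus T ξ)
    (hu : BoundedPeriodic u) (hh : 0 < h) :
    ContinuousOn (fun t => innerDivergence h u (ξ t)) (Set.Icc 0 T) :=
  ((BoundedFamily.sum fun k => hξ.boundedFamily_pderiv_coord hT k k).mul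
    (((BoundedPeriodic.const 1).sub
      (hu.inner (hu.heatConv hh))).boundedFamily T)).continuousOn_integral

lemma continuousOn_innerTransport (hT : 0 < T) (hξ : IsSmoothOnTorus T ξ) (hu : BoundedPeriodic u)
    (hv : BoundedPeriodic v) (hh : 0 < h) :
    ContinuousOn (fun t => innerTransport h u v (ξ t)) (Set.Icc 0 T) := by
  unfold innerTransport
  simp_rw [inner_sum, inner_smul_right]
  have hjump := ((BoundedPeriodic.const h⁻¹).smul (hu.sub hv)).heatConv (half_pos hh)
  exact (BoundedFamily.sum fun k => (hξ.boundedFamily_coord hT k).mul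
    ((hjump.inner (boundedPeriodic_pderiv_heatConv hu (half_pos hh) k)).boundedFamily
      T)).continuousOn_integral

lemma continuousOn_innerStress (hT : 0 < T) (hξ : IsSmoothOnTorus T ξ) (hu : BoundedPeriodic u)
    (hh : 0 < h) (i j : Fin 3) :
    ContinuousOn (fun t => innerStress h u (ξ t) i j) (Set.Icc 0 T) :=
  ((hξ.boundedFamily_pderiv_coord hT i j).mul
    (((boundedPeriodic_pderiv_heatConv hu (half_pos hh) i).inner
      (boundedPeriodic_pderiv_heatConv hu (half_pos hh) j)).boundedFamily
        T)).continuousOn_integral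

end TimeRegularity

section TimeSlices

variable {h s M : ℝ} {w : ℕ → Space → Plane} {ξ : Space → Space} {ζ : Space → ℝ}

lemma IsExactScheme.energy_nonneg (hw : IsExactScheme h w) (hh : 0 < h) (n : ℕ) :
    0 ≤ energy h (w n) :=
  (hw.unitMap n).energy_nonneg hh

lemma IsExactScheme.abs_inner_variation_le (hw : IsExactScheme h w) (hs : 0 < s) (hs1 : s ≤ 1)
    (hsh : s ^ 4 = h) (hξ : C11Bound M ξ) (n : ℕ) :
    |2 * innerTransport h (w n) (w (n - 1)) ξ -
      (1 / h * innerDivergence h (w n) ξ - 2 * ∑ i, ∑ j, innerStress h (w n) ξ i j)| ≤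
      1100 * M * momentConst ^ 3 * errorBudget (fun n => energy h (w n)) s n := by
  have hh : 0 < h := hsh ▸ pow_pos hs 4
  have hM := hξ.nonneg
  have hA := one_le_momentConst
  have h0 := hw.energy_nonneg hh 0
  cases n with
  | zero =>
    refine ((hw.unitMap 0).abs_inner_variation_self_le hh hξ).trans ?_
    gcongr
    · norm_num
    · norm_num
    · exact (le_add_of_nonneg_right zero_le_one).trans
        (le_errorBudget_zero (E := fun n => energy h (w n)) h0 hs.le)
  | succ m =>
    refine ((hw.step m).abs_inner_variation_le (hw.unitMap _) (hw.unitMap _) hs hs1 hsh hξ).trans ?_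
    simp only [errorBudget, Nat.add_sub_cancel, Nat.succ_ne_zero, if_false, add_zero]
    gcongr
    exact hw.energy_antitone hh (Nat.zero_le _)

lemma IsExactScheme.integral_sqrt_defect_le (hw : IsExactScheme h w) (hs : 0 < s) (hs1 : s ≤ 1)
    (hsh : s ^ 4 = h) (n : ℕ) :
    ∫ x in cell, √(defect h (w n) x) ≤ s * (energy h (w 0) + 1) := by
  have hh : 0 < h := hsh ▸ pow_pos hs 4
  refine ((hw.unitMap n).integral_sqrt_defect_le hh).trans ?_
  rw [sqrt_eq_sq_of_pow_four_eq hsh]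
  have hn := hw.energy_nonneg hh n
  gcongr
  · exact pow_le_of_le_one hs.le hs1 two_ne_zero
  · exact hw.energy_antitone hh (Nat.zero_le n)

lemma IsExactScheme.abs_integral_outerIntegrand_backward_le (hw : IsExactScheme h w) (hs : 0 < s)
    (hs1 : s ≤ 1) (hsh : s ^ 4 = h) (hζ : C11Bound M ζ) (i j : Fin 2) (n : ℕ) :
    |∫ x in cell, outerIntegrand h h (w n) (w (n - 1)) ζ i j x| ≤
      6 * M * momentConst * errorBudget (fun n => energy h (w n)) s n := by
  have hh : 0 < h := hsh ▸ pow_pos hs 4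
  have hM := hζ.nonneg
  have hA := one_le_momentConst
  have h0 := hw.energy_nonneg hh 0
  cases n with
  | zero =>
    calc |∫ x in cell, outerIntegrand h h (w 0) (w 0) ζ i j x|
        ≤ 6 * M / √h * momentConst * ∫ x in cell, √(defect h (w 0) x) :=
          (hw.unitMap 0).abs_integral_outerIntegrand_self_le hh hζ h i j
      _ ≤ 6 * M / √h * momentConst * (√h * (energy h (w 0) + 1)) := by
          gcongr
          exact (hw.unitMap 0).integral_sqrt_defect_le hh
      _ = 6 * M * momentConst * (energy h (w 0) + 1) := by field_simp
      _ ≤ 6 * M * momentConst * errorBudget (fun n => energy h (w n)) s 0 := by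
          gcongr
          exact le_errorBudget_zero (E := fun n => energy h (w n)) h0 hs.le
  | succ m =>
    calc |∫ x in cell, outerIntegrand h h (w (m + 1)) (w m) ζ i j x|
        ≤ M * momentConst * ∫ x in cell, √(defect h (w (m + 1)) x) :=
          (hw.step m).abs_integral_outerIntegrand_backward_le
            (hw.unitMap _) (hw.unitMap _) hh hζ i j
      _ ≤ 6 * M * momentConst * (s * (energy h (w 0) + 1)) := by
          gcongr
          · exact le_mul_of_one_le_left hM (by norm_num)
          · exact hw.integral_sqrt_defect_le hs hs1 hsh _
      _ ≤ 6 * M * momentConst * errorBudget (fun n => energy h (w n)) s (m + 1) := by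
          gcongr
          exact le_errorBudget (hw.energy_antitone hh) h0 _

lemma IsExactScheme.abs_integral_outerIntegrand_forward_le (hw : IsExactScheme h w) (hs : 0 < s)
    (hs1 : s ≤ 1) (hsh : s ^ 4 = h) (hζ : C11Bound M ζ) (i j : Fin 2) (n : ℕ) :
    |∫ x in cell, outerIntegrand h (-h) (w n) (w (n + 1)) ζ i j x| ≤
      15 * M * momentConst ^ 2 * errorBudget (fun n => energy h (w n)) s n := by
  have hh : 0 < h := hsh ▸ pow_pos hs 4
  have hM := hζ.nonneg
  have hA := one_le_momentConst
  have h0 := hw.energy_nonneg hh 0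
  have hdefect : (∫ x in cell, defect h (w n) x) / √h ≤ 2 * (s * (energy h (w 0) + 1)) := by
    calc (∫ x in cell, defect h (w n) x) / √h = 2 * (s ^ 2 * energy h (w n)) := by
          rw [integral_defect hh, sqrt_eq_sq_of_pow_four_eq hsh, ← hsh]
          field_simp
      _ ≤ 2 * (s * (energy h (w 0) + 1)) := by
          gcongr
          · exact hw.energy_nonneg hh n
          · exact pow_le_of_le_one hs.le hs1 two_ne_zero
          · exact (hw.energy_antitone hh (Nat.zero_le n)).trans (by simp)
  calc |∫ x in cell, outerIntegrand h (-h) (w n) (w (n + 1)) ζ i j x|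
      ≤ 5 * M * momentConst ^ 2 *
          ∫ x in cell, (√(defect h (w n) x) + defect h (w n) x / √h) :=
        (hw.step n).abs_integral_outerIntegrand_forward_le (hw.unitMap _) (hw.unitMap _) hh hζ i j
    _ = 5 * M * momentConst ^ 2 *
          ((∫ x in cell, √(defect h (w n) x)) + (∫ x in cell, defect h (w n) x) / √h) := by
        rw [integral_add ((hw.unitMap n).integrable_sqrt_defect hh)
          (((hw.unitMap n).integrable_defect hh).div_const _), integral_div]
    _ ≤ 5 * M * momentConst ^ 2 *
          (s * (energy h (w 0) + 1) + 2 * (s * (energy h (w 0) + 1))) := by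
        gcongr
        exact hw.integral_sqrt_defect_le hs hs1 hsh n
    _ = 15 * M * momentConst ^ 2 * (s * (energy h (w 0) + 1)) := by ring
    _ ≤ 15 * M * momentConst ^ 2 * errorBudget (fun n => energy h (w n)) s n := by
        gcongr
        exact le_errorBudget (hw.energy_antitone hh) h0 n

end TimeSlices

section SpaceTime

variable {T h s M : ℝ} {w : ℕ → Space → Plane} {ξ : ℝ → Space → Space} {ζ : ℝ → Space → ℝ}

lemma interpolation_sub (hh : 0 < h) (t : ℝ) :
    interpolation h w (t - h) = w (⌊t / h⌋₊ - 1) := by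
  ext1 x
  rw [interpolation, floor_sub_div hh]

lemma interpolation_add (hh : 0 < h) {t : ℝ} (ht : 0 ≤ t) :
    interpolation h w (t + h) = w (⌊t / h⌋₊ + 1) := by
  ext1 x
  rw [interpolation, floor_add_div hh ht]

lemma innerLHS_interpolation (hh : 0 < h) :
    innerLHS T h (interpolation h w) ξ =
      2 * ∫ t in (0 : ℝ)..T, innerTransport h (w ⌊t / h⌋₊) (w (⌊t / h⌋₊ - 1)) (ξ t) := by
  have hquot (t : ℝ) : diffQuot h (interpolation h w) t =
      fun y => h⁻¹ • (w ⌊t / h⌋₊ y - w (⌊t / h⌋₊ - 1) y) := by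
    ext1 y
    rw [diffQuot, interpolation_sub hh]
    rfl
  simp only [innerLHS, spaceTimeIntegral, hquot]
  rfl

lemma IsExactScheme.innerLHS_sub_innerRHS_eq (hw : IsExactScheme h w) (hT : 0 < T) (hh : 0 < h)
    (hξ : IsSmoothOnTorus T ξ) :
    innerLHS T h (interpolation h w) ξ - innerRHS T h (interpolation h w) ξ =
      ∫ t in (0 : ℝ)..T, (2 * innerTransport h (w ⌊t / h⌋₊) (w (⌊t / h⌋₊ - 1)) (ξ t) -
        (1 / h * innerDivergence h (w ⌊t / h⌋₊) (ξ t) -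
          2 * ∑ i, ∑ j, innerStress h (w ⌊t / h⌋₊) (ξ t) i j)) := by
  have hbdd (n : ℕ) := (hw.unitMap n).boundedPeriodic
  have htransport := intervalIntegrable_floor hh hT.le fun n =>
    continuousOn_innerTransport hT hξ (hbdd n) (hbdd (n - 1)) hh
  have hdivergence := intervalIntegrable_floor hh hT.le fun n =>
    continuousOn_innerDivergence hT hξ (hbdd n) hh
  have hstress (i j : Fin 3) := intervalIntegrable_floor hh hT.le fun n =>
    continuousOn_innerStress hT hξ (hbdd n) hh i j
  have hstress_row (i : Fin 3) := intervalIntegrable_floor hh hT.le fun n =>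
    continuousOn_finsetSum Finset.univ fun j _ => continuousOn_innerStress hT hξ (hbdd n) hh i j
  have hstress_sum := intervalIntegrable_floor hh hT.le fun n =>
    continuousOn_finsetSum Finset.univ fun i _ => continuousOn_finsetSum Finset.univ fun j _ =>
      continuousOn_innerStress hT hξ (hbdd n) hh i j
  rw [intervalIntegral.integral_sub (htransport.const_mul 2)
      ((hdivergence.const_mul _).sub (hstress_sum.const_mul 2)),
    intervalIntegral.integral_sub (hdivergence.const_mul _) (hstress_sum.const_mul 2),
    intervalIntegral.integral_const_mul, intervalIntegral.integral_const_mul,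
    intervalIntegral.integral_const_mul,
    intervalIntegral.integral_finsetSum fun i _ => hstress_row i, innerLHS_interpolation hh]
  simp_rw [fun i => intervalIntegral.integral_finsetSum (s := Finset.univ) fun j _ => hstress i j]
  rfl

lemma IsExactScheme.abs_innerLHS_sub_innerRHS_le (hw : IsExactScheme h w) (hT : 0 < T)
    (hs : 0 < s) (hs1 : s ≤ 1) (hsh : s ^ 4 = h) (hξ : IsSmoothOnTorus T ξ)
    (hbound : ∀ t ∈ Set.Icc 0 T, C11Bound M (ξ t)) :
    |innerLHS T h (interpolation h w) ξ - innerRHS T h (interpolation h w) ξ| ≤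
      1100 * M * momentConst ^ 3 * (T + 3) * (s * (energy h (w 0) + 1)) := by
  have hh : 0 < h := hsh ▸ pow_pos hs 4
  have hM := (hbound 0 (Set.left_mem_Icc.2 hT.le)).nonneg
  have hA := momentConst_pos
  rw [hw.innerLHS_sub_innerRHS_eq hT hh hξ]
  exact abs_intervalIntegral_le_of_errorBudget hT.le hs hs1 hsh (by positivity)
    (hw.energy_antitone hh) (hw.energy_nonneg hh) fun t ht =>
      hw.abs_inner_variation_le hs hs1 hsh (hbound t ht) ⌊t / h⌋₊

lemma outerForm_interpolation_backward (hh : 0 < h) (i j : Fin 2) :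
    outerForm T h h (interpolation h w) ζ i j = ∫ t in (0 : ℝ)..T, ∫ x in cell,
      outerIntegrand h h (w ⌊t / h⌋₊) (w (⌊t / h⌋₊ - 1)) (ζ t) i j x := by
  simp only [outerForm, spaceTimeIntegral, diffQuot, interpolation_sub hh]
  rfl

lemma outerForm_interpolation_forward (hh : 0 < h) (hT : 0 ≤ T) (i j : Fin 2) :
    outerForm T h (-h) (interpolation h w) ζ i j = ∫ t in (0 : ℝ)..T, ∫ x in cell,
      outerIntegrand h (-h) (w ⌊t / h⌋₊) (w (⌊t / h⌋₊ + 1)) (ζ t) i j x := by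
  refine intervalIntegral.integral_congr fun t ht => ?_
  rw [Set.uIcc_of_le hT] at ht
  simp only [diffQuot, sub_neg_eq_add, interpolation_add hh ht.1]
  rfl

lemma IsExactScheme.abs_outerForm_backward_le (hw : IsExactScheme h w) (hT : 0 ≤ T) (hs : 0 < s)
    (hs1 : s ≤ 1) (hsh : s ^ 4 = h)
    (hbound : ∀ t ∈ Set.Icc 0 T, C11Bound M (ζ t)) (i j : Fin 2) :
    |outerForm T h h (interpolation h w) ζ i j| ≤
      6 * M * momentConst * (T + 3) * (s * (energy h (w 0) + 1)) := by
  have hh : 0 < h := hsh ▸ pow_pos hs 4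
  have hM := (hbound 0 (Set.left_mem_Icc.2 hT)).nonneg
  have hA := momentConst_pos
  rw [outerForm_interpolation_backward hh]
  exact abs_intervalIntegral_le_of_errorBudget hT hs hs1 hsh (by positivity)
    (hw.energy_antitone hh) (hw.energy_nonneg hh) fun t ht =>
      hw.abs_integral_outerIntegrand_backward_le hs hs1 hsh (hbound t ht) i j ⌊t / h⌋₊

lemma IsExactScheme.abs_outerForm_forward_le (hw : IsExactScheme h w) (hT : 0 ≤ T) (hs : 0 < s)
    (hs1 : s ≤ 1) (hsh : s ^ 4 = h)
    (hbound : ∀ t ∈ Set.Icc 0 T, C11Bound M (ζ t)) (i j : Fin 2) :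
    |outerForm T h (-h) (interpolation h w) ζ i j| ≤
      15 * M * momentConst ^ 2 * (T + 3) * (s * (energy h (w 0) + 1)) := by
  have hh : 0 < h := hsh ▸ pow_pos hs 4
  have hM := (hbound 0 (Set.left_mem_Icc.2 hT)).nonneg
  have hA := momentConst_pos
  rw [outerForm_interpolation_forward hh hT]
  exact abs_intervalIntegral_le_of_errorBudget hT hs hs1 hsh (by positivity)
    (hw.energy_antitone hh) (hw.energy_nonneg hh) fun t ht =>
      hw.abs_integral_outerIntegrand_forward_le hs hs1 hsh (hbound t ht) i j ⌊t / h⌋₊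

end SpaceTime

section SmallTimeSteps

lemma tendsto_rpow_mul_abs_log (C : ℝ) :
    Tendsto (fun h : ℝ => h ^ (1 / 4 : ℝ) * (C * |Real.log h| + 1)) (𝓝[>] 0) (𝓝 0) := by
  have hlog := (tendsto_log_mul_rpow_nhdsGT_zero (r := 1 / 4) (by norm_num)).abs
  have hpow : Tendsto (fun h : ℝ => h ^ (1 / 4 : ℝ)) (𝓝[>] 0) (𝓝 0) := by
    have hcont := (Real.continuousAt_rpow_const 0 (1 / 4) (Or.inr (by norm_num))).tendsto
    rw [Real.zero_rpow (by norm_num)] at hcont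
    exact hcont.mono_left nhdsWithin_le_nhds
  have hsum := (hlog.const_mul C).add hpow
  rw [abs_zero, mul_zero, add_zero] at hsum
  refine hsum.congr' ?_
  filter_upwards [self_mem_nhdsWithin] with h hh
  rw [abs_mul, abs_of_pos (Real.rpow_pos_of_pos hh _)]
  ring

lemma tendsto_zero_of_abs_le_rpow_mul_energy {e X : ℝ → ℝ} {C K : ℝ} (hK : 0 ≤ K)
    (he : ∀ᶠ h : ℝ in 𝓝[>] 0, e h ≤ C * |Real.log h|)
    (hX : ∀ h s : ℝ, 0 < s → s ≤ 1 → s ^ 4 = h → |X h| ≤ K * (s * (e h + 1))) :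
    Tendsto X (𝓝[>] 0) (𝓝 0) := by
  have hlim := (tendsto_rpow_mul_abs_log C).const_mul K
  rw [mul_zero] at hlim
  refine squeeze_zero_norm' ?_ hlim
  filter_upwards [he, Ioo_mem_nhdsGT zero_lt_one] with h hlog ⟨hh, hh1⟩
  have hroot : (h ^ (1 / 4 : ℝ)) ^ 4 = h := by
    rw [← Real.rpow_natCast, ← Real.rpow_mul hh.le]
    norm_num
  calc ‖X h‖ ≤ K * (h ^ (1 / 4 : ℝ) * (e h + 1)) :=
        hX h _ (Real.rpow_pos_of_pos hh _) (Real.rpow_le_one hh.le hh1.le (by norm_num)) hroot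
    _ ≤ K * (h ^ (1 / 4 : ℝ) * (C * |Real.log h| + 1)) := by gcongr

lemma tendsto_zero_of_exactScheme_bound {u : ℝ → ℕ → Space → Plane} {C K : ℝ}
    {F : ℝ → (ℝ → Space → Plane) → ℝ}
    (hu : ∀ h : ℝ, 0 < h → IsThresholdingScheme h (u h))
    (hE : ∀ᶠ h : ℝ in 𝓝[>] 0, energy h (u h 0) ≤ C * |Real.log h|) (hK : 0 ≤ K)
    (hcongr : ∀ h W W', (∀ t, W t =ᵐ[volume] W' t) → F h W = F h W')
    (hF : ∀ h s w, 0 < s → s ≤ 1 → s ^ 4 = h → IsExactScheme h w →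
      |F h (interpolation h w)| ≤ K * (s * (energy h (w 0) + 1))) :
    Tendsto (fun h => F h (interpolation h (u h))) (𝓝[>] 0) (𝓝 0) := by
  refine tendsto_zero_of_abs_le_rpow_mul_energy hK hE fun h s hs hs1 hsh => ?_
  have hh : 0 < h := hsh ▸ pow_pos hs 4
  obtain ⟨w, hw, huw⟩ := (hu h hh).exists_isExactScheme_ae_eq hh
  rw [hcongr h (interpolation h (u h)) (interpolation h w) fun t => huw _, energy_congr_ae (huw 0)]
  exact hF h s w hs hs1 hsh hw

end SmallTimeSteps

end

end FilamentThresholding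

theorem lemma2p8
    (T : ℝ) (hT : 0 < T)
    (u : ℝ → ℕ → Space → Plane)
    (hu : ∀ h : ℝ, 0 < h → IsThresholdingScheme h (u h))
    (C : ℝ)
    (hE : ∀ᶠ h : ℝ in 𝓝[>] 0, energy h (u h 0) ≤ C * |Real.log h|) :
    (∀ ξ : ℝ → Space → Space, IsSmoothOnTorus T ξ →
      Tendsto (fun h : ℝ => innerLHS T h (interpolation h (u h)) ξ -
        innerRHS T h (interpolation h (u h)) ξ) (𝓝[>] 0) (𝓝 0)) ∧
    (∀ ζ : ℝ → Space → ℝ, IsSmoothOnTorus T ζ → ∀ i j : Fin 2,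
      Tendsto (fun h : ℝ => outerForm T h h (interpolation h (u h)) ζ i j) (𝓝[>] 0) (𝓝 0) ∧
      Tendsto (fun h : ℝ => outerForm T h (-h) (interpolation h (u h)) ζ i j)
        (𝓝[>] 0) (𝓝 0)) := by
  refine ⟨fun ξ hξ => ?_, fun ζ hζ i j => ?_⟩
  · obtain ⟨M, hbound⟩ := hξ.exists_c11Bound hT
    have hM : 0 ≤ M := (hbound 0 (Set.left_mem_Icc.2 hT.le)).nonneg
    have hA := momentConst_pos
    exact tendsto_zero_of_exactScheme_bound
      (F := fun h W => innerLHS T h W ξ - innerRHS T h W ξ)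
      (K := 1100 * M * momentConst ^ 3 * (T + 3)) hu hE (by positivity)
      (fun h W W' hW => by rw [innerLHS_congr_ae hW, innerRHS_congr_ae hW])
      fun h s w hs hs1 hsh hw => hw.abs_innerLHS_sub_innerRHS_le hT hs hs1 hsh hξ hbound
  · obtain ⟨M, hbound⟩ := hζ.exists_c11Bound hT
    have hM : 0 ≤ M := (hbound 0 (Set.left_mem_Icc.2 hT.le)).nonneg
    have hA := momentConst_pos
    constructor
    · exact tendsto_zero_of_exactScheme_bound (F := fun h W => outerForm T h h W ζ i j)
        (K := 6 * M * momentConst * (T + 3)) hu hE (by positivity)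
        (fun h W W' hW => outerForm_congr_ae hW h ζ i j)
        fun h s w hs hs1 hsh hw => hw.abs_outerForm_backward_le hT.le hs hs1 hsh hbound i j
    · exact tendsto_zero_of_exactScheme_bound (F := fun h W => outerForm T h (-h) W ζ i j)
        (K := 15 * M * momentConst ^ 2 * (T + 3)) hu hE (by positivity)
        (fun h W W' hW => outerForm_congr_ae hW (-h) ζ i j)
        fun h s w hs hs1 hsh hw => hw.abs_outerForm_forward_le hT.le hs hs1 hsh hbound i j
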